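/- **Setting.** Let $p$ be a prime, let $V$ be a complete discrete valuation ring of mixed characteristic with maximal ideal $pV$ and perfect residue field of characteristic $p$, let $d\ge 1$, and let $R=V[[x_2,\dots,x_d]]$ with maximal ideal $\mathfrak m=(p,x_2,\dots,x_d)$. Put $R_e=V[p^{1/p^e}][[x_2^{1/p^e},\dots,x_d^{1/p^e}]]$ for $e\ge 0$ (with compatible systems of $p$-power roots) and $R_\infty=\bigcup_{e\ge 0}R_e$. Let $v$ be a valuation on $R_\infty$, with values in $\mathbb{Q}\cup\{\infty\}$, that extends the $\mathfrak m$-adic valuation of $R$ (the one with $v(b)=t$ for $b\in\mathfrak m^t\setminus\mathfrak m^{t+1}$). **Normalized length.** An $R_\infty$-module is $\mathfrak m$-torsion if each of its elements is killed by a power of $\mathfrak m$. For an $\mathfrak m$-torsion $R_\infty$-module $M$ define $\lambda_\infty(M)\in[0,\infty]$ as follows. If $M$ is finitely presented, choose a presentation matrix of $M$ with entries in some $R_e$, let $M_e$ be its cokernel over $R_e$, and put $\lambda_\infty(M)=\ell_{R_e}(M_e)/p^{de}$ (this does not depend on the choices). If $M$ is finitely generated, $\lambda_\infty(M)=\inf_N\lambda_\infty(N)$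 over all finitely presented $\mathfrak m$-torsion modules $N$ that map onto $M$. In general, $\lambda_\infty(M)=\sup_N\lambda_\infty(N)$ over all finitely generated submodules $N\subseteq M$. The module $M$ has *almost finite length* if for every rational $\epsilon>0$ there is $b\in R_\infty$ with $v(b)<\epsilon$ and $\lambda_\infty(bM)<\infty$. It is *$v$-almost zero* if for every $m\in M$ and every rational $\epsilon>0$ there is $b\in R_\infty$ with $bm=0$ and $v(b)<\epsilon$. **Semi-perfect algebras.** Let $R\to S$ be an injective homomorphism of domains. A semi-perfect $S$-algebra is a domain $S_\infty$, integrally closed in its fraction field, together with injective ring homomorphisms $S\to S_\infty$ and $R_\infty\to S_\infty$ that agree on $R$, such that the Frobenius endomorphism $y\mapsto y^p$ of $S_\infty/pS_\infty$ is surjective. The local cohomology $H^i_{\mathfrak m}(S_\infty)$ is the cohomology of the Čech complex of $S_\infty$ on $p,x_2,\dots,x_d$, regarded as an $R_\infty$-module. **Theorem 3.4.** Let $R\to S$ be a module-finite extension of domains, let $S_\infty$ be a semi-perfect $S$-algebra, and let $0<k<d$. Assume that $\lambda_\infty(H^{k-1}_{\mathfrak m}(S_\infty))=0$ and that $H^k_{\mathfrak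 m}(S_\infty)$ has almost finite length. Then $H^k_{\mathfrak m}(S_\infty)$ is $v$-almost zero. -/

import Mathlib

open scoped ENNReal Polynomial
open IsLocalRing

universe u w

noncomputable section

/-! ### The tower `R_e = V[p^{1/p^e}][[x_2^{1/p^e}, …, x_d^{1/p^e}]]` and its union `R_∞`

Throughout `n = d - 1` is the number of power series variables, so `d = n + 1`. -/

/-- `R = V[[x_2, …, x_d]]` with `d = n + 1`. -/
abbrev BaseRing (n : ℕ) (V : Type u) [CommRing V] : Type u := MvPowerSeries (Fin n) V

/-- `V[p^{1/p^e}]`, presented as `V[T]/(T^{p^e} - p)`. -/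
abbrev CoeffLevel (p : ℕ) (V : Type u) [CommRing V] (e : ℕ) : Type u :=
  AdjoinRoot (Polynomial.X ^ (p ^ e) - Polynomial.C (p : V) : V[X])

/-- The element `p^{1/p^e}` of `V[p^{1/p^e}]`. -/
def coeffRoot (p : ℕ) (V : Type u) [CommRing V] (e : ℕ) : CoeffLevel p V e :=
  AdjoinRoot.root _

theorem coeffRoot_pow (p : ℕ) (V : Type u) [CommRing V] (e : ℕ) :
    coeffRoot p V e ^ (p ^ e) = (p : CoeffLevel p V e) := by
  have h := AdjoinRoot.eval₂_root (Polynomial.X ^ (p ^ e) - Polynomial.C (p : V) : V[X])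
  simpa [coeffRoot, Polynomial.eval₂_sub, sub_eq_zero] using h

/-- The inclusion `V[p^{1/p^e}] → V[p^{1/p^f}]` for `e ≤ f`, the `V`-algebra map sending
`p^{1/p^e}` to `(p^{1/p^f})^{p^{f-e}}`. -/
def coeffTransition (p : ℕ) (V : Type u) [CommRing V] (e f : ℕ) (h : e ≤ f) :
    CoeffLevel p V e →+* CoeffLevel p V f :=
  AdjoinRoot.lift (AdjoinRoot.of _) (coeffRoot p V f ^ p ^ (f - e)) (by
    have h1 : p ^ (f - e) * p ^ e = p ^ f := by rw [← pow_add, Nat.sub_add_cancel h]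
    simp [Polynomial.eval₂_sub, ← pow_mul, h1, coeffRoot_pow])

theorem coeffTransition_root (p : ℕ) (V : Type u) [CommRing V] (e f : ℕ) (h : e ≤ f) :
    coeffTransition p V e f h (coeffRoot p V e) = coeffRoot p V f ^ p ^ (f - e) := by
  simp [coeffTransition, coeffRoot]

theorem coeffTransition_of (p : ℕ) (V : Type u) [CommRing V] (e f : ℕ) (h : e ≤ f) (a : V) :
    coeffTransition p V e f h (AdjoinRoot.of _ a) = AdjoinRoot.of _ a := by
  simp [coeffTransition]

theorem coeffTransition_self (p : ℕ) (V : Type u) [CommRing V] (e : ℕ) :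
    coeffTransition p V e e le_rfl = RingHom.id _ := by
  refine AdjoinRoot.ringHom_ext (RingHom.ext fun a => ?_) ?_
  · exact coeffTransition_of p V e e le_rfl a
  · have := coeffTransition_root p V e e le_rfl
    simpa [coeffRoot] using this

theorem coeffTransition_comp (p : ℕ) (V : Type u) [CommRing V] (e f g : ℕ) (h₁ : e ≤ f)
    (h₂ : f ≤ g) :
    (coeffTransition p V f g h₂).comp (coeffTransition p V e f h₁) =
      coeffTransition p V e g (h₁.trans h₂) := by
  refine AdjoinRoot.ringHom_ext (RingHom.ext fun a => ?_) ?_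
  · simp only [RingHom.comp_apply, coeffTransition_of]
  · change coeffTransition p V f g h₂ (coeffTransition p V e f h₁ (coeffRoot p V e)) =
      coeffTransition p V e g (h₁.trans h₂) (coeffRoot p V e)
    have h3 : p ^ (g - f) * p ^ (f - e) = p ^ (g - e) := by
      rw [← pow_add]; congr 1; omega
    simp only [coeffTransition_root, map_pow, ← pow_mul, h3]

section Tower

variable (p n : ℕ) (V : Type u) [CommRing V]

/-- `R_e = V[p^{1/p^e}][[x_2^{1/p^e}, …, x_d^{1/p^e}]]`; the variable `X i` of this power series
ring stands for the `p^e`-th root of the `i`-th variable of `R`. -/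
abbrev RLevel (e : ℕ) : Type u := MvPowerSeries (Fin n) (CoeffLevel p V e)

variable [Fact p.Prime]

/-- The inclusion `R_e → R_f` for `e ≤ f`: it is the inclusion on coefficients and sends the
variable `x_i^{1/p^e}` to `(x_i^{1/p^f})^{p^{f-e}}`. -/
def levelTransition (e f : ℕ) (h : e ≤ f) : RLevel p n V e →+* RLevel p n V f :=
  (MvPowerSeries.expand (p ^ (f - e))
    (pow_ne_zero _ (Fact.out : p.Prime).ne_zero)).toRingHom.comp
      (MvPowerSeries.map (coeffTransition p V e f h))

instance levelTransition_directedSystem :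
    DirectedSystem (RLevel p n V) (levelTransition p n V · · ·) where
  map_self e x := by
    simp [levelTransition, coeffTransition_self]
  map_map g f e h₁ h₂ x := by
    have hp0 : p ≠ 0 := (Fact.out : p.Prime).ne_zero
    have h3 : p ^ (g - f) * p ^ (f - e) = p ^ (g - e) := by
      rw [← pow_add]; congr 1; omega
    have h4 : ∀ y : RLevel p n V g,
        MvPowerSeries.expand (p ^ (g - f)) (pow_ne_zero _ hp0)
          (MvPowerSeries.expand (p ^ (f - e)) (pow_ne_zero _ hp0) y) =
        MvPowerSeries.expand (p ^ (g - e)) (pow_ne_zero _ hp0) y := by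
      intro y
      rw [← MvPowerSeries.expand_mul]
      simp only [h3]
    have h5 : MvPowerSeries.map (coeffTransition p V f g h₂)
        (MvPowerSeries.map (coeffTransition p V e f h₁) x) =
        MvPowerSeries.map (σ := Fin n) (coeffTransition p V e g (h₁.trans h₂)) x := by
      rw [← coeffTransition_comp p V e f g h₁ h₂, MvPowerSeries.map_comp]
      rfl
    simp only [levelTransition, RingHom.comp_apply, AlgHom.toRingHom_eq_coe, RingHom.coe_coe,
      MvPowerSeries.map_expand, h4, h5]

/-- `R_∞ = ⋃_e R_e`, the direct limit of the tower `R_0 → R_1 → R_2 → ⋯`. -/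
def RInf : Type u := DirectLimit (RLevel p n V) (levelTransition p n V)

instance : CommRing (RInf p n V) :=
  inferInstanceAs (CommRing (DirectLimit (RLevel p n V) (levelTransition p n V)))

/-- The inclusion `R_e → R_∞`. -/
def levelToRInf (e : ℕ) : RLevel p n V e →+* RInf p n V :=
  DirectLimit.Ring.of (RLevel p n V) (levelTransition p n V) e

/-- The inclusion `R = R_0 → R_∞`. -/
instance : Algebra (BaseRing n V) (RInf p n V) :=
  ((levelToRInf p n V 0).comp (MvPowerSeries.map (AdjoinRoot.of _))).toAlgebra

/-- The regular system of parameters `p, x_2, …, x_d` of `R`, which generates the maximal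
ideal of `R`, viewed in `R_∞`. -/
def params : Fin (n + 1) → RInf p n V :=
  Fin.cons (p : RInf p n V)
    fun i => algebraMap (BaseRing n V) (RInf p n V) (MvPowerSeries.X i)

end Tower

/-! ### Normalized length -/

/-- The cokernel of a matrix, as a map between finite free modules. -/
abbrev MatrixCoker {A : Type u} [CommRing A] {m₀ m₁ : ℕ} (φ : Matrix (Fin m₀) (Fin m₁) A) :
    Type u :=
  (Fin m₀ → A) ⧸ LinearMap.range φ.mulVecLin

section Length

variable (p n : ℕ) [Fact p.Prime] (V : Type u) [CommRing V]

/-- An `R_∞`-module is `𝔪`-torsion if each element is killed by a power of the maximal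
ideal `𝔪` of `R`. -/
def IsMTorsion [IsLocalRing V] (M : Type w) [AddCommGroup M] [Module (RInf p n V) M] : Prop :=
  ∀ x : M, ∃ t : ℕ, ∀ a ∈ maximalIdeal (BaseRing n V) ^ t,
    algebraMap (BaseRing n V) (RInf p n V) a • x = 0

/-- The normalized length of a finitely presented `𝔪`-torsion module `M`: if a presentation
matrix `φ` of `M` has entries in `R_e` and `M_e` is the cokernel of `φ` over `R_e`, it is
`ℓ(M_e) / p^{d e}`. This does not depend on `e` and `φ`, so that the infimum below is the
infimum of a set with one element. -/
def fpLength (M : Type w) [AddCommGroup M] [Module (RInf p n V) M] : ℝ≥0∞ :=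
  ⨅ (e : ℕ) (m₀ : ℕ) (m₁ : ℕ) (φ : Matrix (Fin m₀) (Fin m₁) (RLevel p n V e))
    (_ : Nonempty (MatrixCoker (φ.map (levelToRInf p n V e)) ≃ₗ[RInf p n V] M)),
    (Module.length (RLevel p n V e) (MatrixCoker φ) : ℝ≥0∞) / (p : ℝ≥0∞) ^ ((n + 1) * e)

/-- The normalized length of a finitely generated `𝔪`-torsion module `M`: the infimum of the
normalized lengths of the finitely presented `𝔪`-torsion modules that map onto `M`. -/
def fgLength [IsLocalRing V] (M : Type w) [AddCommGroup M] [Module (RInf p n V) M] : ℝ≥0∞ :=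
  ⨅ (N : Type u) (_ : AddCommGroup N) (_ : Module (RInf p n V) N)
    (_ : Module.FinitePresentation (RInf p n V) N) (_ : IsMTorsion p n V N)
    (_ : ∃ f : N →ₗ[RInf p n V] M, Function.Surjective f), fpLength p n V N

/-- The normalized length `λ_∞(M)` of an `𝔪`-torsion `R_∞`-module `M`: the supremum of the
normalized lengths of its finitely generated submodules. -/
def normalizedLength [IsLocalRing V] (M : Type w) [AddCommGroup M] [Module (RInf p n V) M] :
    ℝ≥0∞ :=
  ⨆ (N : Submodule (RInf p n V) M) (_ : N.FG), fgLength p n V N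

end Length

/-! ### Almost finite length and almost zero modules -/

section Almost

variable {p n : ℕ} [Fact p.Prime] {V : Type u} [CommRing V] [IsLocalRing V]

/-- The (additive) valuation `v` on `R_∞` restricts to the `𝔪`-adic valuation of `R`. -/
def ExtendsMAdic (v : AddValuation (RInf p n V) (WithTop ℚ)) : Prop :=
  ∀ (b : BaseRing n V) (t : ℕ), b ∈ maximalIdeal (BaseRing n V) ^ t →
    b ∉ maximalIdeal (BaseRing n V) ^ (t + 1) →
      v (algebraMap (BaseRing n V) (RInf p n V) b) = ((t : ℚ) : WithTop ℚ)

/-- `M` has almost finite length: for every rational `ε > 0` there is `b ∈ R_∞` with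
`v(b) < ε` and `λ_∞(bM) < ∞`. -/
def HasAlmostFiniteLength (v : AddValuation (RInf p n V) (WithTop ℚ))
    (M : Type w) [AddCommGroup M] [Module (RInf p n V) M] : Prop :=
  ∀ ε : ℚ, 0 < ε → ∃ b : RInf p n V,
    normalizedLength p n V (LinearMap.range (LinearMap.lsmul (RInf p n V) M b)) < ⊤ ∧
      v b < (ε : WithTop ℚ)

/-- `M` is `v`-almost zero: for every `m ∈ M` and every rational `ε > 0` there is `b ∈ R_∞`
with `bm = 0` and `v(b) < ε`. -/
def IsAlmostZero (v : AddValuation (RInf p n V) (WithTop ℚ))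
    (M : Type w) [AddCommGroup M] [Module (RInf p n V) M] : Prop :=
  ∀ (m : M) (ε : ℚ), 0 < ε → ∃ b : RInf p n V, b • m = 0 ∧ v b < (ε : WithTop ℚ)

end Almost

/-! ### Local cohomology through the Čech complex -/

section Cech

variable {A : Type u} [CommRing A] {d : ℕ} (x : Fin d → A)

/-- The multiplicative set generated by the `x_i` with `i ∈ I`. -/
def cechMonoid (I : Finset (Fin d)) : Submonoid A := Submonoid.closure (x '' (I : Set (Fin d)))

theorem cechMonoid_mono {I J : Finset (Fin d)} (h : I ⊆ J) : cechMonoid x I ≤ cechMonoid x J :=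
  Submonoid.closure_mono (Set.image_mono (Finset.coe_subset.mpr h))

variable (M : Type w) [AddCommGroup M] [Module A M]

/-- The total module `⨁_I M[1/x_i : i ∈ I]` of the Čech complex; the summand of `I` sits in
degree `#I`. -/
abbrev CechTotal : Type (max u w) := ∀ I : Finset (Fin d), LocalizedModule (cechMonoid x I) M

/-- The Čech differential: the component at `J` of the image of `c` is the sum over `j ∈ J` of
`(-1)^{#{i ∈ J | i < j}}` times the image of the component of `c` at `J \ {j}`. -/
def cechDifferential : CechTotal x M →ₗ[A] CechTotal x M :=
  LinearMap.pi fun J => ∑ j ∈ J, (-1 : A) ^ (J.filter (· < j)).card •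
    (LocalizedModule.liftOfLE (M := M) (cechMonoid x (J.erase j)) (cechMonoid x J)
      (cechMonoid_mono x (J.erase_subset j))).comp (LinearMap.proj (J.erase j))

/-- The elements of the total module that are concentrated on the index sets `I` with `P I`. -/
def cechSupported (P : Finset (Fin d) → Prop) : Submodule A (CechTotal x M) where
  carrier := {c | ∀ I, ¬ P I → c I = 0}
  add_mem' ha hb I hI := by simp [ha I hI, hb I hI]
  zero_mem' _ _ := rfl
  smul_mem' a c hc I hI := by simp [hc I hI]

/-- The Čech cocycles of degree `k`. -/
def cechCocycles (k : ℕ) : Submodule A (CechTotal x M) :=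
  cechSupported x M (fun I => I.card = k) ⊓ LinearMap.ker (cechDifferential x M)

/-- The Čech coboundaries of degree `k`: the image of the cochains of degree `k - 1`
(zero for `k = 0`). -/
def cechCoboundaries (k : ℕ) : Submodule A (CechTotal x M) :=
  (cechSupported x M (fun I => I.card + 1 = k)).map (cechDifferential x M)

/-- The `k`-th Čech cohomology module of `M` with respect to `x`, i.e. the local cohomology
of `M` with support in the ideal generated by the `x_i`. -/
abbrev CechCohomology (k : ℕ) : Type (max u w) :=
  cechCocycles x M k ⧸ (cechCoboundaries x M k).submoduleOf (cechCocycles x M k)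

end Cech

/-- The local cohomology module `H^k_𝔪(M)` of an `R_∞`-module `M`, where `𝔪 = (p, x_2, …, x_d)`
is the maximal ideal of `R`, as an `R_∞`-module. -/
abbrev LocalCohomologyM (p n : ℕ) [Fact p.Prime] (V : Type u) [CommRing V] (k : ℕ)
    (M : Type w) [AddCommGroup M] [Module (RInf p n V) M] : Type (max u w) :=
  CechCohomology (params p n V) M k

/-! ### Semi-perfect algebras -/

/-- `T` is a semi-perfect algebra over the extension `S` of `R`: the maps `R → S`, `R → R_∞`,
`S → T`, `R_∞ → T` form a commutative square of ring extensions of domains, `T` is integrally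
closed in its fraction field, and the Frobenius endomorphism of `T/pT` is surjective. -/
structure IsSemiPerfect (p n : ℕ) [Fact p.Prime] (V : Type u) [CommRing V]
    (S : Type*) [CommRing S] [Algebra (BaseRing n V) S]
    (T : Type*) [CommRing T] [Algebra S T] [Algebra (RInf p n V) T] : Prop where
  isDomain : IsDomain T
  comm : ∀ a : BaseRing n V,
    algebraMap S T (algebraMap (BaseRing n V) S a) =
      algebraMap (RInf p n V) T (algebraMap (BaseRing n V) (RInf p n V) a)
  injective_left : Function.Injective (algebraMap S T)
  injective_right : Function.Injective (algebraMap (RInf p n V) T)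
  isIntegrallyClosed : IsIntegrallyClosed T
  frobenius_surjective :
    Function.Surjective fun y : T ⧸ Ideal.span {(p : T)} => y ^ p

end

/-! Write `H^i` for the local cohomology of `T = S_∞`, computed by its Čech complex `C`; put `c =
p^{1/p}` and `q = p^d`, and let `λ` be the normalized length. The proof plays two growth rates
against each other.

For nonzero `a` the complex `C` has no `a`-torsion, so `0 → C → C → C/a → 0` gives an exact sequence
`H^{k-1} → H^{k-1}(C/a) → H^k[a] → 0`. Since `λ(H^{k-1}) = 0`, the last two modules have the same
length, even after multiplication by a fixed `b`. Frobenius `y ↦ y^p` induces an injection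
`H^{k-1}(C/c) → H^{k-1}(C/p)`: integral closedness of `T` turns `p ∣ y^p` into `c ∣ y`, and
surjectivity of Frobenius modulo `p` supplies a `p`-th root modulo `p` of a bounding cochain
(`pow_mem_supMultiples`). As Frobenius carries level `e + 1` of the tower onto level `e` modulo `p`,
it multiplies lengths by at least `q` (`IsPerfectTower.mul_submoduleLength_le`). On the other hand
`p = c^p`, so filtering by powers of `c` gives `λ(b^p H^k[p]) ≤ p · λ(b H^k[c])`
(`IsLengthTower.submoduleLength_ker_pow_le`). Together `q r ≤ p r` for `r = λ(b H^k[c])`. If `λ(b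
H^k) < ∞`, then `r` is finite, and `d > 1` forces `r = 0` (`submoduleLength_torsion_eq_zero`).

Every `m` in `H^k` is killed by some `c^i`, and the same filtration shows that `b^i m` generates a
module of length zero, with `v(b)` as small as desired. Such an element is killed by elements of
arbitrarily small valuation (`ExtendsMAdic.exists_smul_eq_zero`): `v` on `R_e` is the adic valuation
of its maximal ideal scaled by `1/p^e`, so an annihilator contained in `{v ≥ ε}` would bound the
normalized lengths at all high levels below by a positive constant.

To make `λ` usable it is rewritten as an asymptotic length: the infimum over `e` of the length of
the `R_e`-span of a finite set, divided by `q^e` (`normalizedLength_eq_submoduleLength`).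
Subadditivity then needs only the upper bound `q^{f-e}` for the length of the fibre of `R_e → R_f`,
and no flatness. -/

noncomputable section

/-! ### Length and semilinear maps -/

section SemilinearLength

variable {A B : Type*} [CommRing A] [CommRing B] {σ : A →+* B}
  {N M : Type*} [AddCommGroup N] [AddCommGroup M] [Module A N] [Module B M]

/-- Length is the Krull dimension of the lattice of submodules. Only the lattices enter, so modules
over different rings can be compared, as needed for semilinear maps and Frobenius. -/
theorem length_le_of_strictMono {A' B' : Type*} [CommRing A'] [CommRing B']
    {N' M' : Type*} [AddCommGroup N'] [AddCommGroup M'] [Module A' N'] [Module B' M']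
    (F : Submodule A' N' → Submodule B' M') (hF : StrictMono F) :
    Module.length A' N' ≤ Module.length B' M' := by
  have := Order.krullDim_le_of_strictMono F hF
  rw [← Module.coe_length, ← Module.coe_length] at this
  exact_mod_cast this

theorem length_le_of_surjective_semilinear (u : N →ₛₗ[σ] M) (hu : Function.Surjective u) :
    Module.length B M ≤ Module.length A N := by
  refine length_le_of_strictMono (fun P => P.comap u) (Monotone.strictMono_of_injective ?_ ?_)
  · intro P Q h x hx
    exact h hx
  · intro P Q h
    ext y
    obtain ⟨x, rfl⟩ := hu y
    exact SetLike.ext_iff.mp h x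

theorem length_le_of_injective_semilinear [RingHomSurjective σ] (u : N →ₛₗ[σ] M)
    (hu : Function.Injective u) : Module.length A N ≤ Module.length B M := by
  refine length_le_of_strictMono (fun P => P.map u) (Monotone.strictMono_of_injective ?_ ?_)
  · intro P Q h
    exact Submodule.map_mono h
  · exact Submodule.map_injective_of_injective hu

variable [IsLocalRing A]

theorem maximalIdeal_smul_simple [IsSimpleModule A N] {a : A} (ha : a ∈ maximalIdeal A) (x : N) :
    a • x = 0 := by
  have h : (Module.annihilator A N).IsMaximal := IsSimpleModule.annihilator_isMaximal
  have := IsLocalRing.eq_maximalIdeal h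
  rw [← this] at ha
  exact Module.mem_annihilator.mp ha x

/-- A substitute for flat base change, by induction along a composition series. A simple quotient of
`N` is killed by `𝔪_A`, so it adds to the `B`-span one cyclic piece, which is a quotient of `B / 𝔪_A
B`. -/
theorem length_span_range_le_of_isFiniteLength (σ : A →+* B) (hN : IsFiniteLength A N) :
    ∀ {M : Type w} [AddCommGroup M] [Module B M] (u : N →ₛₗ[σ] M),
    Module.length B (Submodule.span B (Set.range u)) ≤
      Module.length B (B ⧸ (maximalIdeal A).map σ) * Module.length A N := by
  induction hN with
  | of_subsingleton => 
    rename_i N _ _ _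
    intro M _ _ u
    have : Submodule.span B (Set.range u) = ⊥ := by
      rw [Submodule.span_eq_bot]
      rintro _ ⟨x, rfl⟩
      rw [Subsingleton.elim x 0, map_zero]
    rw [this]
    simp
  | @of_simple_quotient N _ _ N₀ hs hN₀ ih =>
    intro M _ _ u
    set S := Submodule.span B (Set.range u)
    set S₀ := Submodule.span B (Set.range (u.comp N₀.subtype))
    have hle : S₀ ≤ S := Submodule.span_mono (by rintro _ ⟨x, rfl⟩; exact ⟨x, rfl⟩)
    have h1 := ih (u.comp N₀.subtype)
    have h2 : Module.length B S = Module.length B S₀ +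
        Module.length B (S ⧸ S₀.submoduleOf S) := by
      have e := Module.length_eq_add_of_exact (Submodule.inclusion hle)
        (S₀.submoduleOf S).mkQ (Submodule.inclusion_injective hle) (Submodule.mkQ_surjective _)
        (by
          rw [LinearMap.exact_iff, Submodule.ker_mkQ, Submodule.range_inclusion]
          rfl)
      exact e
    have h3 : Module.length A N = Module.length A N₀ + 1 := by
      have e := Module.length_eq_add_of_exact N₀.subtype N₀.mkQ N₀.injective_subtype
        N₀.mkQ_surjective (by rw [LinearMap.exact_iff, Submodule.ker_mkQ, Submodule.range_subtype])
      rwa [Module.length_eq_one A (N ⧸ N₀)] at e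
    have h4 : Module.length B (S ⧸ S₀.submoduleOf S) ≤
        Module.length B (B ⧸ (maximalIdeal A).map σ) := by
      obtain ⟨x, hx⟩ : ∃ x : N, N₀.mkQ x ≠ 0 := by
        have := IsSimpleModule.nontrivial A (N ⧸ N₀)
        obtain ⟨y, hy⟩ := exists_ne (0 : N ⧸ N₀)
        obtain ⟨x, rfl⟩ := N₀.mkQ_surjective y
        exact ⟨x, hy⟩
      have hux : ∀ y, u y ∈ S := fun y => Submodule.subset_span ⟨y, rfl⟩
      let y : S ⧸ S₀.submoduleOf S := Submodule.Quotient.mk ⟨u x, hux x⟩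
      let F : B →ₗ[B] S ⧸ S₀.submoduleOf S := LinearMap.toSpanSingleton B _ y
      have hker : (maximalIdeal A).map σ ≤ LinearMap.ker F := by
        rw [Ideal.map_le_iff_le_comap]
        intro a ha
        have h5 : a • x ∈ N₀ := by
          have := maximalIdeal_smul_simple ha (N₀.mkQ x)
          rwa [← map_smul, Submodule.mkQ_apply, Submodule.Quotient.mk_eq_zero] at this
        change σ a • y = 0
        change Submodule.Quotient.mk (σ a • (⟨u x, hux x⟩ : S)) = _
        rw [Submodule.Quotient.mk_eq_zero]
        change σ a • u x ∈ S₀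
        rw [← map_smulₛₗ]
        exact Submodule.subset_span ⟨⟨_, h5⟩, rfl⟩
      refine Module.length_le_of_surjective (Submodule.liftQ _ F hker) ?_
      rw [← LinearMap.range_eq_top, Submodule.range_liftQ, eq_top_iff]
      rintro z -
      obtain ⟨⟨z, hz⟩, rfl⟩ := Submodule.Quotient.mk_surjective _ z
      have key : S ≤ S₀ ⊔ Submodule.span B {u x} := by
        refine Submodule.span_le.mpr ?_
        rintro _ ⟨w, rfl⟩
        obtain ⟨a, ha⟩ := (IsSimpleModule.toSpanSingleton_surjective A hx) (N₀.mkQ w)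
        have h6 : w - a • x ∈ N₀ := by
          rw [← Submodule.Quotient.mk_eq_zero, Submodule.Quotient.mk_sub, sub_eq_zero]
          exact ha.symm
        have : u w = u (w - a • x) + σ a • u x := by simp
        rw [this]
        exact Submodule.add_mem_sup (Submodule.subset_span ⟨⟨_, h6⟩, rfl⟩)
          (Submodule.smul_mem _ _ (Submodule.mem_span_singleton_self _))
      obtain ⟨s, hs, t, ht, rfl⟩ := Submodule.mem_sup.mp (key hz)
      obtain ⟨b, rfl⟩ := Submodule.mem_span_singleton.mp ht
      refine ⟨b, ?_⟩
      change Submodule.Quotient.mk (b • (⟨u x, hux x⟩ : S)) = _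
      rw [Submodule.Quotient.eq]
      change b • u x - (s + b • u x) ∈ S₀
      rw [sub_add_cancel_right]
      exact neg_mem hs
    rw [h2, h3, mul_add, mul_one]
    exact add_le_add h1 h4

/-- The `B`-span of the image of a semilinear map from an `A`-module of length `ℓ` has length at
most `ℓ` times the length of the fibre `B / 𝔪_A B`. -/
theorem length_span_range_le {q : ℕ} (hq : q ≠ 0)
    (hfib : Module.length B (B ⧸ (maximalIdeal A).map σ) ≤ q) (u : N →ₛₗ[σ] M) :
    Module.length B (Submodule.span B (Set.range u)) ≤ q * Module.length A N := by
  by_cases h : Module.length A N = ⊤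
  · rw [h, ENat.mul_top (by exact_mod_cast hq)]
    exact le_top
  · exact (length_span_range_le_of_isFiniteLength σ (Module.length_ne_top_iff.mp h) u).trans
      (by gcongr)

/-- A module of finite length over a local ring is killed by a power of the maximal ideal. -/
theorem exists_maximalIdeal_pow_smul_eq_zero (hN : IsFiniteLength A N) :
    ∃ t : ℕ, ∀ a ∈ maximalIdeal A ^ t, ∀ x : N, a • x = 0 := by
  induction hN with
  | of_subsingleton => exact ⟨0, fun a _ x => Subsingleton.elim _ _⟩
  | @of_simple_quotient N _ _ N₀ hs hN₀ ih =>
    obtain ⟨t, ht⟩ := ih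
    refine ⟨t + 1, fun a ha x => ?_⟩
    rw [pow_succ] at ha
    induction ha using Submodule.mul_induction_on' with
    | mem_mul_mem b hb c hc =>
      have h5 : c • x ∈ N₀ := by
        have := maximalIdeal_smul_simple hc (N₀.mkQ x)
        rwa [← map_smul, Submodule.mkQ_apply, Submodule.Quotient.mk_eq_zero] at this
      have := congrArg Subtype.val (ht b hb ⟨c • x, h5⟩)
      rw [mul_smul]
      exact this
    | add y _ z _ hy hz => rw [add_smul, hy, hz, add_zero]

end SemilinearLength

/-- If `A` surjects onto the residue field of the local ring `B`, then length over `A` is at most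
length over `B`. -/
theorem length_le_of_residue_surjective {A B : Type*} [CommRing A] [CommRing B] [IsLocalRing B]
    (σ : A →+* B) (hσ : ∀ b : B, ∃ a : A, b - σ a ∈ maximalIdeal B)
    {M : Type*} [AddCommGroup M] [Module B M] (hM : IsFiniteLength B M) :
    ∀ {N : Type w} [AddCommGroup N] [Module A N] (u : N →ₛₗ[σ] M), Function.Injective u →
      Module.length A N ≤ Module.length B M := by
  induction hM with
  | of_subsingleton =>
    intro N _ _ u hu
    have : Subsingleton N := hu.subsingleton
    simp
  | @of_simple_quotient M _ _ M₀ hs hM₀ ih =>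
    intro N _ _ u hu
    let N₀ : Submodule A N := M₀.comap u
    let u₀ : N₀ →ₛₗ[σ] M₀ :=
      { toFun := fun x => ⟨u x, x.2⟩
        map_add' := fun x y => Subtype.ext (map_add u _ _)
        map_smul' := fun a x => Subtype.ext (map_smulₛₗ u _ _) }
    have h1 := ih u₀ (fun x y h => Subtype.ext (hu (congrArg Subtype.val h)))
    have h3 : Module.length B M = Module.length B M₀ + 1 := by
      have e := Module.length_eq_add_of_exact M₀.subtype M₀.mkQ M₀.injective_subtype
        M₀.mkQ_surjective (by rw [LinearMap.exact_iff, Submodule.ker_mkQ, Submodule.range_subtype])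
      rwa [Module.length_eq_one B (M ⧸ M₀)] at e
    have h2 : Module.length A N = Module.length A N₀ + Module.length A (N ⧸ N₀) := 
      Module.length_eq_add_of_exact N₀.subtype N₀.mkQ N₀.injective_subtype
        N₀.mkQ_surjective (by rw [LinearMap.exact_iff, Submodule.ker_mkQ, Submodule.range_subtype])
    -- The quotient embeds in the simple `B`-module `M ⧸ M₀`, on which `B` acts through its residue
    -- field; `A` hits every residue class, so any nonzero element generates over `A`.
    have h4 : Module.length A (N ⧸ N₀) ≤ 1 := by
      rcases subsingleton_or_nontrivial (N ⧸ N₀) with h | h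
      · simp
      · refine le_of_eq ?_
        rw [Module.length_eq_one_iff, isSimpleModule_iff_toSpanSingleton_surjective]
        refine ⟨h, ?_⟩
        intro x hx y
        obtain ⟨x, rfl⟩ := N₀.mkQ_surjective x
        obtain ⟨y, rfl⟩ := N₀.mkQ_surjective y
        have hux : M₀.mkQ (u x) ≠ 0 := by
          intro h
          apply hx
          rw [Submodule.mkQ_apply, Submodule.Quotient.mk_eq_zero] at h ⊢
          exact h
        obtain ⟨b, hb⟩ := IsSimpleModule.toSpanSingleton_surjective B hux (M₀.mkQ (u y))
        obtain ⟨a, ha⟩ := hσ b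
        refine ⟨a, ?_⟩
        change N₀.mkQ (a • x) = N₀.mkQ y
        rw [← sub_eq_zero, ← map_sub, Submodule.mkQ_apply, Submodule.Quotient.mk_eq_zero]
        change u (a • x - y) ∈ M₀
        rw [← Submodule.Quotient.mk_eq_zero, ← Submodule.mkQ_apply, map_sub, map_sub, ← hb,
          map_smulₛₗ, map_smul, LinearMap.toSpanSingleton_apply]
        have := maximalIdeal_smul_simple ha (M₀.mkQ (u x))
        rw [sub_smul, sub_eq_zero] at this
        rw [this, sub_self]
    rw [h2, h3]
    exact add_le_add h1 h4

/-! ### Asymptotic length along a tower of local rings -/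

/-- An increasing tower of Noetherian local subrings `A e` of `R` with union `R`, such that the
fibres of `A e → A f` have length at most `q ^ (f - e)`. -/
structure IsLengthTower {R : Type*} [CommRing R] (A : ℕ → Subring R)
    [∀ e, IsLocalRing (A e)] (q : ℕ) : Prop where
  mono : Monotone A
  exhaust : ∀ r : R, ∃ e, r ∈ A e
  noeth : ∀ e, IsNoetherianRing (A e)
  ne_zero : q ≠ 0
  length_fiber : ∀ (e f : ℕ) (h : e ≤ f), Module.length (A f)
    (A f ⧸ (maximalIdeal (A e)).map (Subring.inclusion (mono h))) ≤ (q ^ (f - e) : ℕ)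

section Tower

variable {R : Type*} [CommRing R] (A : ℕ → Subring R) (q : ℕ)

/-- The length over `A e` of the `A e`-span of `g`, divided by `q ^ e`. -/
def levelLength (e : ℕ) {M : Type*} [AddCommGroup M] [Module R M] (g : Set M) : ℝ≥0∞ :=
  (Module.length (A e) (Submodule.span (A e) g) : ℝ≥0∞) / (q : ℝ≥0∞) ^ e

/-- The asymptotic length of the `R`-span of a finite set `g`. -/
def spanLength {M : Type*} [AddCommGroup M] [Module R M] (g : Set M) : ℝ≥0∞ :=
  ⨅ e, levelLength A q e g

/-- The asymptotic length of a submodule: the supremum over its finite subsets. -/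
def submoduleLength {M : Type*} [AddCommGroup M] [Module R M] (P : Submodule R M) : ℝ≥0∞ :=
  ⨆ (g : Set M) (_ : g.Finite) (_ : g ⊆ P), spanLength A q g

variable {M M' : Type*} [AddCommGroup M] [Module R M] [AddCommGroup M'] [Module R M']

theorem length_span_image (e : ℕ) (f : M →ₗ[R] M') (g : Set M) :
    Module.length (A e) (Submodule.span (A e) (f '' g)) ≤
      Module.length (A e) (Submodule.span (A e) g) := by
  have h : Submodule.span (A e) (f '' g) =
      (Submodule.span (A e) g).map (f.restrictScalars (A e)) :=
    (Submodule.map_span (f.restrictScalars (A e)) g).symm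
  rw [h]
  exact Module.length_le_of_surjective
    ((f.restrictScalars (A e)).submoduleMap _) (LinearMap.submoduleMap_surjective _ _)

theorem length_span_image_of_injective (e : ℕ) (f : M →ₗ[R] M') (hf : Function.Injective f)
    (g : Set M) :
    Module.length (A e) (Submodule.span (A e) (f '' g)) =
      Module.length (A e) (Submodule.span (A e) g) := by
  refine le_antisymm (length_span_image A e f g) ?_
  have h : Submodule.span (A e) (f '' g) =
      (Submodule.span (A e) g).map (f.restrictScalars (A e)) :=
    (Submodule.map_span (f.restrictScalars (A e)) g).symm
  rw [h]
  refine Module.length_le_of_injective ((f.restrictScalars (A e)).submoduleMap _) ?_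
  intro x y hxy
  exact Subtype.ext (hf (congrArg Subtype.val hxy))

theorem spanLength_image (f : M →ₗ[R] M') (g : Set M) :
    spanLength A q (f '' g) ≤ spanLength A q g :=
  iInf_mono fun e => ENNReal.div_le_div_right
    (ENat.toENNReal_le.mpr (length_span_image A e f g)) _

theorem spanLength_image_of_injective (f : M →ₗ[R] M') (hf : Function.Injective f) (g : Set M) :
    spanLength A q (f '' g) = spanLength A q g := by
  simp only [spanLength, levelLength, length_span_image_of_injective A _ f hf]

theorem submoduleLength_mono {P Q : Submodule R M} (h : P ≤ Q) :
    submoduleLength A q P ≤ submoduleLength A q Q :=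
  iSup_mono fun _ => iSup_mono fun _ => iSup_mono' fun hg => ⟨hg.trans h, le_rfl⟩

theorem spanLength_le_submoduleLength {P : Submodule R M} {g : Set M} (hg : g.Finite)
    (h : g ⊆ P) : spanLength A q g ≤ submoduleLength A q P :=
  le_iSup_of_le g (le_iSup_of_le hg (le_iSup_of_le h le_rfl))

theorem submoduleLength_le_iff {P : Submodule R M} {r : ℝ≥0∞} :
    submoduleLength A q P ≤ r ↔ ∀ g : Set M, g.Finite → g ⊆ P → spanLength A q g ≤ r := by
  simp only [submoduleLength, iSup_le_iff]

theorem submoduleLength_map_le (P : Submodule R M) (f : M →ₗ[R] M') :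
    submoduleLength A q (P.map f) ≤ submoduleLength A q P := by
  rw [submoduleLength_le_iff]
  intro g hg hgP
  obtain ⟨g', hg', hfin, h⟩ := (Set.exists_subset_image_finite_and (f := f) (s := (P : Set M))
    (p := fun t => t = g)).mp ⟨g, hgP, hg, rfl⟩
  rw [← h]
  exact (spanLength_image A q f g').trans (spanLength_le_submoduleLength A q hfin hg')

theorem submoduleLength_map_of_injective (P : Submodule R M) (f : M →ₗ[R] M')
    (hf : Function.Injective f) :
    submoduleLength A q (P.map f) = submoduleLength A q P := by
  refine le_antisymm (submoduleLength_map_le A q P f) ?_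
  rw [submoduleLength_le_iff]
  intro g hg hgP
  rw [← spanLength_image_of_injective A q f hf]
  exact spanLength_le_submoduleLength A q (hg.image _) (Set.image_mono hgP)

variable {A q} [∀ e, IsLocalRing (A e)] (h : IsLengthTower A q)
include h

theorem IsLengthTower.length_span_le {e f : ℕ} (hef : e ≤ f) {N M : Type*} [AddCommGroup N]
    [AddCommGroup M] [Module (A e) N] [Module (A f) M]
    (u : N →ₛₗ[Subring.inclusion (h.mono hef)] M) :
    Module.length (A f) (Submodule.span (A f) (Set.range u)) ≤
      (q ^ (f - e) : ℕ) * Module.length (A e) N :=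
  length_span_range_le (pow_ne_zero _ h.ne_zero) (h.length_fiber e f hef) u

/-- The inclusion of an `A e`-submodule, as a semilinear map. -/
def subtypeSemilinear {B C : Subring R} (hBC : B ≤ C) (L : Submodule B M) :
    L →ₛₗ[Subring.inclusion hBC] M where
  toFun x := x
  map_add' _ _ := rfl
  map_smul' _ _ := rfl

omit [∀ e, IsLocalRing (A e)] h in
theorem span_le_span_of_le {B C : Subring R} (hBC : B ≤ C) (g : Set M) :
    (Submodule.span B g : Set M) ⊆ Submodule.span C g := by
  intro x hx
  induction hx using Submodule.span_induction with
  | mem x hx => exact Submodule.subset_span hx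
  | zero => exact zero_mem _
  | add x y _ _ hx hy => exact add_mem hx hy
  | smul a x _ hx => exact Submodule.smul_mem _ (⟨a, hBC a.2⟩ : C) hx

/-- The `A f`-span of `g` is generated by its `A e`-span, so the fibre bound costs at most the
factor `q ^ (f - e)` that the denominators absorb. Hence the infimum defining `spanLength` is a
limit, and any initial segment of levels may be ignored. -/
theorem IsLengthTower.levelLength_antitone (g : Set M) :
    Antitone fun e => levelLength A q e g := by
  intro e f hef
  have h1 := h.length_span_le hef (subtypeSemilinear (h.mono hef) (Submodule.span (A e) g))
  have h2 : Submodule.span (A f) g ≤ Submodule.span (A f)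
      (Set.range (subtypeSemilinear (h.mono hef) (Submodule.span (A e) g))) :=
    Submodule.span_mono fun x hx => ⟨⟨x, Submodule.subset_span hx⟩, rfl⟩
  have h3 := (Module.length_le_of_injective _ (Submodule.inclusion_injective h2)).trans h1
  have hq : (q : ℝ≥0∞) ≠ 0 := by exact_mod_cast h.ne_zero
  have h4 : (Module.length (A f) (Submodule.span (A f) g) : ℝ≥0∞) ≤
      (q : ℝ≥0∞) ^ (f - e) * (Module.length (A e) (Submodule.span (A e) g) : ℝ≥0∞) := by
    have := ENat.toENNReal_le.mpr h3
    simpa using this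
  simp only [levelLength]
  rw [ENNReal.div_le_iff (pow_ne_zero _ hq) (ENNReal.pow_ne_top (ENNReal.natCast_ne_top _))]
  refine h4.trans (le_of_eq ?_)
  obtain ⟨d, rfl⟩ := Nat.exists_eq_add_of_le hef
  rw [Nat.add_sub_cancel_left, pow_add, ← mul_assoc, ENNReal.div_mul_cancel (pow_ne_zero _ hq)
    (ENNReal.pow_ne_top (ENNReal.natCast_ne_top _)), mul_comm]

theorem IsLengthTower.exists_mem_span {g : Set M} {x : M} (hx : x ∈ Submodule.span R g) :
    ∃ e, x ∈ Submodule.span (A e) g := by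
  induction hx using Submodule.span_induction with
  | mem x hx => exact ⟨0, Submodule.subset_span hx⟩
  | zero => exact ⟨0, zero_mem _⟩
  | add x y _ _ hx hy =>
    obtain ⟨e, he⟩ := hx
    obtain ⟨f, hf⟩ := hy
    exact ⟨max e f, add_mem (span_le_span_of_le (h.mono (le_max_left e f)) _ he)
      (span_le_span_of_le (h.mono (le_max_right e f)) _ hf)⟩
  | smul a x _ hx =>
    obtain ⟨e, he⟩ := hx
    obtain ⟨f, hf⟩ := h.exhaust a
    exact ⟨max e f, Submodule.smul_mem _ (⟨a, h.mono (le_max_right e f) hf⟩ : A (max e f))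
      (span_le_span_of_le (h.mono (le_max_left e f)) _ he)⟩

theorem IsLengthTower.exists_span_le {g g' : Set M} (hg : g.Finite)
    (hgg' : g ⊆ Submodule.span R g') :
    ∃ e, ∀ f, e ≤ f → Submodule.span (A f) g ≤ Submodule.span (A f) g' := by
  induction g, hg using Set.Finite.induction_on with
  | empty => exact ⟨0, fun f _ => by simp⟩
  | @insert a s _ _ ih =>
    obtain ⟨e, he⟩ := ih ((Set.subset_insert _ _).trans hgg')
    obtain ⟨e', he'⟩ := h.exists_mem_span (hgg' (Set.mem_insert _ _))
    refine ⟨max e e', fun f hf => ?_⟩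
    rw [Submodule.span_le, Set.insert_subset_iff]
    exact ⟨span_le_span_of_le (h.mono ((le_max_right _ _).trans hf)) _ he',
      Submodule.span_le.mp (he f ((le_max_left _ _).trans hf))⟩

theorem IsLengthTower.spanLength_eq_iInf (g : Set M) (e : ℕ) :
    spanLength A q g = ⨅ f ≥ e, levelLength A q f g := by
  refine le_antisymm (le_iInf₂ fun f _ => iInf_le _ f) (le_iInf fun f => ?_)
  exact (iInf₂_le (max e f) (le_max_left e f)).trans
    (h.levelLength_antitone g (le_max_right e f))

theorem IsLengthTower.spanLength_le_of_subset_span {g g' : Set M} (hg : g.Finite)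
    (hgg' : g ⊆ Submodule.span R g') : spanLength A q g ≤ spanLength A q g' := by
  obtain ⟨e, he⟩ := h.exists_span_le hg hgg'
  rw [h.spanLength_eq_iInf g e, h.spanLength_eq_iInf g' e]
  exact iInf₂_mono fun f hf => ENNReal.div_le_div_right (ENat.toENNReal_le.mpr
    (Module.length_le_of_injective _ (Submodule.inclusion_injective (he f hf)))) _

/-- At a fixed level `e`, the kernel of `f` on the span of `g` is generated by a finite set `k`, by
Noetherianity. At a later level `e'`, the span of `g` modulo the span of `k` is generated by the
level-`e` span of `f '' g`, so its length is at most `q ^ (e' - e)` times the length of the latter.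
Dividing by `q ^ e'` and letting `e'`, then `e`, vary gives the bound. -/
theorem IsLengthTower.spanLength_le_add (P : Submodule R M) (f : M →ₗ[R] M') {g : Set M}
    (hg : g.Finite) (hgP : g ⊆ P) : spanLength A q g ≤
      submoduleLength A q (P ⊓ LinearMap.ker f) + spanLength A q (f '' g) := by
  conv_rhs => rw [spanLength, ENNReal.add_iInf]
  refine le_iInf fun e => ?_
  have hq : (q : ℝ≥0∞) ≠ 0 := by exact_mod_cast h.ne_zero
  have hqt : ∀ n, (q : ℝ≥0∞) ^ n ≠ ⊤ := fun n => ENNReal.pow_ne_top (ENNReal.natCast_ne_top _)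
  let L := Submodule.span (A e) g
  have hLP : (L : Set M) ⊆ P := fun x hx =>
    Submodule.span_le.mpr hgP (Submodule.span_subset_span (A e) R g hx)
  let fL : L →ₗ[A e] M' := (f.restrictScalars (A e)).comp L.subtype
  have hrange : LinearMap.range fL = Submodule.span (A e) (f '' g) := by
    rw [LinearMap.range_comp, Submodule.range_subtype]
    exact Submodule.map_span (f.restrictScalars (A e)) g
  have := h.noeth e
  have : Module.Finite (A e) L := Module.Finite.span_of_finite _ hg
  obtain ⟨s, hs⟩ := (IsNoetherian.noetherian (LinearMap.ker fL) : (LinearMap.ker fL).FG)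
  let k : Set M := Subtype.val '' (s : Set L)
  have hk : k.Finite := s.finite_toSet.image _
  have hkP : k ⊆ (P ⊓ LinearMap.ker f : Submodule R M) := by
    rintro _ ⟨x, hx, rfl⟩
    refine ⟨hLP x.2, ?_⟩
    have : x ∈ LinearMap.ker fL := hs ▸ Submodule.subset_span hx
    exact this
  refine le_trans ?_ (add_le_add_left (spanLength_le_submoduleLength A q hk hkP) _)
  conv_rhs => rw [h.spanLength_eq_iInf k e, ENNReal.iInf_add]
  refine le_iInf fun e' => ?_
  rw [ENNReal.iInf_add]
  refine le_iInf fun he' => ?_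
  refine (iInf_le _ e').trans ?_
  let S := Submodule.span (A e') g
  let S₀ := Submodule.span (A e') k
  have hLS : (L : Set M) ⊆ S := span_le_span_of_le (h.mono he') g
  have hle : S₀ ≤ S := by
    rw [Submodule.span_le]
    rintro _ ⟨x, hx, rfl⟩
    exact hLS x.2
  have h2 : Module.length (A e') S = Module.length (A e') S₀ +
      Module.length (A e') (S ⧸ S₀.submoduleOf S) :=
    Module.length_eq_add_of_exact (Submodule.inclusion hle)
      (S₀.submoduleOf S).mkQ (Submodule.inclusion_injective hle) (Submodule.mkQ_surjective _)
      (by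
        rw [LinearMap.exact_iff, Submodule.ker_mkQ, Submodule.range_inclusion]
        rfl)
  let u₀ : L →ₛₗ[Subring.inclusion (h.mono he')] S ⧸ S₀.submoduleOf S :=
    { toFun := fun x => Submodule.Quotient.mk ⟨x, hLS x.2⟩
      map_add' := fun _ _ => rfl
      map_smul' := fun _ _ => rfl }
  have hker : LinearMap.ker fL ≤ LinearMap.ker u₀ := by
    rw [← hs, Submodule.span_le]
    intro x hx
    change (Submodule.Quotient.mk _ : S ⧸ S₀.submoduleOf S) = 0
    rw [Submodule.Quotient.mk_eq_zero]
    exact Submodule.subset_span (Set.mem_image_of_mem _ hx)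
  -- The source `L ⧸ ker fL` is isomorphic to the `A e`-span of `f '' g`, and its image spans all of
  -- `S ⧸ S₀` over `A e'`.
  have h3 := h.length_span_le he' ((LinearMap.ker fL).liftQ u₀ hker)
  have h4 : Submodule.span (A e') (Set.range ((LinearMap.ker fL).liftQ u₀ hker)) = ⊤ := by
    rw [eq_top_iff]
    rintro z -
    obtain ⟨⟨z, hz⟩, rfl⟩ := Submodule.Quotient.mk_surjective _ z
    induction hz using Submodule.span_induction with
    | mem x hx =>
      exact Submodule.subset_span ⟨Submodule.Quotient.mk ⟨x, Submodule.subset_span hx⟩, rfl⟩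
    | zero => exact zero_mem _
    | add x y hx hy hx' hy' => exact add_mem hx' hy'
    | smul a x hx hx' => exact Submodule.smul_mem _ a hx'
  rw [h4, Module.length_top, (LinearMap.quotKerEquivRange fL).length_eq, hrange] at h3
  simp only [levelLength]
  rw [show Submodule.span (A e') g = S from rfl, h2, ENat.toENNReal_add, ENNReal.add_div]
  refine add_le_add le_rfl ?_
  rw [ENNReal.div_le_iff (pow_ne_zero _ hq) (hqt _)]
  have h5 := ENat.toENNReal_le.mpr h3
  refine h5.trans (le_of_eq ?_)
  obtain ⟨d, rfl⟩ := Nat.exists_eq_add_of_le he'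
  rw [Nat.add_sub_cancel_left, pow_add, ← mul_assoc, ENNReal.div_mul_cancel (pow_ne_zero _ hq)
    (hqt _), mul_comm]
  simp

/-- Subadditivity of the asymptotic length. -/
theorem IsLengthTower.submoduleLength_le_add (P : Submodule R M) (f : M →ₗ[R] M') :
    submoduleLength A q P ≤
      submoduleLength A q (P ⊓ LinearMap.ker f) + submoduleLength A q (P.map f) := by
  rw [submoduleLength_le_iff]
  intro g hg hgP
  refine (h.spanLength_le_add P f hg hgP).trans ?_
  gcongr
  exact spanLength_le_submoduleLength A q (hg.image _) (Set.image_mono hgP)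

omit [∀ e, IsLocalRing (A e)] h in
-- The kernel condition lets `g` factor through `f`, so its range is a quotient of the range of `f`.
theorem submoduleLength_range_le_of_ker_le {Y : Type*} [AddCommGroup Y] [Module R Y]
    (f : Y →ₗ[R] M) (g : Y →ₗ[R] M') (hfg : LinearMap.ker f ≤ LinearMap.ker g) :
    submoduleLength A q (LinearMap.range g) ≤ submoduleLength A q (LinearMap.range f) := by
  let F : LinearMap.range f →ₗ[R] M' :=
    ((LinearMap.ker f).liftQ g hfg).comp f.quotKerEquivRange.symm.toLinearMap
  have h1 : LinearMap.range g = (⊤ : Submodule R (LinearMap.range f)).map F := by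
    rw [Submodule.map_comp, Submodule.map_top, LinearEquiv.range, Submodule.map_top,
      Submodule.range_liftQ]
  have h2 : LinearMap.range f = (⊤ : Submodule R (LinearMap.range f)).map
      (LinearMap.range f).subtype := by
    rw [Submodule.map_top, Submodule.range_subtype]
  rw [h1]
  conv_rhs => rw [h2, submoduleLength_map_of_injective A q _ _ (Submodule.injective_subtype _)]
  exact submoduleLength_map_le A q _ _

/-- The length of `ab X` is bounded by the lengths of `a (bX ∩ ker f)` and `f (bX)`. -/
theorem IsLengthTower.submoduleLength_mul_le (a : R) (P : Submodule R M) (f : M →ₗ[R] M') :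
    submoduleLength A q (P.map (LinearMap.lsmul R M a)) ≤
      submoduleLength A q ((P ⊓ LinearMap.ker f).map (LinearMap.lsmul R M a)) +
        submoduleLength A q (P.map f) := by
  set P' := (P ⊓ LinearMap.ker f).map (LinearMap.lsmul R M a)
  refine (h.submoduleLength_le_add _ P'.mkQ).trans ?_
  refine add_le_add (submoduleLength_mono A q ?_) ?_
  · rw [Submodule.ker_mkQ]
    exact inf_le_right
  -- Multiplication by `a` sends the kernel of `f` on `P` into `P'`, so modulo `P'` it factors
  -- through `f`.
  · have := submoduleLength_range_le_of_ker_le (A := A) (q := q) (f.comp P.subtype)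
      (P'.mkQ.comp ((LinearMap.lsmul R M a).comp P.subtype)) (by
        intro x hx
        change P'.mkQ (a • (x : M)) = 0
        rw [Submodule.mkQ_apply, Submodule.Quotient.mk_eq_zero]
        exact ⟨x, ⟨x.2, hx⟩, rfl⟩)
    simpa only [LinearMap.range_comp, Submodule.range_subtype] using this

end Tower

/-! ### Asymptotic length and Frobenius -/

section Frobenius

variable {R : Type*} [CommRing R] {A : ℕ → Subring R} {q p : ℕ}

/-- The Frobenius endomorphism of `R / p` carries `A (e + 1)` onto `A e`. -/
structure IsPerfectTower (A : ℕ → Subring R) (p : ℕ) : Prop where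
  exists_eq_pow : ∀ e, ∀ r ∈ A (e + 1), ∃ s ∈ A e, ∃ z, r ^ p = s + p * z
  exists_pow_eq : ∀ e, ∀ s ∈ A e, ∃ r ∈ A (e + 1), ∃ z, r ^ p = s + p * z

variable {X Y : Type*} [AddCommGroup X] [Module R X] [AddCommGroup Y] [Module R Y]
  (φ : X →+ Y) (hφ : Function.Injective φ) (hsmul : ∀ (r : R) (x : X), φ (r • x) = r ^ p • φ x)
  (hY : ∀ y : Y, (p : R) • y = 0)
include hφ hsmul hY

omit hφ in
theorem IsPerfectTower.frobenius_mem_span (hp : IsPerfectTower A p) (e : ℕ) (g : Set X) {x : X}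
    (hx : x ∈ Submodule.span (A (e + 1)) g) : φ x ∈ Submodule.span (A e) (φ '' g) := by
  induction hx using Submodule.span_induction with
  | mem x hx => exact Submodule.subset_span ⟨x, hx, rfl⟩
  | zero => rw [map_zero]; exact zero_mem _
  | add x y _ _ hx hy => rw [map_add]; exact add_mem hx hy
  | smul a x _ hx =>
    obtain ⟨s, hs, z, hz⟩ := hp.exists_eq_pow e a a.2
    have : φ (a • x) = (⟨s, hs⟩ : A e) • φ x := by
      change φ ((a : R) • x) = s • φ x
      rw [hsmul, hz, add_smul, mul_smul, hY, add_zero]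
    rw [this]
    exact Submodule.smul_mem _ _ hx

/-- Because `p` kills `Y` and Frobenius carries `A (e + 1)` onto `A e` modulo `p`, the image under
`φ` of an `A (e + 1)`-submodule is an `A e`-submodule. Injectivity of `φ` makes this passage
injective on submodules, hence strictly monotone. -/
theorem IsPerfectTower.length_span_le (hp : IsPerfectTower A p) (e : ℕ) (g : Set X) :
    Module.length (A (e + 1)) (Submodule.span (A (e + 1)) g) ≤
      Module.length (A e) (Submodule.span (A e) (φ '' g)) := by
  let F : Submodule (A (e + 1)) (Submodule.span (A (e + 1)) g) →
      Submodule (A e) (Submodule.span (A e) (φ '' g)) := fun L =>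
    { carrier := {y | ∃ x ∈ L, φ x = y}
      add_mem' := by
        rintro _ _ ⟨x, hx, hx'⟩ ⟨y, hy, hy'⟩
        exact ⟨x + y, add_mem hx hy, by simp [hx', hy']⟩
      zero_mem' := ⟨0, zero_mem _, by simp⟩
      smul_mem' := by
        rintro a _ ⟨x, hx, hx'⟩
        obtain ⟨r, hr, z, hz⟩ := hp.exists_pow_eq e a a.2
        refine ⟨(⟨r, hr⟩ : A (e + 1)) • x, Submodule.smul_mem _ _ hx, ?_⟩
        change φ (r • (x : X)) = (a : R) • _
        rw [hsmul, hz, add_smul, mul_smul, hY, add_zero, hx'] }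
  refine length_le_of_strictMono F (Monotone.strictMono_of_injective ?_ ?_)
  · rintro L L' hL y ⟨x, hx, hx'⟩
    exact ⟨x, hL hx, hx'⟩
  · have key : ∀ L L', F L = F L' → L ≤ L' := by
      intro L L' hL x hx
      have h1 : (⟨φ x, hp.frobenius_mem_span φ hsmul hY e g x.2⟩ :
          Submodule.span (A e) (φ '' g)) ∈ F L := ⟨x, hx, rfl⟩
      rw [hL] at h1
      obtain ⟨y, hy, hxy⟩ := h1
      rwa [← Subtype.ext (hφ hxy)]
    exact fun L L' hL => le_antisymm (key L L' hL) (key L' L hL.symm)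

/-- An injective Frobenius-semilinear map multiplies asymptotic lengths by at least `q`. -/
theorem IsPerfectTower.mul_submoduleLength_le (hp : IsPerfectTower A p) (hq : q ≠ 0)
    (P : Submodule R X) (Q : Submodule R Y) (hPQ : ∀ x ∈ P, φ x ∈ Q) :
    q * submoduleLength A q P ≤ submoduleLength A q Q := by
  have hq0 : (q : ℝ≥0∞) ≠ 0 := by exact_mod_cast hq
  have hqt : (q : ℝ≥0∞) ≠ ⊤ := ENNReal.natCast_ne_top _
  rw [mul_comm, ← ENNReal.le_div_iff_mul_le (Or.inl hq0) (Or.inl hqt), submoduleLength_le_iff]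
  intro g hg hgP
  rw [ENNReal.le_div_iff_mul_le (Or.inl hq0) (Or.inl hqt)]
  refine le_trans ?_ (spanLength_le_submoduleLength A q (hg.image φ)
    (by rintro _ ⟨x, hx, rfl⟩; exact hPQ x (hgP hx)))
  refine le_iInf fun e => ?_
  have h1 := ENat.toENNReal_le.mpr (hp.length_span_le φ hφ hsmul hY e g)
  -- Level `e + 1` for `g` is compared with level `e` for its image; the denominators `q ^ (e + 1)`
  -- and `q ^ e` differ by the factor gained.
  calc spanLength A q g * q ≤ levelLength A q (e + 1) g * q := by
        gcongr
        exact iInf_le _ _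
    _ = (Module.length (A (e + 1)) (Submodule.span (A (e + 1)) g) : ℝ≥0∞) / (q : ℝ≥0∞) ^ e := by
        rw [levelLength, pow_succ, ENNReal.div_eq_inv_mul, ENNReal.div_eq_inv_mul,
          ENNReal.mul_inv (Or.inr hqt) (Or.inr hq0)]
        rw [mul_assoc, mul_assoc, mul_comm _ (q : ℝ≥0∞), ← mul_assoc (q : ℝ≥0∞)⁻¹,
          ENNReal.inv_mul_cancel hq0 hqt, one_mul]
    _ ≤ levelLength A q e (φ '' g) := ENNReal.div_le_div_right h1 _

end Frobenius

/-! ### Lengths of quotients by powers -/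

section QuotientLength

theorem Module.length_le_add_of_exact {B : Type*} [CommRing B] {N M P : Type*} [AddCommGroup N]
    [AddCommGroup M] [AddCommGroup P] [Module B N] [Module B M] [Module B P] (f : N →ₗ[B] M)
    (g : M →ₗ[B] P) (hfg : LinearMap.ker g ≤ LinearMap.range f) :
    Module.length B M ≤ Module.length B N + Module.length B P := by
  rw [Module.length_eq_add_of_exact (LinearMap.ker g).subtype g.rangeRestrict
    (Submodule.injective_subtype _) g.surjective_rangeRestrict
    (by rw [LinearMap.exact_iff, LinearMap.ker_rangeRestrict, Submodule.range_subtype])]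
  refine add_le_add ?_ (Module.length_le_of_injective _ (Submodule.injective_subtype _))
  exact (Module.length_le_of_injective _ (Submodule.inclusion_injective hfg)).trans
    (Module.length_le_of_surjective _ f.surjective_rangeRestrict)

variable {B : Type*} [CommRing B]

/-- The sequence `B/(J, a) → B/(J, ab) → B/(J, b) → 0`, whose first map is multiplication by `b`, is
exact. -/
theorem length_quotient_sup_span_mul_le (J : Ideal B) (a b : B) :
    Module.length B (B ⧸ (J ⊔ Ideal.span {a * b})) ≤
      Module.length B (B ⧸ (J ⊔ Ideal.span {a})) + Module.length B (B ⧸ (J ⊔ Ideal.span {b})) := by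
  have h1 : J ⊔ Ideal.span {a} ≤
      LinearMap.ker ((J ⊔ Ideal.span {a * b}).mkQ.comp (LinearMap.lsmul B B b)) := by
    refine sup_le (fun x hx => ?_) ?_
    · change (J ⊔ Ideal.span {a * b}).mkQ (b • x) = 0
      rw [Submodule.mkQ_apply, Submodule.Quotient.mk_eq_zero]
      exact Ideal.mem_sup_left (Ideal.mul_mem_left _ _ hx)
    · rw [Ideal.span_singleton_le_iff_mem]
      change (J ⊔ Ideal.span {a * b}).mkQ (b • a) = 0
      rw [Submodule.mkQ_apply, Submodule.Quotient.mk_eq_zero, smul_eq_mul, mul_comm]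
      exact Ideal.mem_sup_right (Ideal.mem_span_singleton_self _)
  have h2 : J ⊔ Ideal.span {a * b} ≤ J ⊔ Ideal.span {b} :=
    sup_le_sup le_rfl (by
      rw [Ideal.span_singleton_le_span_singleton]
      exact Dvd.intro_left _ rfl)
  refine Module.length_le_add_of_exact ((J ⊔ Ideal.span {a}).liftQ _ h1)
    (Submodule.factor h2) ?_
  intro x hx
  obtain ⟨x, rfl⟩ := Submodule.Quotient.mk_surjective _ x
  have hx' : x ∈ J ⊔ Ideal.span {b} := by
    rw [← Submodule.Quotient.mk_eq_zero]
    exact hx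
  obtain ⟨y, hy, z, hz, rfl⟩ := Submodule.mem_sup.mp hx'
  obtain ⟨c, rfl⟩ := Ideal.mem_span_singleton.mp hz
  refine ⟨Submodule.Quotient.mk c, ?_⟩
  change Submodule.Quotient.mk (b * c) = _
  rw [Submodule.Quotient.eq, sub_add_cancel_right]
  exact neg_mem (Ideal.mem_sup_left hy)

theorem length_quotient_sup_span_pow_le (J : Ideal B) (a : B) (N : ℕ) :
    Module.length B (B ⧸ (J ⊔ Ideal.span {a ^ N})) ≤
      N * Module.length B (B ⧸ (J ⊔ Ideal.span {a})) := by
  induction N with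
  | zero =>
    have : J ⊔ Ideal.span {a ^ 0} = ⊤ := by simp
    rw [this]
    simp
  | succ N ih =>
    rw [pow_succ]
    refine (length_quotient_sup_span_mul_le J _ a).trans ?_
    push_cast
    rw [add_mul, one_mul]
    gcongr

theorem length_quotient_congr {I J : Ideal B} (h : I = J) :
    Module.length B (B ⧸ I) = Module.length B (B ⧸ J) := by
  subst h
  rfl

/-- The generators are replaced by their powers one at a time; `J` is kept general so that it can
absorb the power just treated. -/
theorem length_quotient_sup_span_image_pow_le {ι : Type*} (a : ι → B) (N : ℕ) (s : Finset ι)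
    (J : Ideal B) :
    Module.length B (B ⧸ (J ⊔ Ideal.span ((fun i => a i ^ N) '' s))) ≤
      (N ^ s.card : ℕ) * Module.length B (B ⧸ (J ⊔ Ideal.span (a '' s))) := by
  classical
  induction s using Finset.induction_on generalizing J with
  | empty =>
    rw [length_quotient_congr (I := J ⊔ Ideal.span ((fun i => a i ^ N) '' (∅ : Finset ι)))
      (J := J ⊔ Ideal.span (a '' (∅ : Finset ι))) (by simp)]
    simp
  | insert i s hi ih =>
    have h1 : J ⊔ Ideal.span ((fun i => a i ^ N) '' (insert i s : Finset ι)) =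
        (J ⊔ Ideal.span {a i ^ N}) ⊔ Ideal.span ((fun i => a i ^ N) '' s) := by
      rw [Finset.coe_insert, Set.image_insert_eq, Ideal.span_insert, sup_assoc]
    have h2 : J ⊔ Ideal.span (a '' (insert i s : Finset ι)) =
        (J ⊔ Ideal.span (a '' s)) ⊔ Ideal.span {a i} := by
      rw [Finset.coe_insert, Set.image_insert_eq, Ideal.span_insert, sup_assoc,
        sup_comm (Ideal.span {a i})]
    rw [length_quotient_congr h1, length_quotient_congr h2, Finset.card_insert_of_notMem hi]
    refine (ih _).trans ?_
    rw [pow_succ, Nat.cast_mul, mul_assoc]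
    refine mul_le_mul_right ?_ _
    rw [length_quotient_congr (sup_right_comm J (Ideal.span {a i ^ N}) (Ideal.span (a '' s)))]
    exact length_quotient_sup_span_pow_le _ _ _

theorem length_quotient_span_range_pow_le {ι : Type*} [Fintype ι] (a : ι → B) (N : ℕ) :
    Module.length B (B ⧸ Ideal.span (Set.range fun i => a i ^ N)) ≤
      (N ^ Fintype.card ι : ℕ) * Module.length B (B ⧸ Ideal.span (Set.range a)) := by
  have h := length_quotient_sup_span_image_pow_le a N Finset.univ ⊥
  have h1 : ∀ b : ι → B, ⊥ ⊔ Ideal.span (b '' (Finset.univ : Finset ι)) =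
      Ideal.span (Set.range b) := fun b => by simp
  rwa [length_quotient_congr (h1 a), length_quotient_congr (h1 _), Finset.card_univ] at h

/-- Each surjection `B/(a^{N+1}) → B/(a^N)` has the class of `a^N` as a nonzero element of its
kernel. -/
theorem natCast_le_length_quotient_span_pow (a : B) (N : ℕ)
    (ha : ∀ i, a ^ i ∉ Ideal.span {a ^ (i + 1)}) :
    (N : ℕ∞) ≤ Module.length B (B ⧸ Ideal.span {a ^ N}) := by
  induction N with
  | zero => simp
  | succ N ih =>
    have hle : Ideal.span {a ^ (N + 1)} ≤ Ideal.span {a ^ N} := by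
      rw [Ideal.span_singleton_le_span_singleton]
      exact pow_dvd_pow _ (Nat.le_succ N)
    let F := Submodule.factor hle
    rw [Module.length_eq_add_of_exact (LinearMap.ker F).subtype F
      (Submodule.injective_subtype _) (Submodule.factor_surjective hle)
      (by rw [LinearMap.exact_iff, Submodule.range_subtype]), add_comm (Module.length B _)]
    refine (Nat.cast_add N 1).le.trans (add_le_add ih ?_)
    rw [Nat.cast_one]
    rw [Order.one_le_iff_ne_zero, ← pos_iff_ne_zero, Module.length_pos_iff]
    refine ⟨⟨⟨Submodule.Quotient.mk (a ^ N), ?_⟩, 0, ?_⟩⟩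
    · change (Submodule.Quotient.mk (a ^ N) : B ⧸ Ideal.span {a ^ N}) = 0
      rw [Submodule.Quotient.mk_eq_zero]
      exact Ideal.mem_span_singleton_self _
    · intro h
      have := congrArg Subtype.val h
      exact ha N ((Submodule.Quotient.mk_eq_zero _).mp this)

end QuotientLength

/-! ### The rings `V[p^{1/p^e}]` -/

section CoeffLevel

variable (p : ℕ) [Fact p.Prime] (V : Type u) [CommRing V] (e : ℕ)

theorem coeffPoly_monic [Nontrivial V] :
    (Polynomial.X ^ (p ^ e) - Polynomial.C (p : V) : V[X]).Monic :=
  Polynomial.monic_X_pow_sub_C _ (pow_ne_zero _ (Fact.out : p.Prime).ne_zero)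

instance [Nontrivial V] : Module.Finite V (CoeffLevel p V e) :=
  (coeffPoly_monic p V e).finite_adjoinRoot

omit [Fact p.Prime] in
theorem coeffLevel_of_natCast :
    AdjoinRoot.of (Polynomial.X ^ (p ^ e) - Polynomial.C (p : V) : V[X]) (p : V) =
      (p : CoeffLevel p V e) :=
  map_natCast _ _

variable {p V e}

omit [Fact p.Prime] in
-- Membership is tested on `V` and `p^{1/p^e}`, which generate the ring. Below, `W` is a quotient
-- and `S` the range of a homomorphism such as Frobenius.
theorem coeffLevel_mem_of_mem {W : Type*} [CommRing W] (ψ : CoeffLevel p V e →+* W)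
    (S : Subring W) (h1 : ∀ a, ψ (AdjoinRoot.of _ a) ∈ S) (h2 : ψ (coeffRoot p V e) ∈ S)
    (x : CoeffLevel p V e) : ψ x ∈ S := by
  induction x using AdjoinRoot.induction_on with
  | ih f =>
    induction f using Polynomial.induction_on with
    | C a => exact h1 a
    | add f g hf hg => rw [map_add, map_add]; exact add_mem hf hg
    | monomial n a _ =>
      rw [map_mul, map_mul, map_pow, map_pow]
      exact mul_mem (h1 a) (pow_mem h2 _)

variable (p V e)

omit [Fact p.Prime] in
theorem coeffLevel_exists_sub_mem (x : CoeffLevel p V e) :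
    ∃ a : V, x - AdjoinRoot.of _ a ∈ Ideal.span {coeffRoot p V e} := by
  have h := coeffLevel_mem_of_mem (Ideal.Quotient.mk (Ideal.span {coeffRoot p V e}))
    ((Ideal.Quotient.mk (Ideal.span {coeffRoot p V e})).comp (AdjoinRoot.of _)).range
    (fun a => ⟨a, rfl⟩) ⟨0, by
      rw [map_zero, eq_comm, Ideal.Quotient.eq_zero_iff_mem]
      exact Ideal.mem_span_singleton_self _⟩ x
  obtain ⟨a, ha⟩ := h
  exact ⟨a, Ideal.Quotient.eq.mp ha.symm⟩

variable [IsLocalRing V] [hV : Fact (maximalIdeal V = Ideal.span {(p : V)})]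

theorem coeffRoot_span_isMaximal : (Ideal.span {coeffRoot p V e}).IsMaximal := by
  have hp0 : (p : V) ∈ maximalIdeal V := by
    rw [hV.out]; exact Ideal.mem_span_singleton_self _
  let θ : CoeffLevel p V e →+* ResidueField V := AdjoinRoot.lift (residue V) 0 (by
    have : residue V (p : V) = 0 := (residue_eq_zero_iff _).mpr hp0
    rw [map_natCast] at this
    simp [this, (Fact.out : p.Prime).ne_zero])
  have hθ : Ideal.span {coeffRoot p V e} ≤ RingHom.ker θ := by
    rw [Ideal.span_singleton_le_iff_mem, RingHom.mem_ker]
    simp [θ, coeffRoot]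
  rw [Ideal.isMaximal_iff]
  refine ⟨fun h => ?_, fun J x hJ hx hxJ => ?_⟩
  · have := hθ h
    rw [RingHom.mem_ker, map_one] at this
    exact one_ne_zero this
  · obtain ⟨a, ha⟩ := coeffLevel_exists_sub_mem p V e x
    have h1 : IsUnit a := by
      by_contra h
      have : a ∈ maximalIdeal V := h
      rw [hV.out, Ideal.mem_span_singleton] at this
      obtain ⟨b, rfl⟩ := this
      apply hx
      have h2 : AdjoinRoot.of (Polynomial.X ^ (p ^ e) - Polynomial.C (p : V) : V[X]) (p * b) ∈
          Ideal.span {coeffRoot p V e} := by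
        rw [map_mul, coeffLevel_of_natCast, ← coeffRoot_pow]
        refine Ideal.mul_mem_right _ _ (Ideal.pow_mem_of_mem _
          (Ideal.mem_span_singleton_self _) _ (pow_pos (Fact.out : p.Prime).pos _))
      simpa using add_mem ha h2
    have h2 : AdjoinRoot.of (Polynomial.X ^ (p ^ e) - Polynomial.C (p : V) : V[X]) a ∈ J := by
      simpa using sub_mem hxJ (hJ ha)
    exact J.eq_top_iff_one.mp (Ideal.eq_top_of_isUnit_mem _ h2 (h1.map _))

/-- By integrality over `V` every maximal ideal lies over `pV`, so it contains `p =
(p^{1/p^e})^{p^e}` and therefore `p^{1/p^e}`, which already generates a maximal ideal. -/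
instance : IsLocalRing (CoeffLevel p V e) := by
  refine IsLocalRing.of_unique_max_ideal
    ⟨Ideal.span {coeffRoot p V e}, coeffRoot_span_isMaximal p V e, fun J hJ => ?_⟩
  have h1 := Ideal.isMaximal_comap_of_isIntegral_of_isMaximal (R := V) J
  have h2 : (p : V) ∈ J.comap (algebraMap V (CoeffLevel p V e)) := by
    rw [IsLocalRing.eq_maximalIdeal h1, hV.out]
    exact Ideal.mem_span_singleton_self _
  rw [Ideal.mem_comap, AdjoinRoot.algebraMap_eq, coeffLevel_of_natCast, ← coeffRoot_pow] at h2
  refine ((coeffRoot_span_isMaximal p V e).eq_of_le hJ.ne_top ?_).symm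
  rw [Ideal.span_singleton_le_iff_mem]
  exact hJ.isPrime.mem_of_pow_mem _ h2

theorem coeffLevel_maximalIdeal :
    maximalIdeal (CoeffLevel p V e) = Ideal.span {coeffRoot p V e} :=
  (IsLocalRing.eq_maximalIdeal (coeffRoot_span_isMaximal p V e)).symm

instance coeffLevel_isNoetherianRing [IsNoetherianRing V] : IsNoetherianRing (CoeffLevel p V e) :=
  IsNoetherianRing.of_finite V _

/-- Otherwise `π^i (1 - πz) = 0` with `π = p^{1/p^e}`. The second factor is a unit of a local ring,
so `π`, and with it `p`, would be nilpotent, although `V` embeds in the ring. No domain property of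
the extension is needed. -/
theorem coeffRoot_pow_notMem [IsDomain V] (hp0 : (p : V) ≠ 0) (i : ℕ) :
    coeffRoot p V e ^ i ∉ Ideal.span {coeffRoot p V e ^ (i + 1)} := by
  intro h
  obtain ⟨z, hz⟩ := Ideal.mem_span_singleton.mp h
  have h1 : coeffRoot p V e ^ i * (1 - coeffRoot p V e * z) = 0 := by
    rw [mul_sub, mul_one, ← mul_assoc, ← pow_succ, ← hz, sub_self]
  have h2 : IsUnit (1 - coeffRoot p V e * z) := by
    by_contra h
    have h3 : 1 - coeffRoot p V e * z ∈ maximalIdeal (CoeffLevel p V e) := h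
    have h4 : coeffRoot p V e * z ∈ maximalIdeal (CoeffLevel p V e) := by
      rw [coeffLevel_maximalIdeal]
      exact Ideal.mul_mem_right _ _ (Ideal.mem_span_singleton_self _)
    have := add_mem h3 h4
    rw [sub_add_cancel] at this
    exact (Ideal.ne_top_iff_one _).mp (maximalIdeal.isMaximal _).ne_top this
  rw [h2.mul_left_eq_zero] at h1
  have h3 : ((p : V) ^ i) = 0 := by
    have hinj := AdjoinRoot.of.injective_of_degree_ne_zero
      (f := (Polynomial.X ^ (p ^ e) - Polynomial.C (p : V) : V[X])) (by
        rw [Polynomial.degree_X_pow_sub_C (pow_pos (Fact.out : p.Prime).pos e)]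
        exact_mod_cast pow_ne_zero _ (Fact.out : p.Prime).ne_zero)
    apply hinj
    rw [map_pow, map_natCast, map_zero]
    change (p : CoeffLevel p V e) ^ i = 0
    rw [← coeffRoot_pow, ← pow_mul, mul_comm, pow_mul, h1, zero_pow]
    exact pow_ne_zero _ (Fact.out : p.Prime).ne_zero
  exact hp0 (eq_zero_of_pow_eq_zero h3)

/-- The image of `V[p^{1/p^e}]` in `V[p^{1/p^{e+1}}] / p` is the image of Frobenius. -/
theorem coeffLevel_exists_eq_pow (c : CoeffLevel p V (e + 1)) :
    ∃ s : CoeffLevel p V e,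
      (p : CoeffLevel p V (e + 1)) ∣ c ^ p - coeffTransition p V e (e + 1) (Nat.le_succ e) s := by
  have hp : (p : CoeffLevel p V (e + 1)) ∈ nonunits (CoeffLevel p V (e + 1)) := by
    change _ ∈ maximalIdeal _
    rw [coeffLevel_maximalIdeal, ← coeffRoot_pow]
    exact Ideal.pow_mem_of_mem _ (Ideal.mem_span_singleton_self _) _
      (pow_pos (Fact.out : p.Prime).pos _)
  have := CharP.quotient _ p hp
  obtain ⟨s, hs⟩ := coeffLevel_mem_of_mem
    ((frobenius _ p).comp (Ideal.Quotient.mk (Ideal.span {(p : CoeffLevel p V (e + 1))})))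
    ((Ideal.Quotient.mk (Ideal.span {(p : CoeffLevel p V (e + 1))})).comp
      (coeffTransition p V e (e + 1) (Nat.le_succ e))).range
    (fun a => ⟨AdjoinRoot.of _ (a ^ p), by
      rw [RingHom.comp_apply, coeffTransition_of, RingHom.comp_apply, frobenius_def, ← map_pow,
        map_pow (AdjoinRoot.of _)]⟩)
    ⟨coeffRoot p V e, by
      rw [RingHom.comp_apply, coeffTransition_root, RingHom.comp_apply, frobenius_def, ← map_pow,
        Nat.add_sub_cancel_left, pow_one]⟩ c
  refine ⟨s, ?_⟩
  rw [← Ideal.mem_span_singleton, ← Ideal.Quotient.eq, map_pow]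
  exact hs.symm

/-- Both kinds of generators are `p`-th powers modulo `p`: elements of `V` because the residue field
`V/pV` is perfect, and `p^{1/p^e}` because it is the `p`-th power of `p^{1/p^{e+1}}`. -/
theorem coeffLevel_exists_pow_eq [PerfectField (ResidueField V)] (s : CoeffLevel p V e) :
    ∃ c : CoeffLevel p V (e + 1),
      (p : CoeffLevel p V (e + 1)) ∣ c ^ p - coeffTransition p V e (e + 1) (Nat.le_succ e) s := by
  have hp : (p : CoeffLevel p V (e + 1)) ∈ nonunits (CoeffLevel p V (e + 1)) := by
    change _ ∈ maximalIdeal _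
    rw [coeffLevel_maximalIdeal, ← coeffRoot_pow]
    exact Ideal.pow_mem_of_mem _ (Ideal.mem_span_singleton_self _) _
      (pow_pos (Fact.out : p.Prime).pos _)
  have := CharP.quotient _ p hp
  have hres : CharP (ResidueField V) p := by
    rw [CharP.charP_iff_prime_eq_zero Fact.out, ← map_natCast (residue V), residue_eq_zero_iff,
      hV.out]
    exact Ideal.mem_span_singleton_self _
  have hperf : ∀ a : V, ∃ b c : V, a = b ^ p + p * c := by
    intro a
    obtain ⟨y, hy⟩ := surjective_frobenius (ResidueField V) p (residue V a)
    obtain ⟨b, rfl⟩ := residue_surjective y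
    have h1 : a - b ^ p ∈ maximalIdeal V := by
      rw [← residue_eq_zero_iff, map_sub, map_pow, sub_eq_zero]
      exact hy.symm
    rw [hV.out, Ideal.mem_span_singleton] at h1
    obtain ⟨c, hc⟩ := h1
    exact ⟨b, c, by rw [← hc, add_sub_cancel]⟩
  obtain ⟨y, hy⟩ := coeffLevel_mem_of_mem
    ((Ideal.Quotient.mk (Ideal.span {(p : CoeffLevel p V (e + 1))})).comp
      (coeffTransition p V e (e + 1) (Nat.le_succ e)))
    (frobenius (CoeffLevel p V (e + 1) ⧸ Ideal.span {(p : CoeffLevel p V (e + 1))}) p).range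
    (fun a => by
      obtain ⟨b, c, rfl⟩ := hperf a
      refine ⟨Ideal.Quotient.mk _ (AdjoinRoot.of _ b), ?_⟩
      rw [RingHom.comp_apply, coeffTransition_of, frobenius_def, ← map_pow, map_add, map_mul,
        coeffLevel_of_natCast, ← map_pow (AdjoinRoot.of _), Ideal.Quotient.eq, sub_add_cancel_left, neg_mem_iff,
        Ideal.mem_span_singleton]
      exact dvd_mul_right _ _)
    ⟨Ideal.Quotient.mk _ (coeffRoot p V (e + 1)), by
      rw [RingHom.comp_apply, coeffTransition_root, frobenius_def, ← map_pow,
        Nat.add_sub_cancel_left, pow_one]⟩ s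
  obtain ⟨c, rfl⟩ := Ideal.Quotient.mk_surjective y
  refine ⟨c, ?_⟩
  rw [← Ideal.mem_span_singleton, ← Ideal.Quotient.eq, map_pow]
  exact hy

end CoeffLevel

/-! ### The rings `R_e` -/

section RLevel

theorem MvPowerSeries.mem_span_X_of_constantCoeff_eq_zero {n : ℕ} {B : Type*} [CommRing B]
    {f : MvPowerSeries (Fin n) B} (hf : MvPowerSeries.constantCoeff f = 0) :
    f ∈ Ideal.span (Set.range (MvPowerSeries.X : Fin n → MvPowerSeries (Fin n) B)) := by
  classical
  -- Every nonconstant monomial of `f` is assigned to the smallest variable that divides it.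
  let c : Fin n → MvPowerSeries (Fin n) B := fun i m =>
    if ∀ j < i, m j = 0 then MvPowerSeries.coeff (m + Finsupp.single i 1) f else 0
  have h : f = ∑ i, c i * MvPowerSeries.X i := by
    ext m
    rw [map_sum]
    by_cases hm : m = 0
    · subst hm
      rw [MvPowerSeries.coeff_zero_eq_constantCoeff_apply, hf, eq_comm]
      refine Finset.sum_eq_zero fun i _ => ?_
      rw [MvPowerSeries.coeff_zero_eq_constantCoeff_apply, map_mul, MvPowerSeries.constantCoeff_X,
        mul_zero]
    · have hex : ∃ i, m i ≠ 0 := by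
        by_contra! h
        exact hm (Finsupp.ext h)
      have hne : (Finset.univ.filter fun i => m i ≠ 0).Nonempty := by
        obtain ⟨i, hi⟩ := hex
        exact ⟨i, by simpa using hi⟩
      obtain ⟨i, hi, hmin⟩ := Finset.exists_min_image _ id hne
      simp only [Finset.mem_filter, Finset.mem_univ, true_and, id] at hi hmin
      rw [Finset.sum_eq_single i]
      · have hle : Finsupp.single i 1 ≤ m := by
          rw [Finsupp.single_le_iff]
          omega
        rw [MvPowerSeries.X, MvPowerSeries.coeff_mul_monomial, if_pos hle, mul_one]
        change _ = if _ then _ else _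
        rw [if_pos, tsub_add_cancel_of_le hle]
        intro j hj
        by_contra h
        have hmj : m j ≠ 0 := by
          intro h0
          simp [h0] at h
        exact absurd (hmin j hmj) (not_le.mpr hj)
      · intro j _ hji
        rw [MvPowerSeries.X, MvPowerSeries.coeff_mul_monomial, mul_one]
        split_ifs with hle
        · change (if _ then _ else _) = _
          rw [Finsupp.single_le_iff] at hle
          rw [if_neg]
          intro h
          have h1 := hmin j (by omega)
          have h2 := h i (lt_of_le_of_ne h1 (Ne.symm hji))
          simp [hji] at h2
          exact hi h2
        · rfl
      · simp
  rw [h]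
  exact sum_mem fun i _ => Ideal.mul_mem_left _ _ (Ideal.subset_span ⟨i, rfl⟩)

variable (p n : ℕ) (V : Type u) [CommRing V] (e : ℕ)

/-- The regular system of parameters `p^{1/p^e}, x_2^{1/p^e}, …, x_d^{1/p^e}` of `R_e`. -/
def levelGen : Fin (n + 1) → RLevel p n V e :=
  Fin.cons (MvPowerSeries.C (coeffRoot p V e)) MvPowerSeries.X

variable [Fact p.Prime]

theorem levelTransition_levelGen (f : ℕ) (h : e ≤ f) (i : Fin (n + 1)) :
    levelTransition p n V e f h (levelGen p n V e i) = levelGen p n V f i ^ p ^ (f - e) := by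
  refine Fin.cases ?_ (fun i => ?_) i
  · simp [levelGen, levelTransition, MvPowerSeries.expand_C, coeffTransition_root]
  · simp [levelGen, levelTransition, MvPowerSeries.expand_X]

variable [IsLocalRing V] [hV : Fact (maximalIdeal V = Ideal.span {(p : V)})]

theorem rLevel_maximalIdeal :
    maximalIdeal (RLevel p n V e) = Ideal.span (Set.range (levelGen p n V e)) := by
  refine le_antisymm (fun f hf => ?_) (Ideal.span_le.mpr ?_)
  · have h1 : MvPowerSeries.constantCoeff f ∈ maximalIdeal (CoeffLevel p V e) := by
      intro h
      exact hf (MvPowerSeries.isUnit_iff_constantCoeff.mpr h)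
    rw [coeffLevel_maximalIdeal, Ideal.mem_span_singleton] at h1
    obtain ⟨z, hz⟩ := h1
    have h2 : f - MvPowerSeries.C (MvPowerSeries.constantCoeff f) ∈
        Ideal.span (Set.range (levelGen p n V e)) := by
      refine Ideal.span_mono ?_ (MvPowerSeries.mem_span_X_of_constantCoeff_eq_zero (by simp))
      rintro _ ⟨i, rfl⟩
      exact ⟨i.succ, rfl⟩
    have h3 : MvPowerSeries.C (MvPowerSeries.constantCoeff f) ∈
        Ideal.span (Set.range (levelGen p n V e)) := by
      rw [hz, map_mul]
      exact Ideal.mul_mem_right _ _ (Ideal.subset_span ⟨0, rfl⟩)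
    simpa using add_mem h2 h3
  · rintro _ ⟨i, rfl⟩
    change ¬ IsUnit _
    rw [MvPowerSeries.isUnit_iff_constantCoeff]
    refine Fin.cases ?_ (fun i => ?_) i
    · have : coeffRoot p V e ∈ maximalIdeal (CoeffLevel p V e) := by
        rw [coeffLevel_maximalIdeal]
        exact Ideal.mem_span_singleton_self _
      simpa [levelGen] using this
    · simp [levelGen]

theorem rLevel_maximalIdeal_map (f : ℕ) (h : e ≤ f) :
    (maximalIdeal (RLevel p n V e)).map (levelTransition p n V e f h) =
      Ideal.span (Set.range fun i => levelGen p n V f i ^ p ^ (f - e)) := by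
  rw [rLevel_maximalIdeal, Ideal.map_span, ← Set.range_comp]
  congr 2
  ext1 i
  exact levelTransition_levelGen p n V e f h i

theorem rLevel_exists_sub_mem (x : RLevel p n V e) :
    ∃ a : V, x - MvPowerSeries.C (AdjoinRoot.of _ a) ∈ maximalIdeal (RLevel p n V e) := by
  obtain ⟨a, ha⟩ := coeffLevel_exists_sub_mem p V e (MvPowerSeries.constantCoeff x)
  refine ⟨a, ?_⟩
  rw [← coeffLevel_maximalIdeal] at ha
  intro h
  refine ha ?_
  rw [MvPowerSeries.isUnit_iff_constantCoeff] at h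
  simpa using h

/-- The fibre is the quotient by the `p^{f-e}`-th powers of the `n + 1` parameters of `R_f`.
Bounding its length from above requires no regularity of these parameters. -/
theorem rLevel_length_fiber_le (f : ℕ) (h : e ≤ f) :
    Module.length (RLevel p n V f) (RLevel p n V f ⧸
      (maximalIdeal (RLevel p n V e)).map (levelTransition p n V e f h)) ≤
      ((p ^ (n + 1)) ^ (f - e) : ℕ) := by
  rw [length_quotient_congr (rLevel_maximalIdeal_map p n V e f h)]
  refine (length_quotient_span_range_pow_le _ _).trans ?_
  rw [length_quotient_congr (rLevel_maximalIdeal p n V f).symm, Fintype.card_fin, ← pow_mul,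
    ← pow_mul, mul_comm (f - e)]
  have : IsSimpleModule (RLevel p n V f) (RLevel p n V f ⧸ maximalIdeal (RLevel p n V f)) :=
    (isSimpleModule_iff_isCoatom ..).mpr (maximalIdeal.isMaximal _).out
  rw [Module.length_eq_one, mul_one]

omit [Fact p.Prime] [IsLocalRing V] hV in
theorem coeff_mem_of_mem_span_pow {N : ℕ} {x : RLevel p n V e}
    (hx : x ∈ Ideal.span (Set.range fun i => levelGen p n V e i ^ N)) (m : Fin n →₀ ℕ)
    (hm : ∀ i, m i < N) :
    MvPowerSeries.coeff m x ∈ Ideal.span {coeffRoot p V e ^ N} := by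
  classical
  induction hx using Submodule.span_induction generalizing m with
  | mem x hx =>
    obtain ⟨i, rfl⟩ := hx
    refine Fin.cases ?_ (fun i => ?_) i
    · simp only [levelGen, Fin.cons_zero, ← map_pow, MvPowerSeries.coeff_C]
      split_ifs
      · exact Ideal.mem_span_singleton_self _
      · exact zero_mem _
    · simp only [levelGen, Fin.cons_succ, MvPowerSeries.coeff_X_pow]
      rw [if_neg]
      · exact zero_mem _
      · rintro rfl
        simpa using hm i
  | zero => simp
  | add x y _ _ hx hy => rw [map_add]; exact add_mem (hx m hm) (hy m hm)
  | smul a x _ hx =>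
    rw [smul_eq_mul, MvPowerSeries.coeff_mul]
    refine sum_mem fun k hk => Ideal.mul_mem_left _ _ (hx _ fun i => ?_)
    have := Finset.HasAntidiagonal.mem_antidiagonal.mp hk
    have h2 : m i = k.1 i + k.2 i := by rw [← this]; rfl
    have := hm i
    omega

/-- Since the coefficient ring surjects onto the residue field of `R_e`, the length may be bounded
below over the coefficient ring. Reading off the coefficients of the `N ^ n` monomials with all
exponents below `N` maps the quotient onto that many copies of `V[p^{1/p^e}]/(p^{N/p^e})`, each of
length at least `N`. -/
theorem le_rLevel_length_quotient [IsDomain V] (hp0 : (p : V) ≠ 0) (N : ℕ) :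
    ((N ^ (n + 1) : ℕ) : ℕ∞) ≤ Module.length (RLevel p n V e)
      (RLevel p n V e ⧸ Ideal.span (Set.range fun i => levelGen p n V e i ^ N)) := by
  set J := Ideal.span (Set.range fun i => levelGen p n V e i ^ N) with hJ
  have hfin : IsFiniteLength (RLevel p n V e) (RLevel p n V e ⧸ J) := by
    rw [← Module.length_ne_top_iff]
    refine ((length_quotient_span_range_pow_le _ _).trans_lt ?_).ne
    rw [length_quotient_congr (rLevel_maximalIdeal p n V e).symm]
    have : IsSimpleModule (RLevel p n V e) (RLevel p n V e ⧸ maximalIdeal (RLevel p n V e)) :=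
      (isSimpleModule_iff_isCoatom ..).mpr (maximalIdeal.isMaximal _).out
    rw [Module.length_eq_one, mul_one]
    exact ENat.natCast_lt_top _
  have h1 := length_le_of_residue_surjective
    (algebraMap (CoeffLevel p V e) (RLevel p n V e))
    (fun b => by
      obtain ⟨a, ha⟩ := rLevel_exists_sub_mem p n V e b
      exact ⟨_, ha⟩) hfin
    (N := RLevel p n V e ⧸ J)
    { toFun := fun x => x
      map_add' := fun _ _ => rfl
      map_smul' := fun a x => by
        obtain ⟨x, rfl⟩ := Submodule.Quotient.mk_surjective _ x
        rw [← Submodule.Quotient.mk_smul, ← Submodule.Quotient.mk_smul, algebraMap_smul] }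
    (fun _ _ h => h)
  refine le_trans ?_ h1
  let E : (Fin n → Fin N) → Fin n →₀ ℕ := fun m => Finsupp.equivFunOnFinite.symm fun i => m i
  let u : RLevel p n V e →ₗ[CoeffLevel p V e]
      ((Fin n → Fin N) → CoeffLevel p V e ⧸ Ideal.span {coeffRoot p V e ^ N}) :=
    LinearMap.pi fun m => (Submodule.mkQ _).comp (MvPowerSeries.coeff (E m))
  have hu : J.restrictScalars (CoeffLevel p V e) ≤ LinearMap.ker u := by
    intro x hx
    ext m
    change (Submodule.Quotient.mk _ : _ ⧸ _) = 0
    rw [Submodule.Quotient.mk_eq_zero]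
    exact coeff_mem_of_mem_span_pow p n V e hx _ fun i => (m i).2
  have hsurj : Function.Surjective u := by
    classical
    intro y
    choose z hz using fun m => Submodule.Quotient.mk_surjective _ (y m)
    refine ⟨fun m => if h : ∀ i, m i < N then z fun i => ⟨m i, h i⟩ else 0, ?_⟩
    ext m
    change Submodule.Quotient.mk (if h : ∀ i, E m i < N then z fun i => ⟨E m i, h i⟩ else 0) = _
    rw [dif_pos (show ∀ i, E m i < N from fun i => (m i).2)]
    exact hz m
  have h2 := Module.length_le_of_surjective ((J.restrictScalars (CoeffLevel p V e)).liftQ u hu)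
    (by
      rw [← LinearMap.range_eq_top, Submodule.range_liftQ, LinearMap.range_eq_top]
      exact hsurj)
  refine le_trans ?_ h2
  rw [Module.length_pi]
  have h3 := natCast_le_length_quotient_span_pow (coeffRoot p V e) N 
    (coeffRoot_pow_notMem p V e hp0)
  simp only [ENat.card_eq_coe_fintype_card, Fintype.card_pi, Fintype.card_fin, Finset.prod_const,
    Finset.card_univ]
  rw [pow_succ, Nat.cast_mul]
  gcongr

end RLevel

/-! ### `R_∞` as a perfect tower of local rings -/

section RInfTower

variable (p n : ℕ) [Fact p.Prime] (V : Type u) [CommRing V]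

theorem levelToRInf_levelTransition (e f : ℕ) (h : e ≤ f) (x : RLevel p n V e) :
    levelToRInf p n V f (levelTransition p n V e f h x) = levelToRInf p n V e x :=
  DirectLimit.Ring.of_f h x

theorem exists_levelToRInf_eq (x : RInf p n V) :
    ∃ (e : ℕ) (y : RLevel p n V e), levelToRInf p n V e y = x := by
  induction x using DirectLimit.induction with
  | _ e y => exact ⟨e, y, rfl⟩

theorem exists_levelTransition_eq {e f : ℕ} {x : RLevel p n V e} {y : RLevel p n V f}
    (h : levelToRInf p n V e x = levelToRInf p n V f y) :
    ∃ (g : ℕ) (he : e ≤ g) (hf : f ≤ g),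
      levelTransition p n V e g he x = levelTransition p n V f g hf y := by
  obtain ⟨g, he, hf, h⟩ := Quotient.exact h
  exact ⟨g, he, hf, h⟩

/-- The image of `R_e` in `R_∞`. -/
abbrev levelSubring (e : ℕ) : Subring (RInf p n V) := (levelToRInf p n V e).range

/-- The surjection of `R_e` onto its image in `R_∞`. -/
abbrev levelToSubring (e : ℕ) : RLevel p n V e →+* levelSubring p n V e :=
  (levelToRInf p n V e).rangeRestrict

instance (e : ℕ) : RingHomSurjective (levelToSubring p n V e) :=
  ⟨(levelToRInf p n V e).rangeRestrict_surjective⟩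

variable [IsLocalRing V] [hV : Fact (maximalIdeal V = Ideal.span {(p : V)})]

instance : Nontrivial (RInf p n V) := by
  refine nontrivial_of_ne 1 0 fun h => ?_
  rw [← map_one (levelToRInf p n V 0), ← map_zero (levelToRInf p n V 0)] at h
  obtain ⟨g, _, _, h⟩ := exists_levelTransition_eq p n V h
  rw [map_one, map_zero] at h
  exact one_ne_zero h

instance (e : ℕ) : IsLocalRing (levelSubring p n V e) :=
  IsLocalRing.of_surjective' (levelToSubring p n V e)
    (levelToRInf p n V e).rangeRestrict_surjective

theorem levelToSubring_mem_maximalIdeal (e : ℕ) {x : RLevel p n V e}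
    (hx : x ∈ maximalIdeal (RLevel p n V e)) :
    levelToSubring p n V e x ∈ maximalIdeal (levelSubring p n V e) := by
  have := IsLocalHom.of_surjective (levelToSubring p n V e)
    (levelToRInf p n V e).rangeRestrict_surjective
  exact (map_mem_nonunits_iff (levelToSubring p n V e) x).mpr hx

omit [IsLocalRing V] hV in
theorem levelSubring_mono : Monotone (levelSubring p n V) := by
  rintro e f h _ ⟨x, rfl⟩
  exact ⟨levelTransition p n V e f h x, levelToRInf_levelTransition p n V e f h x⟩

/-- The fibre between the images of `R_e` and `R_f` in `R_∞` is a quotient of the fibre of `R_e →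
R_f`. Working with images makes injectivity of the transition maps irrelevant. -/
theorem isLengthTower_levelSubring [IsNoetherianRing V] :
    IsLengthTower (levelSubring p n V) (p ^ (n + 1)) where
  mono := levelSubring_mono p n V
  exhaust r := by
    obtain ⟨e, y, hy⟩ := exists_levelToRInf_eq p n V r
    exact ⟨e, y, hy⟩
  noeth e := isNoetherianRing_of_surjective _ _ (levelToSubring p n V e)
    (levelToRInf p n V e).rangeRestrict_surjective
  ne_zero := pow_ne_zero _ (Fact.out : p.Prime).ne_zero
  length_fiber e f h := by
    refine le_trans ?_ (rLevel_length_fiber_le p n V e f h)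
    refine length_le_of_surjective_semilinear
      (Submodule.mapQ _ _ (levelToSubring p n V f).toSemilinearMap ?_) ?_
    · have h0 : (maximalIdeal (RLevel p n V e)).map (levelTransition p n V e f h) ≤
          Ideal.comap (levelToSubring p n V f) ((maximalIdeal (levelSubring p n V e)).map
            (Subring.inclusion (levelSubring_mono p n V h))) := ?_
      · exact h0
      rw [Ideal.map_le_iff_le_comap]
      intro x hx
      have h1 : levelToSubring p n V f (levelTransition p n V e f h x) =
          Subring.inclusion (levelSubring_mono p n V h) (levelToSubring p n V e x) :=
        Subtype.ext (levelToRInf_levelTransition p n V e f h x)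
      rw [Ideal.mem_comap, Ideal.mem_comap, h1]
      exact Ideal.mem_map_of_mem _ (levelToSubring_mem_maximalIdeal p n V e hx)
    · intro y
      obtain ⟨⟨_, x, rfl⟩, rfl⟩ := Submodule.Quotient.mk_surjective _ y
      exact ⟨Submodule.Quotient.mk x, rfl⟩

/-- Modulo `p`, the `p`-th power of a power series is obtained by raising the coefficients to the
`p`-th power and substituting `X_i^p` for `X_i`. The transition map performs the same substitution,
so the comparison is coefficientwise. -/
theorem rLevel_dvd_pow_sub (e : ℕ) (x : RLevel p n V (e + 1)) (s : RLevel p n V e)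
    (h : ∀ m, (p : CoeffLevel p V (e + 1)) ∣ MvPowerSeries.coeff m x ^ p -
      coeffTransition p V e (e + 1) (Nat.le_succ e) (MvPowerSeries.coeff m s)) :
    (p : RLevel p n V (e + 1)) ∣ x ^ p - levelTransition p n V e (e + 1) (Nat.le_succ e) s := by
  have hp : (p : CoeffLevel p V (e + 1)) ∈ nonunits (CoeffLevel p V (e + 1)) := by
    change _ ∈ maximalIdeal _
    rw [coeffLevel_maximalIdeal, ← coeffRoot_pow]
    exact Ideal.pow_mem_of_mem _ (Ideal.mem_span_singleton_self _) _
      (pow_pos (Fact.out : p.Prime).pos _)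
  have := CharP.quotient _ p hp
  have hp0 := (Fact.out : p.Prime).ne_zero
  let mk := Ideal.Quotient.mk (Ideal.span {(p : CoeffLevel p V (e + 1))})
  have h1 : MvPowerSeries.map mk (x ^ p) =
      MvPowerSeries.map mk (levelTransition p n V e (e + 1) (Nat.le_succ e) s) := by
    rw [map_pow, ← MvPowerSeries.map_frobenius_expand p hp0, MvPowerSeries.map_expand]
    have h2 : levelTransition p n V e (e + 1) (Nat.le_succ e) s =
        MvPowerSeries.expand p hp0
          (MvPowerSeries.map (coeffTransition p V e (e + 1) (Nat.le_succ e)) s) := by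
      simp [levelTransition]
    rw [h2, MvPowerSeries.map_expand]
    congr 1
    ext m
    simp only [MvPowerSeries.coeff_map, frobenius_def]
    rw [← map_pow]
    exact Ideal.Quotient.eq.mpr (Ideal.mem_span_singleton.mpr (h m))
  have h2 : ∀ m, (p : CoeffLevel p V (e + 1)) ∣ MvPowerSeries.coeff m
      (x ^ p - levelTransition p n V e (e + 1) (Nat.le_succ e) s) := by
    intro m
    rw [← Ideal.mem_span_singleton, ← Ideal.Quotient.eq_zero_iff_mem]
    have := congrArg (MvPowerSeries.coeff m) (sub_eq_zero.mpr h1)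
    rwa [← map_sub, MvPowerSeries.coeff_map] at this
  choose z hz using h2
  let Z : RLevel p n V (e + 1) := z
  refine ⟨Z, ?_⟩
  ext m
  rw [hz, ← map_natCast (MvPowerSeries.C (σ := Fin n)), MvPowerSeries.coeff_C_mul]
  rfl

theorem isPerfectTower_levelSubring [PerfectField (ResidueField V)] :
    IsPerfectTower (levelSubring p n V) p where
  exists_eq_pow e := by
    rintro _ ⟨x, rfl⟩
    obtain ⟨s, hs⟩ : ∃ s : RLevel p n V e, ∀ m, (p : CoeffLevel p V (e + 1)) ∣
        MvPowerSeries.coeff m x ^ p -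
          coeffTransition p V e (e + 1) (Nat.le_succ e) (MvPowerSeries.coeff m s) := by
      choose s hs using fun m => coeffLevel_exists_eq_pow p V e (MvPowerSeries.coeff m x)
      exact ⟨s, hs⟩
    obtain ⟨z, hz⟩ := rLevel_dvd_pow_sub p n V e x s hs
    refine ⟨_, ⟨s, rfl⟩, levelToRInf p n V (e + 1) z, ?_⟩
    rw [← levelToRInf_levelTransition p n V e (e + 1) (Nat.le_succ e), ← map_pow,
      ← map_natCast (levelToRInf p n V (e + 1)), ← map_mul, ← map_add, ← hz, add_sub_cancel]
  exists_pow_eq e := by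
    rintro _ ⟨s, rfl⟩
    obtain ⟨x, hx⟩ : ∃ x : RLevel p n V (e + 1), ∀ m, (p : CoeffLevel p V (e + 1)) ∣
        MvPowerSeries.coeff m x ^ p -
          coeffTransition p V e (e + 1) (Nat.le_succ e) (MvPowerSeries.coeff m s) := by
      choose x hx using fun m => coeffLevel_exists_pow_eq p V e (MvPowerSeries.coeff m s)
      exact ⟨x, hx⟩
    obtain ⟨z, hz⟩ := rLevel_dvd_pow_sub p n V e x s hx
    refine ⟨_, ⟨x, rfl⟩, levelToRInf p n V (e + 1) z, ?_⟩
    rw [← levelToRInf_levelTransition p n V e (e + 1) (Nat.le_succ e), ← map_pow,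
      ← map_natCast (levelToRInf p n V (e + 1)), ← map_mul, ← map_add, ← hz, add_sub_cancel]

end RInfTower

/-! ### Normalized length as asymptotic length -/

section NormalizedLength

variable (p n : ℕ) [Fact p.Prime] (V : Type u) [CommRing V]

/-- The inclusion of `R` into `R_e`. -/
def baseToLevel (e : ℕ) : BaseRing n V →+* RLevel p n V e :=
  (levelTransition p n V 0 e (Nat.zero_le e)).comp (MvPowerSeries.map (AdjoinRoot.of _))

theorem levelToRInf_baseToLevel (e : ℕ) (a : BaseRing n V) :
    levelToRInf p n V e (baseToLevel p n V e a) = algebraMap (BaseRing n V) (RInf p n V) a :=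
  levelToRInf_levelTransition p n V 0 e _ _

variable [IsLocalRing V] [hV : Fact (maximalIdeal V = Ideal.span {(p : V)})]

theorem baseToLevel_mem_maximalIdeal (e : ℕ) {a : BaseRing n V}
    (ha : a ∈ maximalIdeal (BaseRing n V)) :
    baseToLevel p n V e a ∈ maximalIdeal (RLevel p n V e) := by
  have h1 : MvPowerSeries.constantCoeff a ∈ maximalIdeal V := by
    intro h
    exact ha (MvPowerSeries.isUnit_iff_constantCoeff.mpr h)
  rw [hV.out, Ideal.mem_span_singleton] at h1
  obtain ⟨b, hb⟩ := h1
  intro h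
  rw [MvPowerSeries.isUnit_iff_constantCoeff] at h
  have h2 : MvPowerSeries.constantCoeff (baseToLevel p n V e a) =
      AdjoinRoot.of _ (MvPowerSeries.constantCoeff a) := by
    simp only [baseToLevel, levelTransition, RingHom.comp_apply, AlgHom.toRingHom_eq_coe,
      RingHom.coe_coe, MvPowerSeries.constantCoeff_expand, MvPowerSeries.constantCoeff_map,
      coeffTransition_of]
  rw [h2, hb, map_mul, coeffLevel_of_natCast, ← coeffRoot_pow] at h
  have h3 : coeffRoot p V e ∈ maximalIdeal (CoeffLevel p V e) := by
    rw [coeffLevel_maximalIdeal]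
    exact Ideal.mem_span_singleton_self _
  refine (Ideal.mul_mem_right _ _ (Ideal.pow_mem_of_mem _ h3 _ ?_) :
    _ ∈ maximalIdeal (CoeffLevel p V e)) h
  exact pow_pos (Fact.out : p.Prime).pos e

/-- The `R_e`-linear combinations of a family. -/
def levelCombination (e : ℕ) {M : Type*} [AddCommGroup M] [Module (RInf p n V) M] {k : ℕ}
    (g : Fin k → M) : (Fin k → RLevel p n V e) →ₛₗ[levelToSubring p n V e]
      Submodule.span (levelSubring p n V e) (Set.range g) where
  toFun r := ∑ i, levelToSubring p n V e (r i) •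
    (⟨g i, Submodule.subset_span ⟨i, rfl⟩⟩ :
      Submodule.span (levelSubring p n V e) (Set.range g))
  map_add' r s := by simp only [Pi.add_apply, map_add, add_smul, Finset.sum_add_distrib]
  map_smul' a r := by
    simp only [Pi.smul_apply, smul_eq_mul, map_mul, mul_smul, Finset.smul_sum]

omit [IsLocalRing V] hV in
theorem coe_levelCombination (e : ℕ) {M : Type*} [AddCommGroup M] [Module (RInf p n V) M] {k : ℕ}
    (g : Fin k → M) (r : Fin k → RLevel p n V e) :
    (levelCombination p n V e g r : M) = ∑ i, levelToRInf p n V e (r i) • g i := by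
  simp only [levelCombination, LinearMap.coe_mk, AddHom.coe_mk, AddSubmonoidClass.coe_finsetSum]
  rfl

omit [IsLocalRing V] hV in
theorem levelCombination_surjective (e : ℕ) {M : Type*} [AddCommGroup M] [Module (RInf p n V) M]
    {k : ℕ} (g : Fin k → M) : Function.Surjective (levelCombination p n V e g) := by
  rintro ⟨x, hx⟩
  obtain ⟨c, hc⟩ := (Submodule.mem_span_range_iff_exists_fun _).mp hx
  choose r hr using fun i => (levelToRInf p n V e).rangeRestrict_surjective (c i)
  refine ⟨r, Subtype.ext ?_⟩
  rw [coe_levelCombination]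
  change _ = x
  rw [← hc]
  refine Finset.sum_congr rfl fun i _ => ?_
  rw [← hr]
  rfl

/-- If `N` has a presentation over `R_e` and maps onto `M`, the images of the basis vectors satisfy
the relations over `R_e`. Their level-`e` span is thus a quotient of the cokernel over `R_e`, and
they generate everything that `g` does. -/
theorem spanLength_le_fgLength [IsNoetherianRing V] {M : Type w} [AddCommGroup M]
    [Module (RInf p n V) M] {k : ℕ} (g : Fin k → M) :
    spanLength (levelSubring p n V) (p ^ (n + 1)) (Set.range g) ≤ fgLength p n V M := by
  refine le_iInf fun N => le_iInf fun _ => le_iInf fun _ => le_iInf fun _ => le_iInf fun _ =>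
    le_iInf fun ⟨f, hf⟩ => ?_
  refine le_iInf fun e => le_iInf fun m₀ => le_iInf fun m₁ => le_iInf fun φ => le_iInf fun ⟨E⟩ => ?_
  let F : (Fin m₀ → RInf p n V) →ₗ[RInf p n V] M := (f.comp E.toLinearMap).comp (Submodule.mkQ _)
  have hF : Function.Surjective F := (hf.comp E.surjective).comp (Submodule.mkQ_surjective _)
  let g' : Fin m₀ → M := fun i => F (Pi.single i 1)
  have hFg : ∀ r, F r = ∑ i, r i • g' i := by
    intro r
    conv_lhs => rw [pi_eq_sum_univ' r]
    rw [map_sum]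
    refine Finset.sum_congr rfl fun i _ => ?_
    rw [map_smul]
  have h1 : (Set.range g : Set M) ⊆ Submodule.span (RInf p n V) (Set.range g') := by
    intro x _
    obtain ⟨r, rfl⟩ := hF x
    rw [hFg]
    exact sum_mem fun i _ => Submodule.smul_mem _ _ (Submodule.subset_span ⟨i, rfl⟩)
  refine ((isLengthTower_levelSubring p n V).spanLength_le_of_subset_span (Set.finite_range g)
    h1).trans ((iInf_le _ e).trans ?_)
  rw [levelLength, Nat.cast_pow, ← pow_mul]
  refine ENNReal.div_le_div_right (ENat.toENNReal_le.mpr ?_) _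
  refine length_le_of_surjective_semilinear
    ((LinearMap.range φ.mulVecLin).liftQ (levelCombination p n V e g') ?_) ?_
  · rintro _ ⟨c, rfl⟩
    rw [LinearMap.mem_ker]
    refine Subtype.ext ?_
    rw [coe_levelCombination]
    have h2 : (fun i => levelToRInf p n V e (φ.mulVec c i)) =
        (φ.map (levelToRInf p n V e)).mulVec (fun j => levelToRInf p n V e (c j)) := by
      ext i
      exact RingHom.map_mulVec _ _ _ i
    have h3 := hFg (fun i => levelToRInf p n V e (φ.mulVec c i))
    change ∑ i, levelToRInf p n V e (φ.mulVec c i) • g' i = 0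
    rw [← h3, h2]
    have h4 : (Submodule.Quotient.mk ((φ.map (levelToRInf p n V e)).mulVec
        (fun j => levelToRInf p n V e (c j))) : MatrixCoker (φ.map (levelToRInf p n V e))) = 0 :=
      (Submodule.Quotient.mk_eq_zero _).mpr ⟨_, rfl⟩
    exact (congrArg (fun y => f (E y)) h4).trans (by rw [map_zero, map_zero])
  · intro y
    obtain ⟨r, rfl⟩ := levelCombination_surjective p n V e g' y
    exact ⟨Submodule.Quotient.mk r, rfl⟩

/-- The level-`e` span of `g` has a finite presentation over the Noetherian ring `R_e`. The same
matrix over `R_∞` presents a module that maps onto `M`; it is `𝔪`-torsion because a module of finite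
length over `R_e` is killed by a power of the maximal ideal. -/
theorem fgLength_le_spanLength [IsNoetherianRing V] {M : Type w} [AddCommGroup M]
    [Module (RInf p n V) M] {k : ℕ} (g : Fin k → M)
    (hg : Submodule.span (RInf p n V) (Set.range g) = ⊤) :
    fgLength p n V M ≤ spanLength (levelSubring p n V) (p ^ (n + 1)) (Set.range g) := by
  refine le_iInf fun e => ?_
  rw [levelLength, Nat.cast_pow, ← pow_mul]
  have hpt : (p : ℝ≥0∞) ^ ((n + 1) * e) ≠ ⊤ := ENNReal.pow_ne_top (ENNReal.natCast_ne_top _)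
  by_cases htop : Module.length (levelSubring p n V e)
      (Submodule.span (levelSubring p n V e) (Set.range g)) = ⊤
  · rw [htop, ENat.toENNReal_top, ENNReal.top_div_of_ne_top hpt]
    exact le_top
  let K := LinearMap.ker (levelCombination p n V e g)
  obtain ⟨m₁, c, hc⟩ := Submodule.fg_iff_exists_fin_generating_family.mp
    (IsNoetherian.noetherian K)
  let φ : Matrix (Fin k) (Fin m₁) (RLevel p n V e) := Matrix.of fun i j => c j i
  have hφ : LinearMap.range φ.mulVecLin = K := by
    rw [Matrix.range_mulVecLin, ← hc]
    rfl
  have hlen : Module.length (RLevel p n V e) (MatrixCoker φ) ≤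
      Module.length (levelSubring p n V e)
        (Submodule.span (levelSubring p n V e) (Set.range g)) := by
    refine length_le_of_injective_semilinear
      ((LinearMap.range φ.mulVecLin).liftQ (levelCombination p n V e g) hφ.le) ?_
    rw [← LinearMap.ker_eq_bot, Submodule.ker_liftQ, eq_bot_iff]
    rintro _ ⟨x, hx, rfl⟩
    exact (Submodule.Quotient.mk_eq_zero _).mpr (hφ.ge hx)
  have hfin : IsFiniteLength (RLevel p n V e) (MatrixCoker φ) :=
    Module.length_ne_top_iff.mp (ne_top_of_le_ne_top htop hlen)
  obtain ⟨t, ht⟩ := exists_maximalIdeal_pow_smul_eq_zero hfin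
  let N := MatrixCoker (φ.map (levelToRInf p n V e))
  have htorsion : IsMTorsion p n V N := by
    intro x
    refine ⟨t, fun a ha => ?_⟩
    have ha' : baseToLevel p n V e a ∈ maximalIdeal (RLevel p n V e) ^ t := by
      have h1 : (maximalIdeal (BaseRing n V)).map (baseToLevel p n V e) ≤
          maximalIdeal (RLevel p n V e) :=
        Ideal.map_le_iff_le_comap.mpr fun b hb => baseToLevel_mem_maximalIdeal p n V e hb
      have h2 := Ideal.mem_map_of_mem (baseToLevel p n V e) ha
      rw [Ideal.map_pow] at h2
      exact Ideal.pow_right_mono h1 t h2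
    obtain ⟨r, rfl⟩ := Submodule.Quotient.mk_surjective _ x
    rw [← levelToRInf_baseToLevel p n V e, ← Submodule.Quotient.mk_smul,
      Submodule.Quotient.mk_eq_zero, pi_eq_sum_univ' r, Finset.smul_sum]
    refine sum_mem fun i _ => ?_
    rw [smul_comm]
    refine Submodule.smul_mem _ _ ?_
    have h3 := ht _ ha' (Submodule.Quotient.mk (Pi.single i 1))
    rw [← Submodule.Quotient.mk_smul, Submodule.Quotient.mk_eq_zero] at h3
    obtain ⟨d, hd⟩ := h3
    refine ⟨fun j => levelToRInf p n V e (d j), ?_⟩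
    ext j
    have h4 := congrArg (levelToRInf p n V e) (congrFun hd j)
    rw [Matrix.mulVecLin_apply, RingHom.map_mulVec] at h4
    rw [Matrix.mulVecLin_apply]
    refine h4.trans ?_
    simp [Pi.single_apply, apply_ite (levelToRInf p n V e)]
  let F₀ : (Fin k → RInf p n V) →ₗ[RInf p n V] M := Fintype.linearCombination _ g
  have hker : LinearMap.range (φ.map (levelToRInf p n V e)).mulVecLin ≤ LinearMap.ker F₀ := by
    rw [Matrix.range_mulVecLin, Submodule.span_le]
    rintro _ ⟨j, rfl⟩
    have h1 : c j ∈ K := hc ▸ Submodule.subset_span ⟨j, rfl⟩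
    have h2 := congrArg Subtype.val (LinearMap.mem_ker.mp h1)
    rw [coe_levelCombination] at h2
    exact h2
  have hsurj : ∃ f : N →ₗ[RInf p n V] M, Function.Surjective f := by
    refine ⟨Submodule.liftQ _ F₀ hker, ?_⟩
    rw [← LinearMap.range_eq_top, Submodule.range_liftQ, Fintype.range_linearCombination, hg]
  have hfp : Module.FinitePresentation (RInf p n V) N := by
    refine Module.finitePresentation_of_surjective (Submodule.mkQ _) (Submodule.mkQ_surjective _) ?_
    rw [Submodule.ker_mkQ, Matrix.range_mulVecLin]
    exact Submodule.fg_span (Set.finite_range _)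
  calc fgLength p n V M ≤ fpLength p n V N :=
        iInf_le_of_le N (iInf_le_of_le _ (iInf_le_of_le _ (iInf_le_of_le hfp
          (iInf_le_of_le htorsion (iInf_le_of_le hsurj le_rfl)))))
    _ ≤ (Module.length (RLevel p n V e) (MatrixCoker φ) : ℝ≥0∞) / (p : ℝ≥0∞) ^ ((n + 1) * e) :=
        iInf_le_of_le e (iInf_le_of_le k (iInf_le_of_le m₁ (iInf_le_of_le φ
          (iInf_le_of_le ⟨LinearEquiv.refl _ _⟩ le_rfl))))
    _ ≤ _ := ENNReal.div_le_div_right (ENat.toENNReal_le.mpr hlen) _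

theorem normalizedLength_eq_submoduleLength_top [IsNoetherianRing V] (M : Type w) [AddCommGroup M]
    [Module (RInf p n V) M] :
    normalizedLength p n V M =
      submoduleLength (levelSubring p n V) (p ^ (n + 1)) (⊤ : Submodule (RInf p n V) M) := by
  have key : ∀ (k : ℕ) (g : Fin k → M),
      fgLength p n V (Submodule.span (RInf p n V) (Set.range g)) =
        spanLength (levelSubring p n V) (p ^ (n + 1)) (Set.range g) := by
    intro k g
    let g' : Fin k → Submodule.span (RInf p n V) (Set.range g) :=
      fun i => ⟨g i, Submodule.subset_span ⟨i, rfl⟩⟩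
    have h1 : Submodule.span (RInf p n V) (Set.range g') = ⊤ := by
      rw [← Submodule.map_injective_of_injective (Submodule.injective_subtype _) |>.eq_iff,
        Submodule.map_span, ← Set.range_comp, Submodule.map_top, Submodule.range_subtype]
      rfl
    have h2 := spanLength_image_of_injective (levelSubring p n V) (p ^ (n + 1))
      (Submodule.span (RInf p n V) (Set.range g)).subtype (Submodule.injective_subtype _)
      (Set.range g')
    rw [← Set.range_comp] at h2
    exact (le_antisymm (fgLength_le_spanLength p n V g' h1)
      (spanLength_le_fgLength p n V g')).trans h2.symm
  refine le_antisymm (iSup₂_le fun N hN => ?_) ?_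
  · obtain ⟨k, g, rfl⟩ := Submodule.fg_iff_exists_fin_generating_family.mp hN
    rw [key]
    exact spanLength_le_submoduleLength _ _ (Set.finite_range g) (Set.subset_univ _)
  · rw [submoduleLength_le_iff]
    intro g hg _
    obtain ⟨k, g, -, rfl⟩ := hg.fin_param
    rw [← key]
    exact le_iSup₂_of_le _ (Submodule.fg_span (Set.finite_range g)) le_rfl

theorem normalizedLength_eq_submoduleLength [IsNoetherianRing V] {M : Type w} [AddCommGroup M]
    [Module (RInf p n V) M] (P : Submodule (RInf p n V) M) :
    normalizedLength p n V P = submoduleLength (levelSubring p n V) (p ^ (n + 1)) P := by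
  rw [normalizedLength_eq_submoduleLength_top,
    ← submoduleLength_map_of_injective _ _ _ P.subtype P.injective_subtype, Submodule.map_top,
    Submodule.range_subtype]

end NormalizedLength

/-! ### The valuation on `R_∞` -/

section IdealPowers

theorem Ideal.span_image_pow_le {B : Type*} [CommRing B] {ι : Type*} (g : ι → B) (N : ℕ)
    (s : Finset ι) (hs : s.Nonempty) :
    Ideal.span (g '' s) ^ (s.card * N) ≤ Ideal.span ((fun i => g i ^ N) '' s) := by
  classical
  induction s using Finset.induction_on with
  | empty => exact absurd hs Finset.not_nonempty_empty
  | insert i s hi ih =>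
    rcases s.eq_empty_or_nonempty with rfl | hs
    · simp [Ideal.span_singleton_pow]
    · rw [Finset.card_insert_of_notMem hi, Finset.coe_insert, Set.image_insert_eq,
        Set.image_insert_eq, Ideal.span_insert, Ideal.span_insert, add_mul, one_mul, add_comm]
      refine Ideal.sup_pow_add_le_pow_sup_pow.trans (sup_le_sup ?_ (ih hs))
      rw [Ideal.span_singleton_pow]

theorem Ideal.span_range_pow_le {B : Type*} [CommRing B] {n : ℕ} (g : Fin (n + 1) → B) (N : ℕ) :
    Ideal.span (Set.range g) ^ ((n + 1) * N) ≤ Ideal.span (Set.range fun i => g i ^ N) := by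
  simpa using Ideal.span_image_pow_le g N Finset.univ Finset.univ_nonempty

end IdealPowers

/-! ### Powers of the maximal ideal of `R` and quasi-regularity of its parameters. -/

section BaseRing

variable (p n : ℕ) (V : Type u) [CommRing V] [IsLocalRing V]
  [hV : Fact (maximalIdeal V = Ideal.span {(p : V)})]

/-- The coefficients of the elements of `𝔪 ^ t`. -/
theorem coeff_mem_of_mem_maximalIdeal_pow (t : ℕ) {a : BaseRing n V}
    (ha : a ∈ maximalIdeal (BaseRing n V) ^ t) (m : Fin n →₀ ℕ) :
    MvPowerSeries.coeff m a ∈ Ideal.span {(p : V)} ^ (t - m.degree) := by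
  classical
  induction t generalizing a m with
  | zero => simp
  | succ t ih =>
    rw [pow_succ] at ha
    induction ha using Submodule.mul_induction_on' with
    | mem_mul_mem b hb c hc =>
      rw [MvPowerSeries.coeff_mul]
      refine sum_mem fun k hk => ?_
      have h1 : MvPowerSeries.coeff k.2 c ∈ Ideal.span {(p : V)} ^ (1 - k.2.degree) := by
        by_cases hk2 : k.2 = 0
        · rw [hk2, MvPowerSeries.coeff_zero_eq_constantCoeff_apply, map_zero, Nat.sub_zero,
            pow_one, ← hV.out]
          intro h
          exact hc (MvPowerSeries.isUnit_iff_constantCoeff.mpr h)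
        · have : 1 - k.2.degree = 0 := by
            have := (Finsupp.degree_eq_zero_iff k.2).not.mpr hk2
            omega
          simp [this]
      have h2 := Ideal.mul_mem_mul (ih hb k.1) h1
      rw [← pow_add] at h2
      refine Ideal.pow_le_pow_right ?_ h2
      have h3 : m.degree = k.1.degree + k.2.degree := by
        rw [← Finset.HasAntidiagonal.mem_antidiagonal.mp hk, map_add]
      omega
    | add y _ z _ hy hz => rw [map_add]; exact add_mem hy hz

/-- The regular system of parameters of `R`. -/
def baseGen : Fin (n + 1) → BaseRing n V := Fin.cons (p : BaseRing n V) MvPowerSeries.X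

omit hV [IsLocalRing V] in
theorem baseToLevel_baseGen [Fact p.Prime] (e : ℕ) (i : Fin (n + 1)) :
    baseToLevel p n V e (baseGen p n V i) = levelGen p n V e i ^ p ^ e := by
  refine Fin.cases ?_ (fun i => ?_) i
  · simp only [baseGen, levelGen, Fin.cons_zero, map_natCast]
    rw [← map_pow, coeffRoot_pow]
    exact (map_natCast (MvPowerSeries.C (σ := Fin n) (R := CoeffLevel p V e)) p).symm
  · simp only [baseGen, levelGen, Fin.cons_succ, baseToLevel, levelTransition, RingHom.comp_apply,
      MvPowerSeries.map_X, AlgHom.toRingHom_eq_coe, RingHom.coe_coe, MvPowerSeries.expand_X,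
      Nat.sub_zero]

theorem baseGen_mem (i : Fin (n + 1)) : baseGen p n V i ∈ maximalIdeal (BaseRing n V) := by
  change ¬ IsUnit _
  rw [MvPowerSeries.isUnit_iff_constantCoeff]
  refine Fin.cases ?_ (fun i => ?_) i
  · have : (p : V) ∈ maximalIdeal V := by
      rw [hV.out]; exact Ideal.mem_span_singleton_self _
    simpa [baseGen] using this
  · simp [baseGen]

omit [IsLocalRing V] hV in
theorem natCast_mem_span_pow_succ [IsDomain V] (hp0 : (p : V) ≠ 0) {c : V} {k : ℕ}
    (h : c * (p : V) ^ k ∈ Ideal.span {(p : V)} ^ (k + 1)) : c ∈ Ideal.span {(p : V)} := by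
  rw [Ideal.span_singleton_pow, Ideal.mem_span_singleton, pow_succ', mul_dvd_mul_iff_right
    (pow_ne_zero _ hp0)] at h
  exact Ideal.mem_span_singleton.mpr h

theorem baseGen_notMem [IsDomain V] (hp0 : (p : V) ≠ 0) (i : Fin (n + 1)) :
    baseGen p n V i ∉ maximalIdeal (BaseRing n V) ^ 2 := by
  classical
  have h1 : (1 : V) ∉ Ideal.span {(p : V)} := by
    rw [← hV.out]
    exact (Ideal.ne_top_iff_one _).mp (maximalIdeal.isMaximal V).ne_top
  intro h
  revert h
  refine Fin.cases (fun h => ?_) (fun i h => ?_) i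
  · have := coeff_mem_of_mem_maximalIdeal_pow p n V 2 h 0
    rw [MvPowerSeries.coeff_zero_eq_constantCoeff_apply] at this
    simp only [baseGen, Fin.cons_zero, map_natCast, map_zero, Nat.sub_zero] at this
    exact h1 (natCast_mem_span_pow_succ p V hp0 (k := 1) (by simpa using this))
  · have := coeff_mem_of_mem_maximalIdeal_pow p n V 2 h (Finsupp.single i 1)
    simp only [baseGen, Fin.cons_succ, MvPowerSeries.coeff_X, if_true, Finsupp.degree_single] at this
    exact h1 (by simpa using this)

/-- The regular system of parameters of `R` is quasi-regular. -/
theorem dvd_coeff_of_eval₂_mem [IsDomain V] (hp0 : (p : V) ≠ 0) (s : ℕ)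
    (F : MvPolynomial (Fin (n + 1)) V) (hF : F.IsHomogeneous s)
    (h : MvPolynomial.eval₂ (MvPowerSeries.C) (baseGen p n V) F ∈
      maximalIdeal (BaseRing n V) ^ (s + 1)) (α : Fin (n + 1) →₀ ℕ) :
    MvPolynomial.coeff α F ∈ Ideal.span {(p : V)} := by
  classical
  by_cases hα : MvPolynomial.coeff α F = 0
  · rw [hα]; exact zero_mem _
  have hdeg : ∀ β, MvPolynomial.coeff β F ≠ 0 → β 0 + β.tail.degree = s := by
    intro β hβ
    have : β.degree = s := by
      rw [Finsupp.degree_eq_weight_one]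
      exact hF hβ
    rw [← this, Finsupp.degree_eq_sum, Finsupp.degree_eq_sum, Fin.sum_univ_succ]
    rfl
  have hterm : ∀ β : Fin (n + 1) →₀ ℕ, MvPowerSeries.coeff α.tail
      (MvPowerSeries.C (MvPolynomial.coeff β F) * ∏ i, baseGen p n V i ^ β i) =
      if α.tail = β.tail then MvPolynomial.coeff β F * (p : V) ^ β 0 else 0 := by
    intro β
    have h1 : ∏ i : Fin n, (MvPowerSeries.X i : BaseRing n V) ^ β i.succ =
        MvPowerSeries.monomial β.tail 1 := by
      rw [MvPowerSeries.monomial_one_eq, Finsupp.prod_fintype _ _ (fun i => pow_zero _)]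
      rfl
    rw [Fin.prod_univ_succ]
    simp only [baseGen, Fin.cons_zero, Fin.cons_succ]
    rw [h1, ← map_natCast (MvPowerSeries.C (σ := Fin n) (R := V)), ← map_pow, ← mul_assoc,
      ← map_mul, MvPowerSeries.coeff_C_mul, MvPowerSeries.coeff_monomial]
    split_ifs <;> simp
  have h1 := coeff_mem_of_mem_maximalIdeal_pow p n V (s + 1) h α.tail
  -- By homogeneity the exponents of the variables determine the exponent of `p`, so only the term
  -- of `α` contributes to this coefficient. Membership in `𝔪^{s+1}` then provides one factor `p`
  -- more than `p^{α 0}`.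
  have h2 : MvPowerSeries.coeff α.tail (MvPolynomial.eval₂ (MvPowerSeries.C) (baseGen p n V) F) =
      MvPolynomial.coeff α F * (p : V) ^ α 0 := by
    rw [MvPolynomial.eval₂_eq', map_sum, Finset.sum_eq_single α]
    · rw [hterm, if_pos rfl]
    · intro β hβ hne
      rw [hterm, if_neg]
      intro htail
      apply hne
      have h3 := hdeg β (MvPolynomial.mem_support_iff.mp hβ)
      have h4 := hdeg α hα
      rw [htail] at h4
      rw [← Finsupp.cons_tail α, ← Finsupp.cons_tail β, htail, show β 0 = α 0 by omega]
    · intro h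
      exact absurd (MvPolynomial.mem_support_iff.mpr hα) h
  rw [h2] at h1
  refine natCast_mem_span_pow_succ p V hp0 (k := α 0) ?_
  have h3 := hdeg α hα
  rwa [show s + 1 - α.tail.degree = α 0 + 1 by omega] at h1

end BaseRing

/-! ### Generation of `R_e` over `R` by roots of the parameters. -/

section Decomposition

variable (p n : ℕ) [Fact p.Prime] (V : Type u) [CommRing V]

/-- Splitting of a power series according to the residues of the exponents modulo `N`. -/
theorem MvPowerSeries.eq_sum_monomial_mul_expand {B : Type*} [CommRing B] (N : ℕ) (hN : N ≠ 0)
    (x : MvPowerSeries (Fin n) B) :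
    ∃ y : (Fin n → Fin N) → MvPowerSeries (Fin n) B,
      x = ∑ b, MvPowerSeries.monomial (Finsupp.equivFunOnFinite.symm fun i => (b i : ℕ)) 1 *
        MvPowerSeries.expand N hN (y b) := by
  classical
  let E : (Fin n → Fin N) → Fin n →₀ ℕ := fun b => Finsupp.equivFunOnFinite.symm fun i => (b i : ℕ)
  let y : (Fin n → Fin N) → MvPowerSeries (Fin n) B :=
    fun b m => MvPowerSeries.coeff (N • m + E b) x
  refine ⟨y, ?_⟩
  ext m
  have hNpos := Nat.pos_of_ne_zero hN
  let b₀ : Fin n → Fin N := fun i => ⟨m i % N, Nat.mod_lt _ hNpos⟩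
  let m₀ : Fin n →₀ ℕ := Finsupp.equivFunOnFinite.symm fun i => m i / N
  have hm : m = N • m₀ + E b₀ := by
    ext i
    exact (Nat.div_add_mod (m i) N).symm
  rw [map_sum, Finset.sum_eq_single b₀]
  · rw [MvPowerSeries.coeff_monomial_mul, if_pos, one_mul]
    · have : m - E b₀ = N • m₀ := by
        conv_lhs => rw [hm]
        exact add_tsub_cancel_right _ _
      change _ = MvPowerSeries.coeff (m - E b₀) _
      rw [this, MvPowerSeries.coeff_expand_smul]
      conv_lhs => rw [hm]
      rfl
    · intro i
      exact Nat.mod_le _ _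
  · intro b _ hb
    rw [MvPowerSeries.coeff_monomial_mul]
    split_ifs with hle
    · obtain ⟨i, hi⟩ : ∃ i, ¬ N ∣ (m - E b) i := by
        by_contra! hdvd
        apply hb
        ext i
        have h1 := hdvd i
        have h2 : (b i : ℕ) ≤ m i := hle i
        change N ∣ m i - b i at h1
        change (b i : ℕ) = m i % N
        have h3 := (Nat.modEq_iff_dvd' h2).mpr h1
        rw [← h3, Nat.mod_eq_of_lt (b i).2]
      change 1 * MvPowerSeries.coeff (m - E b) _ = _
      rw [MvPowerSeries.coeff_expand_of_not_dvd N hN _ hi, mul_zero]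
    · rfl
  · intro h
    exact absurd (Finset.mem_univ _) h

/-- Every element of `R_e` is an `R`-linear combination of monomials in `p^{1/p^e}` and the
`x_i^{1/p^e}`. -/
theorem rLevel_induction [Nontrivial V] (e : ℕ) {P : RLevel p n V e → Prop}
    (hadd : ∀ x y, P x → P y → P (x + y)) (hmul : ∀ x y, P x → P y → P (x * y))
    (hbase : ∀ a, P (baseToLevel p n V e a)) (hgen : ∀ i, P (levelGen p n V e i))
    (x : RLevel p n V e) : P x := by
  classical
  have hsum : ∀ {ι : Type} (s : Finset ι) (f : ι → RLevel p n V e), (∀ i ∈ s, P (f i)) →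
      P (∑ i ∈ s, f i) := fun s f hf =>
    Finset.sum_induction f P hadd (by simpa using hbase 0) hf
  have hpow : ∀ (y : RLevel p n V e) (k : ℕ), P y → P (y ^ k) := by
    intro y k hy
    induction k with
    | zero => simpa using hbase 1
    | succ k ih => rw [pow_succ]; exact hmul _ _ ih hy
  have hprod : ∀ {ι : Type} (s : Finset ι) (f : ι → RLevel p n V e), (∀ i ∈ s, P (f i)) →
      P (∏ i ∈ s, f i) := fun s f hf =>
    Finset.prod_induction f P hmul (by simpa using hbase 1) hf
  have hN : p ^ e ≠ 0 := pow_ne_zero _ (Fact.out : p.Prime).ne_zero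
  obtain ⟨y, rfl⟩ := MvPowerSeries.eq_sum_monomial_mul_expand n (p ^ e) hN x
  refine hsum _ _ fun b _ => hmul _ _ ?_ ?_
  · rw [MvPowerSeries.monomial_one_eq]
    refine hprod _ _ fun i _ => hpow _ _ ?_
    exact hgen i.succ
  · let pb := AdjoinRoot.powerBasis' (coeffPoly_monic p V e)
    let c : Fin pb.dim → BaseRing n V := fun i m => pb.basis.repr (MvPowerSeries.coeff m (y b)) i
    have h1 : y b = ∑ i, MvPowerSeries.C (pb.basis i) *
        MvPowerSeries.map (AdjoinRoot.of _) (c i) := by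
      ext m
      rw [map_sum]
      conv_lhs => rw [← pb.basis.sum_repr (MvPowerSeries.coeff m (y b))]
      refine Finset.sum_congr rfl fun i _ => ?_
      rw [MvPowerSeries.coeff_C_mul, MvPowerSeries.coeff_map, Algebra.smul_def, mul_comm]
      rfl
    rw [h1, map_sum]
    refine hsum _ _ fun i _ => ?_
    rw [map_mul]
    refine hmul _ _ ?_ ?_
    · rw [MvPowerSeries.expand_C, pb.basis_eq_pow, map_pow]
      exact hpow _ _ (hgen 0)
    · have h2 : baseToLevel p n V e (c i) = MvPowerSeries.expand (p ^ e) hN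
          (MvPowerSeries.map (AdjoinRoot.of _) (c i)) := by
        have h3 : MvPowerSeries.map (coeffTransition p V 0 e (Nat.zero_le e))
            (MvPowerSeries.map (AdjoinRoot.of _) (c i)) =
            MvPowerSeries.map (AdjoinRoot.of _) (c i) := by
          ext m
          simp only [MvPowerSeries.coeff_map, coeffTransition_of]
        simp only [baseToLevel, levelTransition, RingHom.comp_apply, AlgHom.toRingHom_eq_coe,
          RingHom.coe_coe, h3, Nat.sub_zero]
      rw [← h2]
      exact hbase _

end Decomposition

/-! ### Valuations extending the `𝔪`-adic valuation -/

section Frobenius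

/-- The inner binomial coefficients of exponent `p^e` are divisible by `p`, and every cross term is
of degree `p^e` in the `y i`. The valuation of the error term is recorded since it must later be
compared with that of the main term. -/
theorem AddValuation.exists_sum_pow_eq {B : Type*} [CommRing B]
    (v : AddValuation B (WithTop ℚ)) (hnat : ∀ k : ℕ, 0 ≤ v (k : B)) {p : ℕ} (hp : p.Prime)
    (e : ℕ) {ι : Type*} (s : Finset ι) (y : ι → B) (r : WithTop ℚ) (hy : ∀ i ∈ s, r ≤ v (y i)) :
    ∃ w, (∑ i ∈ s, y i) ^ p ^ e = ∑ i ∈ s, y i ^ p ^ e + p * w ∧ p ^ e • r ≤ v w := by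
  classical
  have hN : p ^ e ≠ 0 := pow_ne_zero _ hp.ne_zero
  induction s using Finset.induction_on with
  | empty => exact ⟨0, by
      rw [Finset.sum_empty, Finset.sum_empty, zero_pow hN, mul_zero, add_zero], by simp⟩
  | insert i s hi ih =>
    obtain ⟨w, hw, hvw⟩ := ih fun j hj => hy j (Finset.mem_insert_of_mem hj)
    have hyi := hy i (Finset.mem_insert_self i s)
    have hS : r ≤ v (∑ i ∈ s, y i) :=
      v.map_le_sum fun j hj => hy j (Finset.mem_insert_of_mem hj)
    refine ⟨w + ∑ k ∈ Finset.Ioo 0 (p ^ e),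
      y i ^ k * (∑ i ∈ s, y i) ^ (p ^ e - k) * ↑((p ^ e).choose k / p), ?_, ?_⟩
    · rw [Finset.sum_insert hi, Finset.sum_insert hi, (Commute.all _ _).add_pow_prime_pow_eq' hp, hw]
      ring
    · refine v.map_le_add hvw (v.map_le_sum fun k hk => ?_)
      have hk' := (Finset.mem_Ioo.mp hk).2.le
      rw [v.map_mul, v.map_mul, v.map_pow, v.map_pow]
      refine le_trans ?_ (le_add_of_nonneg_right (hnat _))
      calc p ^ e • r = k • r + (p ^ e - k) • r := by
            rw [← add_nsmul, Nat.add_sub_cancel' hk']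
        _ ≤ _ := add_le_add (nsmul_le_nsmul_right hyi k) (nsmul_le_nsmul_right hS _)

end Frobenius

section Valuation

variable {p n : ℕ} [Fact p.Prime] {V : Type u} [CommRing V] [IsLocalRing V] [IsDomain V]
  [hV : Fact (maximalIdeal V = Ideal.span {(p : V)})] [IsNoetherianRing V]
  {v : AddValuation (RInf p n V) (WithTop ℚ)}

omit [IsDomain V] hV in
-- By Krull's intersection theorem a nonzero element leaves the powers of `𝔪` at some point.
theorem ExtendsMAdic.exists_eq (hv : ExtendsMAdic v) {a : BaseRing n V} (ha : a ≠ 0) :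
    ∃ t : ℕ, a ∈ maximalIdeal (BaseRing n V) ^ t ∧ a ∉ maximalIdeal (BaseRing n V) ^ (t + 1) ∧
      v (algebraMap (BaseRing n V) (RInf p n V) a) = ((t : ℚ) : WithTop ℚ) := by
  classical
  have h1 : ∃ s, a ∉ maximalIdeal (BaseRing n V) ^ s := by
    by_contra! h
    have h2 := Ideal.iInf_pow_eq_bot_of_isLocalRing (maximalIdeal (BaseRing n V))
      (maximalIdeal.isMaximal _).ne_top
    have h3 : a ∈ (⨅ i : ℕ, maximalIdeal (BaseRing n V) ^ i) := Ideal.mem_iInf.mpr h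
    rw [h2] at h3
    exact ha h3
  have h2 : Nat.find h1 ≠ 0 := by
    intro h
    have := Nat.find_spec h1
    rw [h, pow_zero] at this
    rw [Ideal.one_eq_top] at this
    exact this trivial
  obtain ⟨t, ht⟩ := Nat.exists_eq_succ_of_ne_zero h2
  have h3 : a ∈ maximalIdeal (BaseRing n V) ^ t := by
    by_contra h
    have := Nat.find_min' h1 h
    omega
  have h4 : a ∉ maximalIdeal (BaseRing n V) ^ (t + 1) := by
    have := Nat.find_spec h1
    rwa [ht] at this
  exact ⟨t, h3, h4, hv a t h3 h4⟩

omit [IsDomain V] hV in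
theorem ExtendsMAdic.nonneg_base (hv : ExtendsMAdic v) (a : BaseRing n V) :
    0 ≤ v (algebraMap (BaseRing n V) (RInf p n V) a) := by
  by_cases ha : a = 0
  · rw [ha, map_zero, v.map_zero]
    exact le_top
  · obtain ⟨t, _, _, ht⟩ := hv.exists_eq ha
    rw [ht]
    exact_mod_cast Nat.zero_le t

omit [IsDomain V] hV in
theorem ExtendsMAdic.nonneg_natCast (hv : ExtendsMAdic v) (k : ℕ) :
    0 ≤ v (k : RInf p n V) := by
  simpa using hv.nonneg_base (k : BaseRing n V)

theorem WithTop.eq_div_of_nsmul_eq {x : WithTop ℚ} {N : ℕ} {q : ℚ} (hN : N ≠ 0)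
    (h : N • x = (q : WithTop ℚ)) : x = ((q / N : ℚ) : WithTop ℚ) := by
  induction x using WithTop.recTopCoe with
  | top =>
    obtain ⟨k, rfl⟩ := Nat.exists_eq_succ_of_ne_zero hN
    rw [succ_nsmul, add_top] at h
    exact absurd h (WithTop.top_ne_coe)
  | coe x =>
    rw [← WithTop.coe_nsmul, WithTop.coe_inj] at h
    rw [WithTop.coe_inj, eq_div_iff (by exact_mod_cast hN), ← h, nsmul_eq_mul, mul_comm]

omit [IsNoetherianRing V] in
theorem ExtendsMAdic.map_levelGen (hv : ExtendsMAdic v) (hp0 : (p : V) ≠ 0) (e : ℕ)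
    (i : Fin (n + 1)) :
    v (levelToRInf p n V e (levelGen p n V e i)) = ((1 / (p ^ e : ℕ) : ℚ) : WithTop ℚ) := by
  refine WithTop.eq_div_of_nsmul_eq (pow_ne_zero _ (Fact.out : p.Prime).ne_zero) ?_
  rw [← v.map_pow, ← map_pow, ← baseToLevel_baseGen, levelToRInf_baseToLevel]
  have := hv (baseGen p n V i) 1 (by simpa using baseGen_mem p n V i)
    (baseGen_notMem p n V hp0 i)
  simpa using this

theorem ExtendsMAdic.nonneg (hv : ExtendsMAdic v) (hp0 : (p : V) ≠ 0) (e : ℕ)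
    (x : RLevel p n V e) : 0 ≤ v (levelToRInf p n V e x) := by
  refine rLevel_induction p n V e (P := fun x => 0 ≤ v (levelToRInf p n V e x))
    (fun x y hx hy => ?_) (fun x y hx hy => ?_) (fun a => ?_) (fun i => ?_) x
  · rw [map_add]
    exact v.map_le_add hx hy
  · rw [map_mul, v.map_mul]
    exact add_nonneg hx hy
  · rw [levelToRInf_baseToLevel]
    exact hv.nonneg_base a
  · rw [hv.map_levelGen hp0]
    exact_mod_cast (by positivity : (0 : ℚ) ≤ 1 / (p ^ e : ℕ))

theorem ExtendsMAdic.le_of_mem_pow (hv : ExtendsMAdic v) (hp0 : (p : V) ≠ 0) (e s : ℕ)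
    {x : RLevel p n V e} (hx : x ∈ maximalIdeal (RLevel p n V e) ^ s) :
    ((s / (p ^ e : ℕ) : ℚ) : WithTop ℚ) ≤ v (levelToRInf p n V e x) := by
  induction s generalizing x with
  | zero => simpa using hv.nonneg hp0 e x
  | succ s ih =>
    have h1 : ∀ z ∈ maximalIdeal (RLevel p n V e),
        ((1 / (p ^ e : ℕ) : ℚ) : WithTop ℚ) ≤ v (levelToRInf p n V e z) := by
      intro z hz
      rw [rLevel_maximalIdeal] at hz
      induction hz using Submodule.span_induction with
      | mem z hz =>
        obtain ⟨i, rfl⟩ := hz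
        exact (hv.map_levelGen hp0 e i).ge
      | zero => rw [map_zero, v.map_zero]; exact le_top
      | add y z _ _ hy hz => rw [map_add]; exact v.map_le_add hy hz
      | smul a z _ hz =>
        rw [smul_eq_mul, map_mul, v.map_mul]
        exact le_add_of_nonneg_of_le (hv.nonneg hp0 e a) hz
    rw [pow_succ] at hx
    induction hx using Submodule.mul_induction_on' with
    | mem_mul_mem y hy z hz =>
      rw [map_mul, v.map_mul]
      refine le_trans (le_of_eq ?_) (add_le_add (ih hy) (h1 z hz))
      rw [← WithTop.coe_add]
      congr 1
      push_cast
      ring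
    | add y _ z _ hy hz => rw [map_add]; exact v.map_le_add hy hz

/-- Evaluation of a polynomial over `V` at the parameters of `R_e`. -/
def levelEval (p n : ℕ) (V : Type u) [CommRing V] (e : ℕ) :
    MvPolynomial (Fin (n + 1)) V →+* RLevel p n V e :=
  MvPolynomial.eval₂Hom ((MvPowerSeries.C).comp (AdjoinRoot.of _)) (levelGen p n V e)

omit [IsDomain V] [IsNoetherianRing V] in
-- This is a leading form of degree `s`. Its coefficients can be taken in `V` because `V` surjects
-- onto the residue field of `R_e`.
theorem exists_isHomogeneous_sub_mem (e s : ℕ) {x : RLevel p n V e}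
    (hx : x ∈ maximalIdeal (RLevel p n V e) ^ s) :
    ∃ F : MvPolynomial (Fin (n + 1)) V, F.IsHomogeneous s ∧
      x - levelEval p n V e F ∈ maximalIdeal (RLevel p n V e) ^ (s + 1) := by
  have h0 : ∀ x : RLevel p n V e, ∃ F : MvPolynomial (Fin (n + 1)) V, F.IsHomogeneous 0 ∧
      x - levelEval p n V e F ∈ maximalIdeal (RLevel p n V e) := by
    intro x
    obtain ⟨a, ha⟩ := rLevel_exists_sub_mem p n V e x
    refine ⟨MvPolynomial.C a, MvPolynomial.isHomogeneous_C _ _, ?_⟩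
    simpa [levelEval] using ha
  have h1 : ∀ z ∈ maximalIdeal (RLevel p n V e), ∃ F : MvPolynomial (Fin (n + 1)) V,
      F.IsHomogeneous 1 ∧ z - levelEval p n V e F ∈ maximalIdeal (RLevel p n V e) ^ 2 := by
    intro z hz
    have hz' := hz
    rw [rLevel_maximalIdeal] at hz'
    obtain ⟨c, hc⟩ := (Submodule.mem_span_range_iff_exists_fun _).mp hz'
    choose F hF hF' using fun i => h0 (c i)
    refine ⟨∑ i, F i * MvPolynomial.X i, MvPolynomial.IsHomogeneous.sum _ _ _ fun i _ => ?_, ?_⟩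
    · simpa using (hF i).mul (MvPolynomial.isHomogeneous_X V i)
    · rw [← hc, map_sum, ← Finset.sum_sub_distrib]
      refine sum_mem fun i _ => ?_
      have : levelEval p n V e (MvPolynomial.X i) = levelGen p n V e i := by simp [levelEval]
      rw [map_mul, this, smul_eq_mul, ← sub_mul, sq]
      refine Ideal.mul_mem_mul (hF' i) ?_
      rw [rLevel_maximalIdeal]
      exact Ideal.subset_span ⟨i, rfl⟩
  induction s generalizing x with
  | zero => simpa using h0 x
  | succ s ih =>
    have hx' := hx
    rw [pow_succ] at hx'
    clear hx
    induction hx' using Submodule.mul_induction_on' with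
    | mem_mul_mem y hy z hz =>
      obtain ⟨F, hF, hF'⟩ := ih hy
      obtain ⟨G, hG, hG'⟩ := h1 z hz
      refine ⟨F * G, hF.mul hG, ?_⟩
      rw [map_mul]
      have h2 : y * z - levelEval p n V e F * levelEval p n V e G =
          (y - levelEval p n V e F) * z + levelEval p n V e F * (z - levelEval p n V e G) := by
        ring
      have h3 : levelEval p n V e F ∈ maximalIdeal (RLevel p n V e) ^ s := by
        have := sub_mem hy (Ideal.pow_le_pow_right (Nat.le_succ s) hF')
        rwa [sub_sub_cancel] at this
      rw [h2]
      refine add_mem ?_ ?_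
      · rw [pow_succ]
        exact Ideal.mul_mem_mul hF' hz
      · have := Ideal.mul_mem_mul h3 hG'
        rwa [← pow_add] at this
    | add y _ z _ hy hz =>
      obtain ⟨F, hF, hF'⟩ := hy
      obtain ⟨G, hG, hG'⟩ := hz
      refine ⟨F + G, hF.add hG, ?_⟩
      rw [map_add, add_sub_add_comm]
      exact add_mem hF' hG'

theorem WithTop.nsmul_lt_of_lt {x : WithTop ℚ} {N : ℕ} {q : ℚ} (hN : N ≠ 0)
    (h : (q : WithTop ℚ) < x) : ((N * q : ℚ) : WithTop ℚ) < N • x := by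
  induction x using WithTop.recTopCoe with
  | top =>
    obtain ⟨k, rfl⟩ := Nat.exists_eq_succ_of_ne_zero hN
    rw [succ_nsmul, add_top]
    exact WithTop.coe_lt_top _
  | coe x =>
    rw [← WithTop.coe_nsmul, WithTop.coe_lt_coe, nsmul_eq_mul]
    rw [WithTop.coe_lt_coe] at h
    have : (0 : ℚ) < N := by exact_mod_cast Nat.pos_of_ne_zero hN
    exact mul_lt_mul_of_pos_left h this

/-- On `R_e` nothing is known about `v` directly, so the leading form of `x` is raised to the power
`p^e`. Up to `p w` with `v(p w) ≥ s + 1`, the result is the value `G` in `R` of the form whose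
coefficients are the `p^e`-th powers. Hence `v(G) > s`, so `G` lies in `𝔪^{s+1}`; by
quasi-regularity `p` divides these powers, hence the coefficients themselves, and the leading form
vanishes modulo the maximal ideal. -/
theorem ExtendsMAdic.mem_pow_succ (hv : ExtendsMAdic v) (hp0 : (p : V) ≠ 0) (e s : ℕ)
    {x : RLevel p n V e} (hx : x ∈ maximalIdeal (RLevel p n V e) ^ s)
    (hlt : ((s / (p ^ e : ℕ) : ℚ) : WithTop ℚ) < v (levelToRInf p n V e x)) :
    x ∈ maximalIdeal (RLevel p n V e) ^ (s + 1) := by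
  classical
  have hN : p ^ e ≠ 0 := pow_ne_zero _ (Fact.out : p.Prime).ne_zero
  have hNQ : (0 : ℚ) < (p ^ e : ℕ) := by exact_mod_cast Nat.pos_of_ne_zero hN
  obtain ⟨F, hF, hF'⟩ := exists_isHomogeneous_sub_mem e s hx
  let term : (Fin (n + 1) →₀ ℕ) → RLevel p n V e := fun α =>
    MvPowerSeries.C (AdjoinRoot.of _ (F.coeff α)) * ∏ i, levelGen p n V e i ^ α i
  have hsum : levelEval p n V e F = ∑ α ∈ F.support, term α := by
    simp only [levelEval, MvPolynomial.coe_eval₂Hom, MvPolynomial.eval₂_eq']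
    rfl
  let T : (Fin (n + 1) →₀ ℕ) → BaseRing n V := fun α =>
    MvPowerSeries.C (F.coeff α ^ p ^ e) * ∏ i, baseGen p n V i ^ α i
  have hT : ∀ α, baseToLevel p n V e (T α) = term α ^ p ^ e := by
    intro α
    have h1 : baseToLevel p n V e (MvPowerSeries.C (F.coeff α ^ p ^ e)) =
        MvPowerSeries.C (AdjoinRoot.of _ (F.coeff α)) ^ p ^ e := by
      simp only [baseToLevel, levelTransition, RingHom.comp_apply, AlgHom.toRingHom_eq_coe,
        RingHom.coe_coe, MvPowerSeries.map_C, MvPowerSeries.expand_C, coeffTransition_of, map_pow]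
    rw [map_mul, h1, map_prod, mul_pow, ← Finset.prod_pow]
    congr 1
    refine Finset.prod_congr rfl fun i _ => ?_
    rw [map_pow, baseToLevel_baseGen, ← pow_mul, ← pow_mul, mul_comm]
  have hgen : ∀ i, levelGen p n V e i ∈ maximalIdeal (RLevel p n V e) := fun i => by
    rw [rLevel_maximalIdeal]
    exact Ideal.subset_span ⟨i, rfl⟩
  have hdeg : ∀ α ∈ F.support, ∑ i, α i = s := by
    intro α hα
    rw [← Finsupp.degree_eq_sum, Finsupp.degree_eq_weight_one]
    exact hF (MvPolynomial.mem_support_iff.mp hα)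
  have hmon : ∀ α ∈ F.support, ∏ i, levelGen p n V e i ^ α i ∈
      maximalIdeal (RLevel p n V e) ^ s := by
    intro α hα
    rw [← hdeg α hα, ← Finset.prod_pow_eq_pow_sum]
    exact Ideal.prod_mem_prod fun i _ => Ideal.pow_mem_pow (hgen i) _
  have hterm : ∀ α ∈ F.support, term α ∈ maximalIdeal (RLevel p n V e) ^ s := fun α hα =>
    Ideal.mul_mem_left _ _ (hmon α hα)
  obtain ⟨w, hw, hvw⟩ := v.exists_sum_pow_eq hv.nonneg_natCast (Fact.out : p.Prime) e F.support
    (fun α => levelToRInf p n V e (term α)) ((s / (p ^ e : ℕ) : ℚ) : WithTop ℚ)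
    (fun α hα => hv.le_of_mem_pow hp0 e s (hterm α hα))
  let G : BaseRing n V := ∑ α ∈ F.support, T α
  have hG : levelToRInf p n V e (levelEval p n V e F) ^ p ^ e =
      algebraMap (BaseRing n V) (RInf p n V) G + p * w := by
    rw [hsum, map_sum, hw, ← levelToRInf_baseToLevel p n V e, map_sum, map_sum]
    congr 1
    refine Finset.sum_congr rfl fun α _ => ?_
    rw [hT, map_pow]
  have hv1 : ((s / (p ^ e : ℕ) : ℚ) : WithTop ℚ) <
      v (levelToRInf p n V e (levelEval p n V e F)) := by
    have h1 : levelEval p n V e F = x - (x - levelEval p n V e F) := by ring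
    rw [h1, map_sub]
    refine (lt_min hlt (lt_of_lt_of_le ?_ (hv.le_of_mem_pow hp0 e (s + 1) hF'))).trans_le
      (v.map_sub _ _)
    rw [WithTop.coe_lt_coe]
    push_cast
    exact (div_lt_div_iff_of_pos_right (by exact_mod_cast hNQ)).mpr (by linarith)
  have hv2 : ((s : ℚ) : WithTop ℚ) < v (levelToRInf p n V e (levelEval p n V e F) ^ p ^ e) := by
    have := WithTop.nsmul_lt_of_lt hN hv1
    rwa [mul_div_cancel₀ _ hNQ.ne', ← v.map_pow] at this
  have hvp : v (p : RInf p n V) = ((1 : ℚ) : WithTop ℚ) := by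
    have := hv (baseGen p n V 0) 1 (by simpa using baseGen_mem p n V 0)
      (baseGen_notMem p n V hp0 0)
    simpa [baseGen] using this
  have hv3 : ((s : ℚ) : WithTop ℚ) < v (p * w) := by
    rw [v.map_mul, hvp]
    refine lt_of_lt_of_le ?_ (add_le_add le_rfl hvw)
    rw [← WithTop.coe_nsmul, ← WithTop.coe_add, WithTop.coe_lt_coe, nsmul_eq_mul,
      mul_div_cancel₀ _ hNQ.ne']
    linarith
  have hv4 : ((s : ℚ) : WithTop ℚ) < v (algebraMap (BaseRing n V) (RInf p n V) G) := by
    have h1 : algebraMap (BaseRing n V) (RInf p n V) G =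
        levelToRInf p n V e (levelEval p n V e F) ^ p ^ e - p * w := by rw [hG]; ring
    rw [h1]
    exact (lt_min hv2 hv3).trans_le (v.map_sub _ _)
  have hGs : G ∈ maximalIdeal (BaseRing n V) ^ s := by
    refine sum_mem fun α hα => Ideal.mul_mem_left _ _ ?_
    rw [← hdeg α hα, ← Finset.prod_pow_eq_pow_sum]
    exact Ideal.prod_mem_prod fun i _ => Ideal.pow_mem_pow (baseGen_mem p n V i) _
  have hGs' : G ∈ maximalIdeal (BaseRing n V) ^ (s + 1) := by
    by_contra h
    rw [hv G s hGs h] at hv4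
    exact lt_irrefl _ hv4
  let F' : MvPolynomial (Fin (n + 1)) V :=
    ∑ α ∈ F.support, MvPolynomial.monomial α (F.coeff α ^ p ^ e)
  have hF'hom : F'.IsHomogeneous s := by
    refine MvPolynomial.IsHomogeneous.sum _ _ _ fun α hα =>
      MvPolynomial.isHomogeneous_monomial _ ?_
    rw [Finsupp.degree_eq_sum, hdeg α hα]
  have hF'eval : MvPolynomial.eval₂ MvPowerSeries.C (baseGen p n V) F' = G := by
    rw [MvPolynomial.eval₂_sum]
    refine Finset.sum_congr rfl fun α _ => ?_
    rw [MvPolynomial.eval₂_monomial, Finsupp.prod_fintype _ _ (fun i => pow_zero _)]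
  have hcoeff : ∀ α ∈ F.support, F.coeff α ∈ Ideal.span {(p : V)} := by
    intro α hα
    have h1 := dvd_coeff_of_eval₂_mem p n V hp0 s F' hF'hom (by rwa [hF'eval]) α
    have h2 : F'.coeff α = F.coeff α ^ p ^ e := by
      simp only [F', MvPolynomial.coeff_sum, MvPolynomial.coeff_monomial]
      rw [Finset.sum_ite_eq', if_pos hα]
    rw [h2, ← hV.out] at h1
    rw [← hV.out]
    exact (maximalIdeal.isMaximal V).isPrime.mem_of_pow_mem _ h1
  have hfinal : levelEval p n V e F ∈ maximalIdeal (RLevel p n V e) ^ (s + 1) := by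
    rw [hsum]
    refine sum_mem fun α hα => ?_
    rw [pow_succ']
    refine Ideal.mul_mem_mul ?_ (hmon α hα)
    obtain ⟨b, hb⟩ := Ideal.mem_span_singleton.mp (hcoeff α hα)
    -- A factor `p` is the `p^e`-th power of the first parameter, with `p^e ≥ 1`, and so supplies
    -- one more factor in the maximal ideal.
    have h1 : MvPowerSeries.C (σ := Fin n)
        (AdjoinRoot.of (Polynomial.X ^ (p ^ e) - Polynomial.C (p : V) : V[X]) (F.coeff α)) =
        levelGen p n V e 0 ^ p ^ e * MvPowerSeries.C (AdjoinRoot.of _ b) := by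
      rw [hb, map_mul, coeffLevel_of_natCast, ← coeffRoot_pow, map_mul, map_pow]
      rfl
    rw [h1]
    exact Ideal.mul_mem_right _ _ (Ideal.pow_mem_of_mem _ (hgen 0) _ (Nat.pos_of_ne_zero hN))
  have := add_mem hF' hfinal
  rwa [sub_add_cancel] at this

/-- Valuation at least `ε` forces membership in the `s`-th power of the maximal ideal for all `s ≤ ε
p^e`, in particular for `s = (n + 1) p^{e-j}`; pigeonhole on monomials does the rest. The point is
that `j` depends on `ε` only, not on `e`. -/
theorem ExtendsMAdic.mem_map_of_le (hv : ExtendsMAdic v) (hp0 : (p : V) ≠ 0) {ε : ℚ} {j e : ℕ}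
    (hj : (n + 1 : ℚ) ≤ ε * p ^ j) (hje : j ≤ e) {x : RLevel p n V e}
    (hx : (ε : WithTop ℚ) ≤ v (levelToRInf p n V e x)) :
    x ∈ Ideal.span (Set.range fun i => levelGen p n V e i ^ p ^ (e - j)) := by
  have hN : p ^ e ≠ 0 := pow_ne_zero _ (Fact.out : p.Prime).ne_zero
  have hNQ : (0 : ℚ) < (p ^ e : ℕ) := by exact_mod_cast Nat.pos_of_ne_zero hN
  have key : ∀ s : ℕ, (s : ℚ) ≤ ε * (p ^ e : ℕ) → x ∈ maximalIdeal (RLevel p n V e) ^ s := by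
    intro s
    induction s with
    | zero => simp
    | succ s ih =>
      intro hs
      push_cast at hs hNQ
      refine hv.mem_pow_succ hp0 e s (ih (by push_cast; linarith)) (lt_of_lt_of_le ?_ hx)
      rw [WithTop.coe_lt_coe]
      push_cast
      rw [div_lt_iff₀ hNQ]
      linarith
  refine Ideal.span_range_pow_le _ _ ?_
  rw [← rLevel_maximalIdeal]
  refine key _ ?_
  obtain ⟨d, rfl⟩ := Nat.exists_eq_add_of_le hje
  rw [Nat.add_sub_cancel_left]
  push_cast
  rw [pow_add, ← mul_assoc]
  exact mul_le_mul_of_nonneg_right hj (by positivity)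

/-- An element generating a module of normalized length zero is killed by elements of
arbitrarily small valuation. -/
theorem ExtendsMAdic.exists_smul_eq_zero (hv : ExtendsMAdic v) (hp0 : (p : V) ≠ 0)
    {M : Type w} [AddCommGroup M] [Module (RInf p n V) M] (m : M)
    (hm : spanLength (levelSubring p n V) (p ^ (n + 1)) {m} = 0) {ε : ℚ} (hε : 0 < ε) :
    ∃ b : RInf p n V, b • m = 0 ∧ v b < (ε : WithTop ℚ) := by
  by_contra! hcon
  have hp1 : (1 : ℚ) < p := by exact_mod_cast (Fact.out : p.Prime).one_lt
  obtain ⟨j, hj⟩ : ∃ j : ℕ, (n + 1 : ℚ) ≤ ε * p ^ j := by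
    obtain ⟨j, hj⟩ := pow_unbounded_of_one_lt ((n + 1 : ℚ) / ε) hp1
    refine ⟨j, ?_⟩
    rw [div_lt_iff₀ hε] at hj
    linarith
  set q := p ^ (n + 1) with hq
  have hq0 : (q : ℝ≥0∞) ≠ 0 := by
    exact_mod_cast pow_ne_zero _ (Fact.out : p.Prime).ne_zero
  have hqt : ∀ k, (q : ℝ≥0∞) ^ k ≠ ⊤ := fun k => ENNReal.pow_ne_top (ENNReal.natCast_ne_top _)
  -- For every `e ≥ j` the annihilator of `m` in `R_e` lies in the ideal of `p^{e-j}`-th powers of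
  -- the parameters, whose quotient has length at least `q^{e-j}`. Division by `q^e` leaves a bound
  -- independent of `e`.
  have hlow : ((q : ℝ≥0∞) ^ j)⁻¹ ≤ spanLength (levelSubring p n V) q {m} := by
    rw [(isLengthTower_levelSubring p n V).spanLength_eq_iInf {m} j]
    refine le_iInf₂ fun e he => ?_
    let m' : Submodule.span (levelSubring p n V e) {m} := ⟨m, Submodule.mem_span_singleton_self m⟩
    let u : RLevel p n V e →ₛₗ[levelToSubring p n V e]
        Submodule.span (levelSubring p n V e) {m} :=
      { toFun := fun r => levelToSubring p n V e r • m'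
        map_add' := fun r s => by rw [map_add, add_smul]
        map_smul' := fun r s => by rw [smul_eq_mul, map_mul, mul_smul] }
    have hker : LinearMap.ker u ≤
        Ideal.span (Set.range fun i => levelGen p n V e i ^ p ^ (e - j)) := by
      intro r hr
      refine hv.mem_map_of_le hp0 hj he (hcon _ ?_)
      exact congrArg Subtype.val (LinearMap.mem_ker.mp hr)
    have h1 := le_rLevel_length_quotient p n V e hp0 (p ^ (e - j))
    have h2 := Module.length_le_of_surjective (Submodule.factor hker)
      (Submodule.factor_surjective hker)
    have h3 := length_le_of_injective_semilinear ((LinearMap.ker u).liftQ u le_rfl) (by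
      rw [← LinearMap.ker_eq_bot, Submodule.ker_liftQ_eq_bot]
      exact le_rfl)
    have h4 := ENat.toENNReal_le.mpr (h1.trans (h2.trans h3))
    rw [levelLength, ENNReal.le_div_iff_mul_le (Or.inl (pow_ne_zero _ hq0)) (Or.inl (hqt _))]
    refine le_trans (le_of_eq ?_) h4
    obtain ⟨d, rfl⟩ := Nat.exists_eq_add_of_le he
    rw [Nat.add_sub_cancel_left, pow_add, ← mul_assoc,
      ENNReal.inv_mul_cancel (pow_ne_zero _ hq0) (hqt _), one_mul, hq]
    push_cast
    rw [← pow_mul, ← pow_mul, mul_comm]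
  rw [hm, nonpos_iff_eq_zero, ENNReal.inv_eq_zero] at hlow
  exact hqt j hlow

end Valuation

/-! ### The Čech complex -/

section Cech

variable {A : Type u} [CommRing A] {d : ℕ} (x : Fin d → A)

section Module

variable (M : Type w) [AddCommGroup M] [Module A M]

/-- The restriction of the component at `K` to the component at `J`, zero unless `K ⊆ J`. -/
def cechFace (J K : Finset (Fin d)) : CechTotal x M →ₗ[A] LocalizedModule (cechMonoid x J) M :=
  open Classical in
  if h : K ⊆ J then
    (LocalizedModule.liftOfLE (M := M) (cechMonoid x K) (cechMonoid x J)
      (cechMonoid_mono x h)).comp (LinearMap.proj K)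
  else 0

theorem cechFace_apply {J K : Finset (Fin d)} (h : K ⊆ J) (c : CechTotal x M) :
    cechFace x M J K c = LocalizedModule.liftOfLE (M := M) (cechMonoid x K) (cechMonoid x J)
      (cechMonoid_mono x h) (c K) := by
  rw [cechFace, dif_pos h]
  rfl

theorem cechDifferential_apply (c : CechTotal x M) (J : Finset (Fin d)) :
    cechDifferential x M c J =
      ∑ j ∈ J, (-1 : A) ^ (J.filter (· < j)).card • cechFace x M J (J.erase j) c := by
  simp only [cechDifferential, LinearMap.pi_apply, LinearMap.sum_apply, LinearMap.smul_apply]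
  refine Finset.sum_congr rfl fun j _ => ?_
  rw [cechFace_apply x M (J.erase_subset j)]
  rfl

theorem cechFace_eq_zero {J K : Finset (Fin d)} {c : CechTotal x M} (h : c K = 0) :
    cechFace x M J K c = 0 := by
  by_cases hK : K ⊆ J
  · rw [cechFace_apply x M hK, h, map_zero]
  · rw [cechFace, dif_neg hK]
    rfl

theorem liftOfLE_mk {S₁ S₂ : Submonoid A} (h : S₁ ≤ S₂) (m : M) (s : S₁) :
    LocalizedModule.liftOfLE (M := M) S₁ S₂ h (LocalizedModule.mk m s : LocalizedModule S₁ M) =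
      (LocalizedModule.mk m (⟨(s : A), h s.2⟩ : S₂) : LocalizedModule S₂ M) := by
  rw [IsLocalizedModule.mk_eq_mk', IsLocalizedModule.mk_eq_mk']
  exact IsLocalizedModule.liftOfLE_mk' S₁ S₂ h _ _ m s

theorem liftOfLE_liftOfLE {S₁ S₂ S₃ : Submonoid A} (h : S₁ ≤ S₂) (h' : S₂ ≤ S₃)
    (z : LocalizedModule S₁ M) :
    LocalizedModule.liftOfLE (M := M) S₂ S₃ h' (LocalizedModule.liftOfLE (M := M) S₁ S₂ h z) =
      LocalizedModule.liftOfLE (M := M) S₁ S₃ (h.trans h') z := by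
  induction z using LocalizedModule.induction_on with
  | _ m s => rw [liftOfLE_mk, liftOfLE_mk, liftOfLE_mk]

theorem cechDifferential_mem_supported {k : ℕ} {c : CechTotal x M}
    (hc : c ∈ cechSupported x M (fun I => I.card + 1 = k)) :
    cechDifferential x M c ∈ cechSupported x M (fun I => I.card = k) := by
  intro J hJ
  rw [cechDifferential_apply]
  refine Finset.sum_eq_zero fun j hj => ?_
  rw [cechFace_eq_zero x M (hc _ ?_), smul_zero]
  change ¬ ((J.erase j).card + 1 = k)
  rwa [Finset.card_erase_add_one hj]

/-- The sign of an ordered pair of removals changes when the removals are exchanged. -/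
theorem cech_sign_swap (J : Finset (Fin d)) {i j : Fin d} (hi : i ∈ J) (hij : i < j) :
    (-1 : A) ^ (J.filter (· < j)).card * (-1) ^ ((J.erase j).filter (· < i)).card +
      (-1 : A) ^ (J.filter (· < i)).card * (-1) ^ ((J.erase i).filter (· < j)).card = 0 := by
  have h1 : (J.erase j).filter (· < i) = J.filter (· < i) := by
    ext a
    simp only [Finset.mem_filter, Finset.mem_erase]
    constructor
    · rintro ⟨⟨_, h⟩, h'⟩; exact ⟨h, h'⟩
    · rintro ⟨h, h'⟩; exact ⟨⟨(h'.trans hij).ne, h⟩, h'⟩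
  have h2 : ((J.erase i).filter (· < j)).card + 1 = (J.filter (· < j)).card := by
    rw [Finset.filter_erase, Finset.card_erase_add_one (Finset.mem_filter.mpr ⟨hi, hij⟩)]
  rw [h1, ← h2, pow_succ]
  ring

theorem cechDifferential_cechDifferential (c : CechTotal x M) :
    cechDifferential x M (cechDifferential x M c) = 0 := by
  ext J
  have h1 : cechDifferential x M (cechDifferential x M c) J =
      ∑ j ∈ J, ∑ i ∈ J.erase j, ((-1 : A) ^ (J.filter (· < j)).card *
        (-1) ^ ((J.erase j).filter (· < i)).card) • cechFace x M J ((J.erase j).erase i) c := by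
    rw [cechDifferential_apply]
    refine Finset.sum_congr rfl fun j _ => ?_
    rw [cechFace_apply x M (J.erase_subset j), cechDifferential_apply, map_sum, Finset.smul_sum]
    refine Finset.sum_congr rfl fun i _ => ?_
    rw [map_smul, smul_smul, cechFace_apply x M ((J.erase j).erase_subset i), liftOfLE_liftOfLE,
      cechFace_apply x M (((J.erase j).erase_subset i).trans (J.erase_subset j))]
  rw [h1, Finset.sum_sigma']
  -- Exchanging the two removed indices reaches the same face with the opposite sign.
  refine Finset.sum_involution (fun a _ => ⟨a.2, a.1⟩) ?_ ?_ ?_ ?_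
  · rintro ⟨j, i⟩ h
    simp only [Finset.mem_sigma, Finset.mem_erase] at h
    obtain ⟨hj, hne, hi⟩ := h
    simp only
    rw [Finset.erase_right_comm (a := i), ← add_smul]
    rcases lt_or_gt_of_ne hne with h | h
    · rw [cech_sign_swap J hi h, zero_smul]
    · rw [add_comm, cech_sign_swap J hj h, zero_smul]
  · rintro ⟨j, i⟩ h _ heq
    simp only [Finset.mem_sigma, Finset.mem_erase] at h
    simp only [Sigma.mk.injEq] at heq
    exact h.2.1 heq.1
  · rintro ⟨j, i⟩ h
    simp only [Finset.mem_sigma, Finset.mem_erase] at h ⊢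
    exact ⟨h.2.2, h.2.1.symm, h.1⟩
  · intro a _
    rfl

end Module

/-! ### Multiplicative structure and Frobenius on the Čech complex of an algebra. -/

section Algebra

variable (T : Type w) [CommRing T] [Algebra A T]

theorem liftOfLE_mul {S₁ S₂ : Submonoid A} (h : S₁ ≤ S₂) (y z : LocalizedModule S₁ T) :
    LocalizedModule.liftOfLE (M := T) S₁ S₂ h (y * z) =
      LocalizedModule.liftOfLE (M := T) S₁ S₂ h y * LocalizedModule.liftOfLE (M := T) S₁ S₂ h z := by
  induction y using LocalizedModule.induction_on with
  | _ a s =>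
  induction z using LocalizedModule.induction_on with
  | _ b t =>
    rw [LocalizedModule.mk_mul_mk, liftOfLE_mk, liftOfLE_mk, liftOfLE_mk,
      LocalizedModule.mk_mul_mk]
    rfl

theorem liftOfLE_one {S₁ S₂ : Submonoid A} (h : S₁ ≤ S₂) :
    LocalizedModule.liftOfLE (M := T) S₁ S₂ h 1 = 1 := by
  rw [OreLocalization.one_def, OreLocalization.one_def]
  exact liftOfLE_mk T h 1 1

theorem liftOfLE_pow {S₁ S₂ : Submonoid A} (h : S₁ ≤ S₂) (y : LocalizedModule S₁ T) (k : ℕ) :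
    LocalizedModule.liftOfLE (M := T) S₁ S₂ h (y ^ k) =
      LocalizedModule.liftOfLE (M := T) S₁ S₂ h y ^ k := by
  induction k with
  | zero => rw [pow_zero, pow_zero, liftOfLE_one]
  | succ k ih => rw [pow_succ, pow_succ, liftOfLE_mul, ih]

theorem exists_sum_pow_prime_eq {B : Type*} [CommRing B] {p : ℕ} (hp : p.Prime) {ι : Type*}
    (s : Finset ι) (f : ι → B) : ∃ r, (∑ i ∈ s, f i) ^ p = ∑ i ∈ s, f i ^ p + p * r := by
  classical
  induction s using Finset.induction_on with
  | empty => exact ⟨0, by simp [hp.ne_zero]⟩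
  | insert i s hi ih =>
    obtain ⟨r, hr⟩ := ih
    obtain ⟨r', hr'⟩ := exists_add_pow_prime_eq hp (f i) (∑ i ∈ s, f i)
    refine ⟨r + f i * (∑ i ∈ s, f i) * r', ?_⟩
    rw [Finset.sum_insert hi, Finset.sum_insert hi, hr', hr]
    ring

theorem exists_neg_one_pow_pow_prime_eq {B : Type*} [CommRing B] {p : ℕ} (hp : p.Prime) (k : ℕ) :
    ∃ r, ((-1 : B) ^ k) ^ p = (-1) ^ k + p * r := by
  rcases hp.eq_two_or_odd' with rfl | hodd
  · rcases neg_one_pow_eq_or B k with h | h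
    · exact ⟨0, by rw [h]; simp⟩
    -- For `p = 2` the sign `-1` is fixed by Frobenius only modulo `p`: `1 = -1 + 2`.
    · exact ⟨1, by rw [h]; norm_num⟩
  · refine ⟨0, ?_⟩
    rw [← pow_mul, mul_comm, pow_mul, hodd.neg_one_pow]
    simp

/-- The Čech differential commutes with Frobenius modulo `p`. -/
theorem cechDifferential_pow {p : ℕ} (hp : p.Prime) (y : CechTotal x T) :
    ∃ u : CechTotal x T,
      cechDifferential x T (y ^ p) = cechDifferential x T y ^ p + (p : A) • u := by
  suffices h : ∀ J, ∃ u : LocalizedModule (cechMonoid x J) T,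
      cechDifferential x T (y ^ p) J = cechDifferential x T y J ^ p + (p : A) • u by
    choose u hu using h
    exact ⟨u, funext hu⟩
  intro J
  obtain ⟨r, hr⟩ := exists_sum_pow_prime_eq hp J
    (fun j => (-1 : A) ^ (J.filter (· < j)).card • cechFace x T J (J.erase j) y)
  choose ρ hρ using fun j : Fin d =>
    exists_neg_one_pow_pow_prime_eq (B := A) hp (J.filter (· < j)).card
  refine ⟨-r - ∑ j ∈ J, ρ j • cechFace x T J (J.erase j) y ^ p, ?_⟩
  rw [cechDifferential_apply, cechDifferential_apply, hr]
  have h1 : ∀ j, cechFace x T J (J.erase j) (y ^ p) = cechFace x T J (J.erase j) y ^ p := by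
    intro j
    rw [cechFace_apply x T (J.erase_subset j), cechFace_apply x T (J.erase_subset j)]
    exact liftOfLE_pow T _ _ _
  have h2 : ∀ j, ((-1 : A) ^ (J.filter (· < j)).card • cechFace x T J (J.erase j) y) ^ p =
      (-1 : A) ^ (J.filter (· < j)).card • cechFace x T J (J.erase j) y ^ p +
        (p : A) • ρ j • cechFace x T J (J.erase j) y ^ p := by
    intro j
    rw [smul_pow, hρ, add_smul, mul_smul]
  simp only [h1, h2, Finset.sum_add_distrib, ← Finset.smul_sum]
  rw [smul_sub, smul_neg, Nat.cast_smul_eq_nsmul A p r, nsmul_eq_mul]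
  ring

variable [IsDomain T] (hinj : Function.Injective (algebraMap A T))

section TorsionFree

variable {S : Submonoid A} (hS : ∀ s ∈ S, s ≠ 0)
include hinj hS

theorem localizedModule_mk_eq_mk {a b : T} {s t : S} :
    (LocalizedModule.mk a s : LocalizedModule S T) = LocalizedModule.mk b t ↔
      (t : A) • a = (s : A) • b := by
  rw [LocalizedModule.mk_eq]
  constructor
  · rintro ⟨u, hu⟩
    change (u : A) • ((t : A) • a) = (u : A) • ((s : A) • b) at hu
    rw [Algebra.smul_def, Algebra.smul_def (u : A)] at hu
    refine mul_left_cancel₀ ?_ hu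
    rw [Ne, map_eq_zero_iff _ hinj]
    exact hS u u.2
  · intro h
    exact ⟨1, by rw [one_smul, one_smul]; exact h⟩

theorem localizedModule_smul_eq_zero {a : A} (ha : a ≠ 0) {z : LocalizedModule S T}
    (h : a • z = 0) : z = 0 := by
  induction z using LocalizedModule.induction_on with
  | _ m s =>
    rw [LocalizedModule.smul'_mk, ← LocalizedModule.zero_mk (1 : S),
      localizedModule_mk_eq_mk T hinj hS, smul_zero, OneMemClass.coe_one, one_smul,
      Algebra.smul_def, mul_eq_zero, map_eq_zero_iff _ hinj] at h
    rw [h.resolve_left ha, LocalizedModule.zero_mk]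

/-- If `T` is integrally closed and `p ∣ y ^ p` in a localization of `T`, then `p^{1/p} ∣ y`. -/
theorem localizedModule_root_dvd [IsIntegrallyClosed T] {p : ℕ} (hp : p ≠ 0) {c : A}
    (hc : c ^ p = p) {y z : LocalizedModule S T} (h : y ^ p = (p : A) • z) :
    ∃ u, y = c • u := by
  induction y using LocalizedModule.induction_on with
  | _ a s =>
  induction z using LocalizedModule.induction_on with
  | _ b t =>
    rw [LocalizedModule.mk_pow, LocalizedModule.smul'_mk, localizedModule_mk_eq_mk T hinj hS] at h
    -- With `y = a/s` and `z = b/t`, clearing denominators gives `(ta)^p = p · t^{p-1} s^p b`.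
    -- Integral closedness then extracts the `p`-th root `c` of `p` as a divisor of `ta`.
    have h1 : algebraMap A T c ^ p ∣ ((t : A) • a) ^ p := by
      obtain ⟨k, rfl⟩ := Nat.exists_eq_succ_of_ne_zero hp
      refine ⟨(t : A) ^ k • ((s ^ (k + 1) : S) : A) • b, ?_⟩
      rw [smul_pow, pow_succ (t : A), mul_smul, h, ← map_pow, hc, ← Algebra.smul_def,
        smul_comm ((s ^ (k + 1) : S) : A), smul_comm ((t : A) ^ k)]
    rw [IsIntegrallyClosed.pow_dvd_pow_iff hp] at h1
    obtain ⟨e, he⟩ := h1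
    refine ⟨LocalizedModule.mk e (t * s), ?_⟩
    rw [LocalizedModule.smul'_mk, localizedModule_mk_eq_mk T hinj hS, Algebra.smul_def c, ← he,
      Submonoid.coe_mul, mul_smul, smul_comm]

theorem liftOfLE_injective {S₁ : Submonoid A} (h : S₁ ≤ S) :
    Function.Injective (LocalizedModule.liftOfLE (M := T) S₁ S h) := by
  rw [injective_iff_map_eq_zero]
  intro z hz
  induction z using LocalizedModule.induction_on with
  | _ m s =>
    rw [liftOfLE_mk, ← LocalizedModule.zero_mk (1 : S), localizedModule_mk_eq_mk T hinj hS,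
      smul_zero, OneMemClass.coe_one, one_smul] at hz
    rw [hz, LocalizedModule.zero_mk]

end TorsionFree

omit [IsDomain T] in
/-- Frobenius is surjective modulo `p` on localizations of `T`. -/
theorem localizedModule_exists_pow_eq {p : ℕ} (hp : p ≠ 0)
    (hF : ∀ t : T, ∃ y z : T, t = y ^ p + p * z) {S : Submonoid A} (z : LocalizedModule S T) :
    ∃ w u : LocalizedModule S T, z = w ^ p + (p : A) • u ∧ (z = 0 → w = 0) := by
  -- The choice `w = 0` for `z = 0` ensures that roots taken component by component keep the support
  -- of a cochain.
  by_cases hz : z = 0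
  · exact ⟨0, 0, by rw [hz, zero_pow hp, smul_zero, add_zero], fun _ => rfl⟩
  induction z using LocalizedModule.induction_on with
  | _ a s =>
    obtain ⟨k, rfl⟩ := Nat.exists_eq_succ_of_ne_zero hp
    -- The fraction `a/s` is expanded to `s^k a / s^{k+1}`, so that its denominator is a `p`-th
    -- power.
    obtain ⟨y, b, hyb⟩ := hF ((s ^ k : S) • a)
    refine ⟨LocalizedModule.mk y s, LocalizedModule.mk b (s ^ (k + 1)), ?_, fun h => absurd h hz⟩
    rw [LocalizedModule.mk_pow, LocalizedModule.smul'_mk, ← LocalizedModule.mk_cancel_common_left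
      (s ^ k) s a, hyb, ← pow_succ]
    have h1 : (((k + 1 : ℕ) : A) • b : T) = ((k + 1 : ℕ) : T) * b := by
      rw [Algebra.smul_def, map_natCast]
    rw [h1, LocalizedModule.mk_add_mk, ← smul_add, LocalizedModule.mk_cancel_common_left]

theorem cechMonoid_ne_zero [IsDomain A] (hx : ∀ i, x i ≠ 0) (I : Finset (Fin d)) :
    ∀ s ∈ cechMonoid x I, s ≠ 0 := by
  have h : cechMonoid x I ≤ nonZeroDivisors A := by
    rw [cechMonoid, Submonoid.closure_le]
    rintro _ ⟨i, _, rfl⟩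
    exact mem_nonZeroDivisors_of_ne_zero (hx i)
  exact fun s hs => nonZeroDivisors.ne_zero (h hs)

end Algebra

end Cech

/-! ### Torsion in Čech cohomology -/

section PowerTorsion

variable {R : Type*} [CommRing R] {B : ℕ → Subring R} [∀ e, IsLocalRing (B e)] {q : ℕ}
  {M : Type*} [AddCommGroup M] [Module R M]

omit [∀ e, IsLocalRing (B e)] in
theorem submoduleLength_range_comp_le {M' Y Z : Type*} [AddCommGroup M'] [Module R M']
    [AddCommGroup Y] [Module R Y] [AddCommGroup Z] [Module R Z] {f : Y →ₗ[R] M} {g : Y →ₗ[R] M'}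
    (hfg : LinearMap.ker f ≤ LinearMap.ker g) (u : Z →ₗ[R] Y) :
    submoduleLength B q (LinearMap.range (g.comp u)) ≤
      submoduleLength B q (LinearMap.range (f.comp u)) := by
  refine submoduleLength_range_le_of_ker_le _ _ ?_
  rw [LinearMap.ker_comp, LinearMap.ker_comp]
  exact Submodule.comap_mono hfg

/-- The `c^{i+1}`-torsion is filtered by multiplication by `c^i`: the kernel consists of
`c^i`-torsion and the image of `c`-torsion. One factor `b` is spent on the image at each step, which
is why `b^i` appears on the left. -/
theorem IsLengthTower.submoduleLength_ker_pow_le (h : IsLengthTower B q) (b c : R) (i : ℕ) :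
    submoduleLength B q
      ((LinearMap.ker (LinearMap.lsmul R M (c ^ i))).map (LinearMap.lsmul R M (b ^ i))) ≤
      i * submoduleLength B q
        ((LinearMap.ker (LinearMap.lsmul R M c)).map (LinearMap.lsmul R M b)) := by
  induction i with
  | zero =>
    refine le_of_eq_of_le ?_ zero_le
    have h1 : LinearMap.ker (LinearMap.lsmul R M (c ^ 0)) = ⊥ := by
      rw [eq_bot_iff]
      intro m hm
      simpa using hm
    rw [h1, Submodule.map_bot, ← nonpos_iff_eq_zero, submoduleLength_le_iff]
    intro g _ hg
    refine (iInf_le _ 0).trans (le_of_eq ?_)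
    have h2 : Submodule.span (B 0) g = ⊥ := Submodule.span_eq_bot.mpr fun x hx => hg hx
    rw [levelLength, h2, Module.length_eq_zero]
    simp
  | succ i ih =>
    have h1 := h.submoduleLength_mul_le (b ^ i)
      ((LinearMap.ker (LinearMap.lsmul R M (c ^ (i + 1)))).map (LinearMap.lsmul R M b))
      (LinearMap.lsmul R M (c ^ i))
    have h2 : ((LinearMap.ker (LinearMap.lsmul R M (c ^ (i + 1)))).map
        (LinearMap.lsmul R M b)).map (LinearMap.lsmul R M (b ^ i)) =
        (LinearMap.ker (LinearMap.lsmul R M (c ^ (i + 1)))).map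
          (LinearMap.lsmul R M (b ^ (i + 1))) := by
      rw [← Submodule.map_comp]
      congr 1
      ext m
      simp [pow_succ', mul_smul, smul_comm b]
    rw [h2] at h1
    refine h1.trans ?_
    rw [Nat.cast_add, Nat.cast_one, add_mul, one_mul]
    refine add_le_add (le_trans (submoduleLength_mono B q (Submodule.map_mono inf_le_right)) ih)
      (submoduleLength_mono B q ?_)
    rintro _ ⟨_, ⟨m, hm, rfl⟩, rfl⟩
    refine ⟨c ^ i • m, ?_, ?_⟩
    · change c • c ^ i • m = 0
      rw [smul_smul, ← pow_succ']
      exact hm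
    · exact smul_comm b (c ^ i) m

end PowerTorsion

/-! ### The Bockstein sequence and the comparison of lengths through Frobenius. -/

section Bockstein

variable {A : Type*} [CommRing A] {C : Type*} [AddCommGroup C] [Module A C]
  (D : C →ₗ[A] C) (F E Z : Submodule A C)

/-- Pairs of a cochain `y` in `F` and a cocycle `z` in `Z` with `D y = a z`. -/
def bocksteinPairs (a : A) : Submodule A (C × Z) where
  carrier := {y | y.1 ∈ F ∧ D y.1 = a • (y.2 : C)}
  add_mem' {y z} hy hz := ⟨add_mem hy.1 hz.1, by
    rw [Prod.fst_add, map_add, hy.2, hz.2, Prod.snd_add, Submodule.coe_add, smul_add]⟩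
  zero_mem' := ⟨zero_mem _, by simp⟩
  smul_mem' r y hy := ⟨Submodule.smul_mem _ r hy.1, by
    rw [Prod.smul_fst, map_smul, hy.2, Prod.smul_snd, Submodule.coe_smul, smul_comm]⟩

/-- The elements that belong to `E` modulo `a`. -/
def supMultiples (a : A) : Submodule A C := LinearMap.range (LinearMap.lsmul A C a) ⊔ E

theorem mem_supMultiples {a : A} {y : C} :
    y ∈ supMultiples E a ↔ ∃ u, ∃ w ∈ E, y = a • u + w := by
  rw [supMultiples, Submodule.mem_sup]
  constructor
  · rintro ⟨_, ⟨u, rfl⟩, w, hw, rfl⟩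
    exact ⟨u, w, hw, rfl⟩
  · rintro ⟨u, w, hw, rfl⟩
    exact ⟨_, ⟨u, rfl⟩, w, hw, rfl⟩

theorem smul_mem_supMultiples (a : A) (u : C) : a • u ∈ supMultiples E a :=
  (mem_supMultiples E).mpr ⟨u, 0, zero_mem _, (add_zero _).symm⟩

/-- The class modulo `a` of the first member of a pair. -/
def bocksteinSource (a : A) : bocksteinPairs D F Z a →ₗ[A] C ⧸ supMultiples E a :=
  (supMultiples E a).mkQ.comp ((LinearMap.fst A C Z).comp (Submodule.subtype _))

/-- The cohomology class of the second member of a pair. -/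
def bocksteinTarget (a : A) :
    bocksteinPairs D F Z a →ₗ[A] Z ⧸ (F.map D).submoduleOf Z :=
  ((F.map D).submoduleOf Z).mkQ.comp ((LinearMap.snd A C Z).comp (Submodule.subtype _))

theorem bocksteinSource_eq_zero {a : A} {y : bocksteinPairs D F Z a} :
    bocksteinSource D F E Z a y = 0 ↔ y.1.1 ∈ supMultiples E a :=
  Submodule.Quotient.mk_eq_zero _

theorem bocksteinTarget_eq_zero {a : A} {y : bocksteinPairs D F Z a} :
    bocksteinTarget D F Z a y = 0 ↔ (y.1.2 : C) ∈ F.map D :=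
  Submodule.Quotient.mk_eq_zero _

theorem range_bocksteinTarget_comp (a b : A) :
    LinearMap.range ((bocksteinTarget D F Z a).comp (LinearMap.lsmul A _ b)) =
      (LinearMap.ker (LinearMap.lsmul A (Z ⧸ (F.map D).submoduleOf Z) a)).map
        (LinearMap.lsmul A _ b) := by
  apply le_antisymm
  · rintro _ ⟨y, rfl⟩
    refine ⟨bocksteinTarget D F Z a y, ?_, (map_smul _ b y).symm⟩
    change a • bocksteinTarget D F Z a y = 0
    rw [← map_smul, bocksteinTarget_eq_zero]
    exact ⟨y.1.1, y.2.1, y.2.2⟩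
  · rintro _ ⟨m, hm, rfl⟩
    obtain ⟨z, rfl⟩ := Submodule.mkQ_surjective _ m
    obtain ⟨y, hy, hyz⟩ : ((a • z : Z) : C) ∈ F.map D := by
      have : ((F.map D).submoduleOf Z).mkQ (a • z) = 0 := hm
      rwa [Submodule.mkQ_apply, Submodule.Quotient.mk_eq_zero] at this
    exact ⟨⟨(y, z), hy, hyz⟩, rfl⟩

/-- Exactness in the middle: if `D y = a z` and `z = D u`, then `y - a u` is a cocycle with the same
class modulo `a` as `y`. -/
theorem ker_bocksteinTarget_le {Z₀ : Submodule A C} (hZ₀ : F ⊓ LinearMap.ker D ≤ Z₀) (a : A) :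
    LinearMap.ker (bocksteinTarget D F Z a) ≤
      LinearMap.ker ((Z₀.map (supMultiples E a).mkQ).mkQ.comp (bocksteinSource D F E Z a)) := by
  intro y hy
  obtain ⟨u, hu, hdu⟩ := (bocksteinTarget_eq_zero D F Z).mp hy
  change Submodule.mkQ _ (bocksteinSource D F E Z a y) = 0
  refine (Submodule.Quotient.mk_eq_zero _).mpr ⟨y.1.1 - a • u, hZ₀ ⟨?_, ?_⟩, ?_⟩
  · exact sub_mem y.2.1 (Submodule.smul_mem _ a hu)
  · change D (y.1.1 - a • u) = 0
    rw [map_sub, map_smul, hdu, y.2.2, sub_self]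
  · rw [map_sub]
    refine sub_eq_self.mpr ?_
    exact (Submodule.Quotient.mk_eq_zero _).mpr (smul_mem_supMultiples E a u)

/-- The connecting map is well defined: if `y = a u + w` with `w` in `E`, then `a z = D y = a D u`,
and cancelling `a` exhibits `z` as the coboundary of `u`. -/
theorem ker_bocksteinSource_le (hEF : E ≤ F) (hED : E ≤ LinearMap.ker D) {a : A}
    (ha : ∀ u : C, a • u = 0 → u = 0) (haF : ∀ u : C, a • u ∈ F → u ∈ F) :
    LinearMap.ker (bocksteinSource D F E Z a) ≤ LinearMap.ker (bocksteinTarget D F Z a) := by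
  intro y hy
  obtain ⟨u, w, hw, hyu⟩ := (mem_supMultiples E).mp ((bocksteinSource_eq_zero D F E Z).mp hy)
  rw [LinearMap.mem_ker, bocksteinTarget_eq_zero]
  refine ⟨u, haF u ?_, ?_⟩
  · rw [eq_sub_of_add_eq hyu.symm]
    exact sub_mem y.2.1 (hEF hw)
  · rw [← sub_eq_zero]
    refine ha _ ?_
    rw [smul_sub, ← y.2.2, hyu, map_add, LinearMap.mem_ker.mp (hED hw), map_smul, add_zero,
      sub_self]

variable {B : ℕ → Subring A} {q : ℕ}

theorem submoduleLength_map_mkQ_le (Z₀ : Submodule A C) (a : A) :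
    submoduleLength B q (Z₀.map (supMultiples E a).mkQ) ≤
      submoduleLength B q (⊤ : Submodule A (Z₀ ⧸ E.submoduleOf Z₀)) := by
  let f : Z₀ ⧸ E.submoduleOf Z₀ →ₗ[A] C ⧸ supMultiples E a :=
    Submodule.liftQ _ ((supMultiples E a).mkQ.comp Z₀.subtype) (by
      intro z hz
      exact (Submodule.Quotient.mk_eq_zero _).mpr
        ((le_sup_right : _ ≤ supMultiples E a) hz))
  refine le_trans (submoduleLength_mono B q ?_) (submoduleLength_map_le B q ⊤ f)
  rintro _ ⟨z, hz, rfl⟩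
  exact ⟨Submodule.mkQ _ ⟨z, hz⟩, trivial, Submodule.liftQ_apply _ _ _⟩

variable [∀ e, IsLocalRing (B e)]

/-- The part of the cohomology modulo `a` that the connecting map kills comes from the cohomology at
`Z₀`, which has length zero. -/
theorem IsLengthTower.submoduleLength_range_bocksteinSource_le (h : IsLengthTower B q)
    {Z₀ : Submodule A C} (hZ₀ : F ⊓ LinearMap.ker D ≤ Z₀) (a b : A)
    (hzero : submoduleLength B q (⊤ : Submodule A (Z₀ ⧸ E.submoduleOf Z₀)) = 0) :
    submoduleLength B q
        (LinearMap.range ((bocksteinSource D F E Z a).comp (LinearMap.lsmul A _ b))) ≤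
      submoduleLength B q
        (LinearMap.range ((bocksteinTarget D F Z a).comp (LinearMap.lsmul A _ b))) := by
  refine (h.submoduleLength_le_add _ (Z₀.map (supMultiples E a).mkQ).mkQ).trans ?_
  have h1 : submoduleLength B q (LinearMap.range ((bocksteinSource D F E Z a).comp
      (LinearMap.lsmul A _ b)) ⊓ LinearMap.ker (Z₀.map (supMultiples E a).mkQ).mkQ) = 0 := by
    rw [← nonpos_iff_eq_zero, Submodule.ker_mkQ]
    refine (submoduleLength_mono B q inf_le_right).trans ?_
    exact (submoduleLength_map_mkQ_le E Z₀ a).trans hzero.le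
  rw [h1, zero_add, ← LinearMap.range_comp, ← LinearMap.comp_assoc]
  exact submoduleLength_range_comp_le (ker_bocksteinTarget_le D F E Z hZ₀ a) _

/-- Let `c ^ p = p`, and let `φ` be an injective Frobenius-semilinear map from cochains modulo `c`
to cochains modulo `p`. If `b` times the cohomology at `Z` has finite length and the cohomology
at `Z₀` has length zero, then `b` times the `c`-torsion of the cohomology at `Z` has
length zero. -/
theorem submoduleLength_torsion_eq_zero (h : IsLengthTower B q) {p : ℕ}
    (hB : IsPerfectTower B p) (hpq : p < q) {c : A} (hc : c ^ p = p)
    {Z₀ : Submodule A C} (hZ₀ : F ⊓ LinearMap.ker D ≤ Z₀) (hEF : E ≤ F)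
    (hED : E ≤ LinearMap.ker D) (hcC : ∀ u : C, c • u = 0 → u = 0)
    (hcF : ∀ u : C, c • u ∈ F → u ∈ F)
    (φ : (C ⧸ supMultiples E c) →+ (C ⧸ supMultiples E (p : A))) (hφ : Function.Injective φ)
    (hsmul : ∀ (r : A) y, φ (r • y) = r ^ p • φ y)
    (hφF : ∀ y : bocksteinPairs D F Z c, ∃ z : bocksteinPairs D F Z (p : A),
      φ (bocksteinSource D F E Z c y) = bocksteinSource D F E Z (p : A) z) (b : A)
    (hzero : submoduleLength B q (⊤ : Submodule A (Z₀ ⧸ E.submoduleOf Z₀)) = 0)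
    (hfin : submoduleLength B q
      (LinearMap.range (LinearMap.lsmul A (Z ⧸ (F.map D).submoduleOf Z) b)) < ⊤) :
    submoduleLength B q ((LinearMap.ker (LinearMap.lsmul A (Z ⧸ (F.map D).submoduleOf Z) c)).map
      (LinearMap.lsmul A _ b)) = 0 := by
  set r := submoduleLength B q
    ((LinearMap.ker (LinearMap.lsmul A (Z ⧸ (F.map D).submoduleOf Z) c)).map
      (LinearMap.lsmul A _ b)) with hr
  have h1 : r ≤ submoduleLength B q
      (LinearMap.range ((bocksteinSource D F E Z c).comp (LinearMap.lsmul A _ b))) := by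
    rw [hr, ← range_bocksteinTarget_comp]
    exact submoduleLength_range_comp_le (ker_bocksteinSource_le D F E Z hEF hED hcC hcF) _
  have h2 : submoduleLength B q (LinearMap.range ((bocksteinSource D F E Z (p : A)).comp
      (LinearMap.lsmul A _ (b ^ p)))) ≤ p * r := by
    refine (h.submoduleLength_range_bocksteinSource_le D F E Z hZ₀ (p : A) (b ^ p) hzero).trans ?_
    rw [range_bocksteinTarget_comp, ← hc]
    exact h.submoduleLength_ker_pow_le b c p
  have h3 : q * submoduleLength B q
        (LinearMap.range ((bocksteinSource D F E Z c).comp (LinearMap.lsmul A _ b))) ≤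
      submoduleLength B q (LinearMap.range ((bocksteinSource D F E Z (p : A)).comp
        (LinearMap.lsmul A _ (b ^ p)))) := by
    refine hB.mul_submoduleLength_le φ hφ hsmul ?_ (by omega) _ _ ?_
    · intro y
      obtain ⟨y, rfl⟩ := Submodule.mkQ_surjective _ y
      exact (Submodule.Quotient.mk_eq_zero _).mpr (smul_mem_supMultiples E (p : A) y)
    · rintro _ ⟨y, rfl⟩
      obtain ⟨z, hz⟩ := hφF y
      refine ⟨z, ?_⟩
      change bocksteinSource D F E Z (p : A) (b ^ p • z) =
        φ (bocksteinSource D F E Z c (b • y))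
      rw [map_smul, map_smul, hsmul, hz]
  have h4 : (q : ℝ≥0∞) * r ≤ p * r := (mul_le_mul_right h1 _).trans (h3.trans h2)
  -- The bound `q r ≤ p r` is informative only for finite `r`; finiteness is inherited from `b`
  -- times the whole cohomology.
  have hrt : r ≠ ⊤ := by
    refine ((submoduleLength_mono B q ?_).trans_lt hfin).ne
    rw [← Submodule.map_top]
    exact Submodule.map_mono le_top
  by_contra hr0
  have h5 := (ENNReal.mul_le_mul_iff_left hr0 hrt).mp h4
  exact absurd (by exact_mod_cast h5) (not_le.mpr hpq)

end Bockstein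

/-! ### Injectivity of Frobenius on Čech cochains modulo coboundaries. -/

section CechFrobenius

variable {A : Type u} [CommRing A] {d : ℕ} (x : Fin d → A)
  (T : Type w) [CommRing T] [Algebra A T]

theorem cechSupported_succ (j : ℕ) : cechSupported x T (fun I => I.card + 1 = j + 1) =
    cechSupported x T (fun I => I.card = j) := by
  simp only [add_left_inj]

theorem cechCoboundaries_le (j : ℕ) : cechCoboundaries x T j ≤ cechCocycles x T j := by
  rintro _ ⟨y, hy, rfl⟩
  exact ⟨cechDifferential_mem_supported x T hy, cechDifferential_cechDifferential x T y⟩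

theorem mem_supMultiples_cechCoboundaries {a : A} {j : ℕ} {y : CechTotal x T} :
    y ∈ supMultiples (cechCoboundaries x T j) a ↔
      ∃ u, ∃ w ∈ cechSupported x T (fun I => I.card + 1 = j),
        y = a • u + cechDifferential x T w := by
  rw [mem_supMultiples]
  constructor
  · rintro ⟨u, _, ⟨w, hw, rfl⟩, rfl⟩
    exact ⟨u, w, hw, rfl⟩
  · rintro ⟨u, w, hw, rfl⟩
    exact ⟨u, _, ⟨w, hw, rfl⟩, rfl⟩

variable {p : ℕ} {c : A}

/-- Frobenius from cochains modulo `p^{1/p}` to cochains modulo `p`. -/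
theorem exists_cechFrobenius (j : ℕ) (hp : p.Prime) (hc : c ^ p = p) :
    ∃ φ : (CechTotal x T ⧸ supMultiples (cechCoboundaries x T j) c) →+
      (CechTotal x T ⧸ supMultiples (cechCoboundaries x T j) (p : A)),
      ∀ y, φ ((supMultiples (cechCoboundaries x T j) c).mkQ y) = (supMultiples (cechCoboundaries x T j) (p : A)).mkQ (y ^ p) := by
  have hmod : ∀ u, (supMultiples (cechCoboundaries x T j) (p : A)).mkQ ((p : A) • u) = 0 := fun u =>
    (Submodule.Quotient.mk_eq_zero _).mpr
      ((mem_supMultiples_cechCoboundaries x T).mpr ⟨u, 0, zero_mem _, by rw [map_zero, add_zero]⟩)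
  have hcast : ∀ u : CechTotal x T, (p : CechTotal x T) * u = (p : A) • u := fun u => by
    rw [Nat.cast_smul_eq_nsmul, nsmul_eq_mul]
  have hadd : ∀ y z : CechTotal x T, (supMultiples (cechCoboundaries x T j) (p : A)).mkQ ((y + z) ^ p) =
      (supMultiples (cechCoboundaries x T j) (p : A)).mkQ (y ^ p) +
        (supMultiples (cechCoboundaries x T j) (p : A)).mkQ (z ^ p) := by
    intro y z
    obtain ⟨r, hr⟩ := exists_add_pow_prime_eq hp y z
    rw [hr, mul_assoc, mul_assoc, hcast, map_add, map_add, hmod, add_zero]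
  let ψ : CechTotal x T →+ (CechTotal x T ⧸ supMultiples (cechCoboundaries x T j) (p : A)) :=
    AddMonoidHom.mk' (fun y => (supMultiples (cechCoboundaries x T j) (p : A)).mkQ (y ^ p)) hadd
  have hψ : ∀ y ∈ (supMultiples (cechCoboundaries x T j) c).toAddSubgroup, ψ y = 0 := by
    intro y hy
    obtain ⟨u, w, hw, rfl⟩ := (mem_supMultiples_cechCoboundaries x T).mp hy
    obtain ⟨r, hr⟩ := cechDifferential_pow x T hp w
    change (supMultiples (cechCoboundaries x T j) (p : A)).mkQ ((c • u + cechDifferential x T w) ^ p) = 0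
    -- Modulo `p` one has `(c u + D w)^p ≡ c^p u^p + D(w^p)`, and `c^p = p`.
    rw [hadd, smul_pow, hc, hmod, zero_add, eq_sub_of_add_eq hr.symm, map_sub, hmod, sub_zero]
    refine (Submodule.Quotient.mk_eq_zero _).mpr
      ((mem_supMultiples_cechCoboundaries x T).mpr ⟨0, w ^ p, fun I hI => ?_, by rw [smul_zero, zero_add]⟩)
    rw [Pi.pow_apply, hw I hI, zero_pow hp.ne_zero]
  exact ⟨QuotientAddGroup.lift (supMultiples (cechCoboundaries x T j) c).toAddSubgroup ψ hψ, fun y => rfl⟩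

variable [IsDomain A] [IsDomain T] (hinj : Function.Injective (algebraMap A T))
  (hx : ∀ i, x i ≠ 0)
include hinj hx

theorem cechTotal_smul_eq_zero {a : A} (ha : a ≠ 0) {z : CechTotal x T} (h : a • z = 0) :
    z = 0 :=
  funext fun I => localizedModule_smul_eq_zero T hinj (cechMonoid_ne_zero x hx I) ha
    (congrFun h I)

theorem mem_cechSupported_of_smul_mem {a : A} (ha : a ≠ 0) {P : Finset (Fin d) → Prop}
    {z : CechTotal x T} (h : a • z ∈ cechSupported x T P) : z ∈ cechSupported x T P :=
  fun I hI => localizedModule_smul_eq_zero T hinj (cechMonoid_ne_zero x hx I) ha (h I hI)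

theorem mem_cechCocycles_of_smul_mem {a : A} (ha : a ≠ 0) {j : ℕ} {z : CechTotal x T}
    (h : a • z ∈ cechCocycles x T j) : z ∈ cechCocycles x T j := by
  refine ⟨mem_cechSupported_of_smul_mem x T hinj hx ha h.1,
    cechTotal_smul_eq_zero x T hinj hx ha ?_⟩
  rw [← map_smul]
  exact h.2

/-- Suppose `y^p = p u + D z`. Surjectivity of Frobenius modulo `p` gives `z = w^p + p r`, so `(y -
D w)^p` is divisible by `p` in every localization. Integral closedness then makes `y - D w`
divisible by `c`. -/
theorem pow_mem_supMultiples [IsIntegrallyClosed T] (hp : p.Prime) (hc : c ^ p = p)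
    (hF : ∀ t : T, ∃ y z : T, t = y ^ p + p * z)
    {j : ℕ} {y : CechTotal x T} (h : y ^ p ∈ supMultiples (cechCoboundaries x T j) (p : A)) :
    y ∈ supMultiples (cechCoboundaries x T j) c := by
  have hcast : ∀ u : CechTotal x T, (p : CechTotal x T) * u = (p : A) • u := fun u => by
    rw [Nat.cast_smul_eq_nsmul, nsmul_eq_mul]
  obtain ⟨u, z, hz, hyz⟩ := (mem_supMultiples_cechCoboundaries x T).mp h
  choose w r hw hw0 using fun I => localizedModule_exists_pow_eq T hp.ne_zero hF (z I)
  have hzw : z = (w : CechTotal x T) ^ p + (p : A) • (r : CechTotal x T) := funext hw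
  obtain ⟨s, hs⟩ := cechDifferential_pow x T hp w
  obtain ⟨t, ht⟩ := exists_add_pow_prime_eq hp (y - cechDifferential x T w)
    (cechDifferential x T w)
  rw [sub_add_cancel, mul_assoc, mul_assoc, hcast, hyz, hzw, map_add, hs, map_smul] at ht
  have h1 : (y - cechDifferential x T w) ^ p = (p : A) • (u + s + cechDifferential x T r -
      (y - cechDifferential x T w) * (cechDifferential x T w * t)) := by
    rw [smul_sub, smul_add, smul_add, eq_sub_iff_add_eq]
    rw [← sub_eq_zero] at ht ⊢
    rw [← neg_eq_zero, ← ht]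
    abel
  choose v hv using fun I => localizedModule_root_dvd T hinj (cechMonoid_ne_zero x hx I)
    hp.ne_zero hc (congrFun h1 I)
  refine (mem_supMultiples_cechCoboundaries x T).mpr ⟨v, w, fun I hI => hw0 I (hz I hI), ?_⟩
  rw [← sub_eq_iff_eq_add]
  exact funext hv

theorem submoduleLength_cechCohomology_torsion_eq_zero [IsIntegrallyClosed T]
    {B : ℕ → Subring A} [∀ e, IsLocalRing (B e)] {q : ℕ} (h : IsLengthTower B q)
    (hB : IsPerfectTower B p) (hpq : p < q) (hp : p.Prime) (hc : c ^ p = p) (hp0 : (p : A) ≠ 0)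
    (hF : ∀ t : T, ∃ y z : T, t = y ^ p + p * z) (b : A) (j : ℕ)
    (hzero : submoduleLength B q (⊤ : Submodule A (CechCohomology x T j)) = 0)
    (hfin : submoduleLength B q
      (LinearMap.range (LinearMap.lsmul A (CechCohomology x T (j + 1)) b)) < ⊤) :
    submoduleLength B q ((LinearMap.ker (LinearMap.lsmul A (CechCohomology x T (j + 1)) c)).map
      (LinearMap.lsmul A _ b)) = 0 := by
  have hc0 : c ≠ 0 := by
    rintro rfl
    rw [zero_pow hp.ne_zero] at hc
    exact hp0 hc.symm
  obtain ⟨φ, hφ⟩ := exists_cechFrobenius x T j hp hc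
  refine submoduleLength_torsion_eq_zero (cechDifferential x T)
    (cechSupported x T (fun I => I.card + 1 = j + 1)) (cechCoboundaries x T j)
    (cechCocycles x T (j + 1)) h hB hpq hc (Z₀ := cechCocycles x T j) ?_ ?_ ?_
    (fun u hu => cechTotal_smul_eq_zero x T hinj hx hc0 hu)
    (fun u hu => mem_cechSupported_of_smul_mem x T hinj hx hc0 hu) φ ?_ ?_ ?_ b hzero hfin
  · rw [cechSupported_succ]
    exact le_rfl
  · rw [cechSupported_succ]
    exact (cechCoboundaries_le x T j).trans inf_le_left
  · exact (cechCoboundaries_le x T j).trans inf_le_right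
  · rw [injective_iff_map_eq_zero]
    intro y hy
    obtain ⟨y, rfl⟩ := Submodule.mkQ_surjective _ y
    rw [hφ] at hy
    exact (Submodule.Quotient.mk_eq_zero _).mpr (pow_mem_supMultiples x T hinj hx hp hc hF
      ((Submodule.Quotient.mk_eq_zero _).mp hy))
  · intro r y
    obtain ⟨y, rfl⟩ := Submodule.mkQ_surjective _ y
    rw [← map_smul, hφ, hφ, smul_pow, map_smul]
  · intro y
    -- From `D y = c z` follows `D(y^p) = p (z^p + u)`. Since cochains have no `p`-torsion, `z^p +
    -- u` is again a cocycle, so `y^p` is the first member of a pair for `p`.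
    obtain ⟨u, hu⟩ := cechDifferential_pow x T hp y.1.1
    rw [y.2.2, smul_pow, hc, ← smul_add] at hu
    have hy : y.1.1 ^ p ∈ cechSupported x T (fun I => I.card + 1 = j + 1) := fun I hI => by
      rw [Pi.pow_apply, y.2.1 I hI, zero_pow hp.ne_zero]
    have h1 : (y.1.2 : CechTotal x T) ^ p + u ∈ cechCocycles x T (j + 1) := by
      refine mem_cechCocycles_of_smul_mem x T hinj hx hp0 ?_
      rw [← hu]
      exact cechCoboundaries_le x T (j + 1) ⟨_, hy, rfl⟩
    exact ⟨⟨(y.1.1 ^ p, ⟨_, h1⟩), hy, hu⟩, hφ _⟩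

end CechFrobenius

/-! ### Čech cohomology in positive degrees is torsion. -/

section CechTorsion

variable {A : Type u} [CommRing A] {n : ℕ} (x : Fin (n + 1) → A)
  (T : Type w) [CommRing T] [Algebra A T]

/-- Only the face that removes `0` avoids the index `0`; it carries the sign `+1` because `0` is the
least index. -/
theorem cechDifferential_insert_zero {I : Finset (Fin (n + 1))} (hI : 0 ∉ I) {c : CechTotal x T}
    (hc : ∀ K, 0 ∈ K → c K = 0) :
    cechDifferential x T c (insert 0 I) = cechFace x T (insert 0 I) I c := by
  rw [cechDifferential_apply, Finset.sum_insert hI, Finset.erase_insert hI,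
    Finset.sum_eq_zero, add_zero]
  · have h1 : (insert 0 I).filter (· < (0 : Fin (n + 1))) = ∅ :=
      Finset.filter_eq_empty_iff.mpr fun i _ => Fin.not_lt_zero i
    rw [h1, Finset.card_empty, pow_zero, one_smul]
  · intro i hi
    have hi0 : (0 : Fin (n + 1)) ≠ i := by
      rintro rfl
      exact hI hi
    rw [cechFace_eq_zero x T (hc _ (Finset.mem_erase.mpr ⟨hi0, Finset.mem_insert_self 0 I⟩)),
      smul_zero]

theorem exists_pow_smul_eq_liftOfLE (i : Fin (n + 1)) (I : Finset (Fin (n + 1)))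
    (z : LocalizedModule (cechMonoid x (insert i I)) T) :
    ∃ (t : ℕ) (b : LocalizedModule (cechMonoid x I) T),
      x i ^ t • z = LocalizedModule.liftOfLE (M := T) (cechMonoid x I)
        (cechMonoid x (insert i I)) (cechMonoid_mono x (Finset.subset_insert i I)) b := by
  induction z using LocalizedModule.induction_on with
  | _ m s =>
    have h1 : (s : A) ∈ Submonoid.closure {x i} ⊔ cechMonoid x I := by
      rw [cechMonoid, ← Submonoid.closure_union, Set.singleton_union, ← Set.image_insert_eq,
        ← Finset.coe_insert]
      exact s.2
    obtain ⟨_, ha, a, haI, hs⟩ := Submonoid.mem_sup.mp h1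
    obtain ⟨t, rfl⟩ := Submonoid.mem_closure_singleton.mp ha
    refine ⟨t, LocalizedModule.mk m ⟨a, haI⟩, ?_⟩
    rw [liftOfLE_mk, LocalizedModule.smul'_mk, LocalizedModule.mk_eq]
    refine ⟨1, ?_⟩
    rw [one_smul, one_smul]
    change a • x i ^ t • m = (s : A) • m
    rw [smul_smul, ← hs, mul_comm]

variable [IsDomain A] [IsDomain T] (hinj : Function.Injective (algebraMap A T))
  (hx : ∀ i, x i ≠ 0)
include hinj hx

/-- Čech cohomology in positive degrees is torsion with respect to the first element. -/
theorem exists_pow_smul_mem_cechCoboundaries (j : ℕ) {z : CechTotal x T}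
    (hz : z ∈ cechCocycles x T (j + 1)) :
    ∃ t : ℕ, x 0 ^ t • z ∈ cechCoboundaries x T (j + 1) := by
  classical
  choose t b hb using fun I : Finset (Fin (n + 1)) =>
    exists_pow_smul_eq_liftOfLE x T 0 I (z (insert 0 I))
  let N := ∑ I, t I
  have hN : ∀ I, t I ≤ N := fun I => Finset.single_le_sum (fun _ _ => zero_le) (Finset.mem_univ I)
  -- This is a contracting homotopy after inverting `x 0`: the component of `z` at `insert 0 I`,
  -- multiplied by `x 0 ^ N`, has no denominator `x 0` left and is placed at `I`.
  let y : CechTotal x T := fun I =>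
    if 0 ∉ I ∧ I.card + 1 = j + 1 then x 0 ^ (N - t I) • b I else 0
  have hy : y ∈ cechSupported x T (fun I => I.card + 1 = j + 1) := fun I hI =>
    if_neg fun h => hI h.2
  have hy0 : ∀ K, 0 ∈ K → y K = 0 := fun K hK => if_neg fun h => h.1 hK
  let u := x 0 ^ N • z - cechDifferential x T y
  have hu : u ∈ cechCocycles x T (j + 1) :=
    sub_mem (Submodule.smul_mem _ _ hz) (cechCoboundaries_le x T (j + 1) ⟨y, hy, rfl⟩)
  have hu0 : ∀ K, 0 ∈ K → u K = 0 := by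
    intro K hK
    by_cases hKj : K.card = j + 1
    · obtain ⟨I, hI, rfl⟩ : ∃ I, 0 ∉ I ∧ insert 0 I = K :=
        ⟨K.erase 0, Finset.notMem_erase 0 K, Finset.insert_erase hK⟩
      rw [Finset.card_insert_of_notMem hI] at hKj
      change x 0 ^ N • z (insert 0 I) - cechDifferential x T y (insert 0 I) = 0
      rw [cechDifferential_insert_zero x T hI hy0, cechFace_apply x T (Finset.subset_insert 0 I)]
      have h1 : y I = x 0 ^ (N - t I) • b I := if_pos ⟨hI, hKj⟩
      rw [h1, map_smul, ← hb, smul_smul, ← pow_add, Nat.sub_add_cancel (hN I), sub_self]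
    · exact hu.1 K hKj
  -- The cocycle `u` vanishes at all sets containing `0`, so its component at any other `I` dies in
  -- the localization at `insert 0 I`, into which it embeds.
  have hu1 : u = 0 := by
    funext I
    by_cases hI : 0 ∈ I
    · exact hu0 I hI
    · have h1 : cechDifferential x T u (insert 0 I) = 0 := congrFun hu.2 _
      rw [cechDifferential_insert_zero x T hI hu0,
        cechFace_apply x T (Finset.subset_insert 0 I)] at h1
      exact (injective_iff_map_eq_zero _).mp (liftOfLE_injective T hinj
        (cechMonoid_ne_zero x hx (insert 0 I)) _) _ h1
  exact ⟨N, y, hy, (sub_eq_zero.mp hu1).symm⟩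

theorem exists_pow_smul_cechCohomology_eq_zero (j : ℕ) (m : CechCohomology x T (j + 1)) :
    ∃ t : ℕ, x 0 ^ t • m = 0 := by
  obtain ⟨z, rfl⟩ := Submodule.mkQ_surjective _ m
  obtain ⟨t, ht⟩ := exists_pow_smul_mem_cechCoboundaries x T hinj hx j z.2
  refine ⟨t, ?_⟩
  rw [← map_smul, Submodule.mkQ_apply, Submodule.Quotient.mk_eq_zero]
  exact ht

end CechTorsion

/-! ### From vanishing length of the torsion to almost vanishing. -/

section AlmostZero

variable {p n : ℕ} [Fact p.Prime] {V : Type u} [CommRing V] [IsLocalRing V] [IsDomain V]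
  [hV : Fact (maximalIdeal V = Ideal.span {(p : V)})] [IsNoetherianRing V]
  {v : AddValuation (RInf p n V) (WithTop ℚ)}

omit [IsLocalRing V] [IsDomain V] hV [IsNoetherianRing V] in
theorem algebraMap_baseGen (i : Fin (n + 1)) :
    algebraMap (BaseRing n V) (RInf p n V) (baseGen p n V i) = params p n V i := by
  refine Fin.cases ?_ (fun i => ?_) i
  · exact map_natCast _ p
  · rfl

omit [IsNoetherianRing V] in
theorem ExtendsMAdic.params_ne_zero (hv : ExtendsMAdic v) (hp0 : (p : V) ≠ 0)
    (i : Fin (n + 1)) : params p n V i ≠ 0 := by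
  intro h
  have h1 := hv (baseGen p n V i) 1 (by simpa using baseGen_mem p n V i)
    (baseGen_notMem p n V hp0 i)
  rw [algebraMap_baseGen, h, v.map_zero] at h1
  exact WithTop.top_ne_coe h1

omit [IsLocalRing V] [IsDomain V] hV [IsNoetherianRing V] in
theorem exists_pow_eq_natCast : ∃ c : RInf p n V, c ^ p = p := by
  refine ⟨levelToRInf p n V 1 (levelGen p n V 1 0), ?_⟩
  have h := levelToRInf_baseToLevel p n V 1 (baseGen p n V 0)
  rw [baseToLevel_baseGen, map_pow, algebraMap_baseGen] at h
  exact (by simpa only [pow_one] using h : _ = params p n V 0)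

/-- If the images under elements of small valuation of the `c`-torsion have length zero, then a
module that is torsion with respect to a power of `c` is almost zero. -/
theorem ExtendsMAdic.isAlmostZero_of_torsion (hv : ExtendsMAdic v) (hp0 : (p : V) ≠ 0)
    {M : Type w} [AddCommGroup M] [Module (RInf p n V) M] (c : RInf p n V)
    (hc : ∀ m : M, ∃ i : ℕ, c ^ i • m = 0)
    (h : ∀ ε : ℚ, 0 < ε → ∃ b : RInf p n V,
      submoduleLength (levelSubring p n V) (p ^ (n + 1))
        ((LinearMap.ker (LinearMap.lsmul (RInf p n V) M c)).map
          (LinearMap.lsmul (RInf p n V) M b)) = 0 ∧ v b < (ε : WithTop ℚ)) :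
    IsAlmostZero v M := by
  intro m ε hε
  obtain ⟨i, hi⟩ := hc m
  have hi0 : (0 : ℚ) < 2 * (i + 1) := by positivity
  -- The element `b` is chosen after `i`, so that `b^i` uses at most half of `ε`; the other half is
  -- left for the annihilator of `b^i m`. Using `i + 1` avoids division by zero.
  obtain ⟨b, hb, hvb⟩ := h (ε / (2 * (i + 1))) (by positivity)
  have h1 : spanLength (levelSubring p n V) (p ^ (n + 1)) {b ^ i • m} = 0 := by
    rw [← nonpos_iff_eq_zero]
    refine (spanLength_le_submoduleLength _ _ (Set.finite_singleton _)
      (P := (LinearMap.ker (LinearMap.lsmul (RInf p n V) M (c ^ i))).map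
        (LinearMap.lsmul (RInf p n V) M (b ^ i))) ?_).trans ?_
    · rw [Set.singleton_subset_iff]
      exact ⟨m, hi, rfl⟩
    · refine ((isLengthTower_levelSubring p n V).submoduleLength_ker_pow_le b c i).trans ?_
      rw [hb, mul_zero]
  obtain ⟨a, ha, hva⟩ := hv.exists_smul_eq_zero hp0 _ h1 (half_pos hε)
  refine ⟨a * b ^ i, by rw [mul_smul, ha], ?_⟩
  rw [v.map_mul, v.map_pow]
  obtain ⟨r, hr⟩ := WithTop.ne_top_iff_exists.mp hvb.ne_top
  obtain ⟨s, hs⟩ := WithTop.ne_top_iff_exists.mp hva.ne_top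
  rw [← hr, WithTop.coe_lt_coe] at hvb
  rw [← hs, WithTop.coe_lt_coe] at hva
  rw [← hr, ← hs, ← WithTop.coe_nsmul, ← WithTop.coe_add, WithTop.coe_lt_coe, nsmul_eq_mul]
  rw [lt_div_iff₀ hi0] at hvb
  have h2 : (i : ℚ) * r ≤ ε / 2 := by
    rcases le_or_gt r 0 with h0 | h0
    · exact (mul_nonpos_of_nonneg_of_nonpos (Nat.cast_nonneg i) h0).trans (half_pos hε).le
    · nlinarith
  linarith

end AlmostZero

theorem theorem3p4
    -- `V` is a complete discrete valuation ring of mixed characteristic with maximal ideal `pV`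
    -- and perfect residue field; `R = V[[x_2, …, x_d]]` with `d = n + 1`
    (p : ℕ) [Fact p.Prime] (n : ℕ)
    (V : Type*) [CommRing V] [IsDomain V] [IsDiscreteValuationRing V]
    (hV : IsLocalRing.maximalIdeal V = Ideal.span {(p : V)})
    [IsAdicComplete (IsLocalRing.maximalIdeal V) V]
    [PerfectField (IsLocalRing.ResidueField V)]
    -- `v` is a valuation on `R_∞` that extends the `𝔪`-adic valuation of `R`
    (v : AddValuation (RInf p n V) (WithTop ℚ)) (hv : ExtendsMAdic v)
    -- `R → S` is a module-finite extension of domains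
    (S : Type*) [CommRing S] [IsDomain S] [Algebra (BaseRing n V) S]
    [Module.Finite (BaseRing n V) S]
    (hS : Function.Injective (algebraMap (BaseRing n V) S))
    -- `T = S_∞` is a semi-perfect algebra over `S`
    (T : Type*) [CommRing T] [Algebra S T] [Algebra (RInf p n V) T]
    (hT : IsSemiPerfect p n V S T)
    (k : ℕ) (hk : 0 < k) (hkd : k < n + 1)
    (hzero : normalizedLength p n V (LocalCohomologyM p n V (k - 1) T) = 0)
    (hfin : HasAlmostFiniteLength v (LocalCohomologyM p n V k T)) :
    IsAlmostZero v (LocalCohomologyM p n V k T) := by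
  obtain ⟨j, rfl⟩ := Nat.exists_eq_succ_of_ne_zero hk.ne'
  have hp : p.Prime := Fact.out
  have : Fact (maximalIdeal V = Ideal.span {(p : V)}) := ⟨hV⟩
  have := hT.isDomain
  have := hT.isIntegrallyClosed
  have hinj := hT.injective_right
  have : IsDomain (RInf p n V) := hinj.isDomain (algebraMap (RInf p n V) T)
  have hp0 : (p : V) ≠ 0 := by
    intro h
    rw [h, Ideal.span_singleton_eq_bot.mpr rfl] at hV
    exact IsDiscreteValuationRing.not_a_field V hV
  have hx := hv.params_ne_zero hp0
  obtain ⟨c, hc⟩ := exists_pow_eq_natCast (p := p) (n := n) (V := V)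
  have hF : ∀ t : T, ∃ y z : T, t = y ^ p + p * z := by
    intro t
    obtain ⟨y, hy⟩ := hT.frobenius_surjective (Ideal.Quotient.mk _ t)
    obtain ⟨y, rfl⟩ := Ideal.Quotient.mk_surjective y
    have h1 : Ideal.Quotient.mk (Ideal.span {(p : T)}) t = Ideal.Quotient.mk _ (y ^ p) := by
      rw [map_pow]
      exact hy.symm
    obtain ⟨z, hz⟩ := Ideal.mem_span_singleton.mp (Ideal.Quotient.eq.mp h1)
    exact ⟨y, z, by rw [← hz, add_sub_cancel]⟩
  refine hv.isAlmostZero_of_torsion hp0 c (fun m => ?_) fun ε hε => ?_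
  · obtain ⟨t, ht⟩ := exists_pow_smul_cechCohomology_eq_zero (params p n V) T hinj hx j m
    -- The first parameter is `p = c^p`, so its `t`-th power is `c^{pt}`.
    refine ⟨p * t, ?_⟩
    rw [pow_mul, hc]
    exact ht
  · obtain ⟨b, hb, hvb⟩ := hfin ε hε
    refine ⟨b, ?_, hvb⟩
    rw [normalizedLength_eq_submoduleLength] at hb
    rw [normalizedLength_eq_submoduleLength_top] at hzero
    refine submoduleLength_cechCohomology_torsion_eq_zero (params p n V) T hinj hx
      (isLengthTower_levelSubring p n V) (isPerfectTower_levelSubring p n V) ?_ hp hc (hx 0) hF b j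
      hzero hb
    -- The strict inequality `p < p^d` requires `d = n + 1 > 1`, which follows from `0 < k < d`.
    exact lt_self_pow₀ hp.one_lt (by omega)

end
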